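/- **Theorem.** *Process.* Let $\widehat g$ be one of the following two spectral filters on $\mathbb R$: - (fOU) $\widehat g(x)=c\,(\zeta^2+x^2)^{-1/2}|x|^{-d}$ with $c=\sigma\sqrt{\Gamma(2d+2)\sin(\pi(d+\tfrac12))}$, where $\zeta,\sigma>0$ and $-\tfrac12<d<\tfrac12$; - (fGLE) $\widehat g(x)=c\,(\gamma_0+\gamma_1|x|^{\beta}+\gamma_2|x|^{2\beta})^{-1/2}|x|^{d}$ with $c=\sqrt{2\zeta k_B\tau\,\Gamma(2d+2)\sin(\pi(d+\tfrac12))}$, $\beta=1+2d$, $\gamma_0=a^2+b^2$, $\gamma_1=2bm$, $\gamma_2=m^2$, $a=\zeta\,\Gamma(2d+2)\sin(\pi(d+\tfrac12))$, $b=\zeta\,\Gamma(2d+2)\cos(\pi(d+\tfrac12))$, where $m,\zeta,k_B,\tau>0$ and $0<d<\tfrac12$. A velocity process is an a.s. continuous process $V=\{V(t)\}_{t\in\mathbb R}$ with the law of $\int_{\mathbb R}e^{itx}\widehat g(x)\,\widetilde B(dx)$, where $\widetilde B$ is a complex Brownian measure with $\widetilde B(-dx)=\overline{\widetilde B(dx)}$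 and $E|\widetilde B(dx)|^2=dx$; that is, a centered stationary Gaussian process with $E\,V(s)V(t)=\int_{\mathbb R}\cos((s-t)x)\,\widehat g(x)^2dx$. *Filters.* For $j=0,1,2,\dots$ let $\widehat g_j$ be the $2\pi$-periodic function equal on $[-\pi,\pi)$ to $$\sqrt{2\pi}\,c\,(\zeta^2+2^{2j}x^2)^{-1/2}\,2^{-jd}|x|^{-d}\quad\text{(fOU)},$$ $$\sqrt{2\pi}\,c\,(\gamma_0+\gamma_12^{j\beta}|x|^\beta+\gamma_22^{2j\beta}|x|^{2\beta})^{-1/2}\,2^{jd}|x|^{d}\quad\text{(fGLE)}.$$ Let $\widehat u$ be a Meyer low-pass conjugate mirror filter of class $C^2$ with real coefficients: $\widehat u$ is $2\pi$-periodic, $\widehat u(-x)=\overline{\widehat u(x)}$, $|\widehat u(x)|^2+|\widehat u(x+\pi)|^2=2$, $\widehat u=\sqrt2$ for $|x|\le\pi/3$, $\widehat u=0$ for $2\pi/3\le|x|\le\pi$. Let $\widehat v(x)=e^{-ix}\overline{\widehat u(x+\pi)}$, and let $u_j,v_j$ be the real sequences with Fourier transforms $$\widehat u_j(x)=\frac{\widehat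 g_{j+1}(x)}{\widehat g_j(2x)}\,\widehat u(x),\qquad \widehat v_j(x)=\widehat g_{j+1}(x)\,\widehat v(x),$$ with the convention $f_k=\frac1{2\pi}\int_{-\pi}^{\pi}\widehat f(x)e^{ikx}dx$. *Algorithm.* Let $V_0=\{V_{0,k}\}_{k\in\mathbb Z}$ be a centered stationary Gaussian sequence with $E\,V_{0,k}V_{0,l}=\frac1{2\pi}\int_{-\pi}^{\pi}\cos((k-l)x)\,\widehat g_0(x)^2dx$, and let $\varepsilon_j=\{\varepsilon_{j,k}\}_{k\in\mathbb Z}$, $j\ge0$, be i.i.d. standard Gaussian variables independent of $V_0$. Define recursively $$V_{j+1}=u_j*{\uparrow_2}V_j+v_j*{\uparrow_2}\varepsilon_j,\qquad j\ge0,$$ where $({\uparrow_2}a)_k=a_{k/2}$ for even $k$ and $0$ for odd $k$. *Claim.* There is $\nu\in(0,1)$, depending only on the process, such that for every such $\widehat u$ and every probability space: for every input $(V_0,\varepsilon)$ of the algorithm there is a velocity process $V$ on the same space, and conversely for every velocity process $V$ there is an input $(V_0,\varepsilon)$ of the algorithm on the same space, such that for every compact interval $K\subset\mathbb R$ there is a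 finite random variable $A$ not depending on $J$ with, almost surely, $$\sup_{t\in K}\bigl|2^{J/2}V_{J,\lfloor 2^Jt\rfloor}-V(t)\bigr|\le A\,2^{-J\nu}\qquad\text{for all }J=0,1,2,\dots$$ -/

import Mathlib

open MeasureTheory ProbabilityTheory
open scoped Real ComplexConjugate

noncomputable section

namespace AnomalousDiffusion

/-! ### The two velocity models and their spectral filters -/

/-- Parameters of the fractional Ornstein–Uhlenbeck process
`dV = -ζ V dt + σ dB_H`, with `d = H - 1/2`. -/
structure FOUParams where
  ζ : ℝ
  σ : ℝ
  d : ℝ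
  ζ_pos : 0 < ζ
  σ_pos : 0 < σ
  d_gt : -(1 / 2) < d
  d_lt : d < 1 / 2

/-- Parameters of the fractional generalized Langevin equation: mass `m`, friction constant `ζ`,
Boltzmann constant `kB`, temperature `τ`, and `d = H - 1/2`. -/
structure FGLEParams where
  m : ℝ
  ζ : ℝ
  kB : ℝ
  τ : ℝ
  d : ℝ
  m_pos : 0 < m
  ζ_pos : 0 < ζ
  kB_pos : 0 < kB
  τ_pos : 0 < τ
  d_pos : 0 < d
  d_lt : d < 1 / 2

/-- The multiplicative constant `σ √(Γ(2d+2) sin(π(d+1/2)))` of the fOU spectral filter. -/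
def FOUParams.c (p : FOUParams) : ℝ :=
  p.σ * √(Real.Gamma (2 * p.d + 2) * Real.sin (π * (p.d + 1 / 2)))

namespace FGLEParams

/-- `β = 1 + 2d`. -/
def β (p : FGLEParams) : ℝ := 1 + 2 * p.d

/-- `a = ζ Γ(2d+2) sin(π(d+1/2))`. -/
def a (p : FGLEParams) : ℝ :=
  p.ζ * Real.Gamma (2 * p.d + 2) * Real.sin (π * (p.d + 1 / 2))

/-- `b = ζ Γ(2d+2) cos(π(d+1/2))`. -/
def b (p : FGLEParams) : ℝ :=
  p.ζ * Real.Gamma (2 * p.d + 2) * Real.cos (π * (p.d + 1 / 2))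

/-- `γ₀ = a² + b²`. -/
def γ₀ (p : FGLEParams) : ℝ := p.a ^ 2 + p.b ^ 2

/-- `γ₁ = 2 b m`. -/
def γ₁ (p : FGLEParams) : ℝ := 2 * p.b * p.m

/-- `γ₂ = m²`. -/
def γ₂ (p : FGLEParams) : ℝ := p.m ^ 2

/-- The multiplicative constant `c(d) = √(2 ζ k_B τ Γ(2d+2) sin(π(d+1/2)))` of the fGLE
spectral filter. -/
def c (p : FGLEParams) : ℝ :=
  √(2 * p.ζ * p.kB * p.τ * Real.Gamma (2 * p.d + 2) * Real.sin (π * (p.d + 1 / 2)))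

end FGLEParams

/-- The velocity process is that of the fOU or of the fGLE. -/
inductive VelocityModel where
  | fOU (p : FOUParams)
  | fGLE (p : FGLEParams)

/-- The (real, even) continuous-time spectral filter `ĝ`. -/
def spectralFilter : VelocityModel → ℝ → ℝ
  | .fOU p, x => p.c * (1 / √(p.ζ ^ 2 + x ^ 2)) * |x| ^ (-p.d)
  | .fGLE p, x =>
      p.c * (1 / √(p.γ₀ + p.γ₁ * |x| ^ p.β + p.γ₂ * |x| ^ (2 * p.β))) * |x| ^ p.d

/-- `V` is a velocity process of the model `M`: an a.s. continuous, centered, stationary Gaussian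
process with spectral density `|ĝ|²`, i.e. with the law of `V(t) = ∫ e^{itx} ĝ(x) B̃(dx)`, where
`B̃` is the Hermitian complex Brownian measure with `E|B̃(dx)|² = dx`. -/
structure IsVelocityProcess (M : VelocityModel) {Ω : Type*} [MeasurableSpace Ω] (P : Measure Ω)
    (V : ℝ → Ω → ℝ) : Prop where
  gaussian : IsGaussianProcess V P
  centered : ∀ t, ∫ ω, V t ω ∂P = 0
  covariance : ∀ s t, ∫ ω, V s ω * V t ω ∂P
    = ∫ x : ℝ, Real.cos ((s - t) * x) * spectralFilter M x ^ 2
  continuous : ∀ᵐ ω ∂P, Continuous fun t => V t ω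

/-! ### Truncated, periodically extended discretization filters -/

/-- The representative of `x` modulo `2π` in `[-π, π)`. -/
def wrap (x : ℝ) : ℝ := toIcoMod Real.two_pi_pos (-π) x

/-- `(ζ² + 2^{2j} x²)^{-1/2}`, truncated to `[-π, π)` and extended periodically. -/
def ouComponent (ζ : ℝ) (j : ℕ) (x : ℝ) : ℝ :=
  1 / √(ζ ^ 2 + 2 ^ (2 * j) * wrap x ^ 2)

/-- `2^{-jδ} |x|^{-δ}`, truncated to `[-π, π)` and extended periodically. -/
def powerComponent (δ : ℝ) (j : ℕ) (x : ℝ) : ℝ :=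
  (2 : ℝ) ^ (-(j * δ)) * |wrap x| ^ (-δ)

/-- `(γ₀ + γ₁ 2^{jβ} |x|^β + γ₂ 2^{2jβ} |x|^{2β})^{-1/2}`, truncated to `[-π, π)` and extended
periodically. -/
def gleComponent (p : FGLEParams) (j : ℕ) (x : ℝ) : ℝ :=
  1 / √(p.γ₀ + p.γ₁ * (2 : ℝ) ^ (j * p.β) * |wrap x| ^ p.β
    + p.γ₂ * (2 : ℝ) ^ (2 * j * p.β) * |wrap x| ^ (2 * p.β))

/-- The discretization filter `ĝ_j` at scale `2^{-j}` (with fractional exponent `δ = d` for the fOU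
and `δ = -d` for the fGLE). The factor `√(2π)` reconciles the normalization `E|B̃(dx)|² = dx` with
the convention `f_k = (2π)⁻¹ ∫_{-π}^{π} f̂(x) e^{ikx} dx` for discrete filters. -/
def discreteFilter : VelocityModel → ℕ → ℝ → ℝ
  | .fOU p, j, x => √(2 * π) * p.c * (ouComponent p.ζ j x * powerComponent p.d j x)
  | .fGLE p, j, x => √(2 * π) * p.c * (gleComponent p j x * powerComponent (-p.d) j x)

/-! ### Meyer conjugate mirror filters and the wavelet recursion -/

/-- `û` is the low-pass conjugate mirror filter of a Meyer multiresolution analysis (with real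
filter coefficients), of class `C²`. -/
structure IsMeyerFilter (uhat : ℝ → ℂ) : Prop where
  contDiff : ContDiff ℝ 2 uhat
  periodic : Function.Periodic uhat (2 * π)
  hermitian : ∀ x, uhat (-x) = conj (uhat x)
  mirror : ∀ x, ‖uhat x‖ ^ 2 + ‖uhat (x + π)‖ ^ 2 = 2
  pass_band : ∀ x, |x| ≤ π / 3 → uhat x = (√2 : ℝ)
  stop_band : ∀ x, 2 * π / 3 ≤ |x| → |x| ≤ π → uhat x = 0

/-- The high-pass conjugate mirror filter `v̂(x) = e^{-ix} conj(û(x + π))`. -/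
def highPass (uhat : ℝ → ℂ) (x : ℝ) : ℂ :=
  Complex.exp (-(Complex.I * x)) * conj (uhat (x + π))

/-- `û_j(x) = ĝ_{j+1}(x) / ĝ_j(2x) · û(x)`. -/
def lowFilterHat (M : VelocityModel) (uhat : ℝ → ℂ) (j : ℕ) (x : ℝ) : ℂ :=
  ((discreteFilter M (j + 1) x / discreteFilter M j (2 * x) : ℝ) : ℂ) * uhat x

/-- `v̂_j(x) = ĝ_{j+1}(x) · v̂(x)`. -/
def highFilterHat (M : VelocityModel) (uhat : ℝ → ℂ) (j : ℕ) (x : ℝ) : ℂ :=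
  (discreteFilter M (j + 1) x : ℂ) * highPass uhat x

/-- The time-domain filter `f_k = (2π)⁻¹ ∫_{-π}^{π} f̂(x) e^{ikx} dx`; it is real for the Hermitian
functions `f̂` used here, and the real part is taken only to land in `ℝ`. -/
def timeFilter (fhat : ℝ → ℂ) (k : ℤ) : ℝ :=
  ((2 * π : ℂ)⁻¹ * ∫ x in (-π)..π, fhat x * Complex.exp (Complex.I * k * x)).re

/-- Upsampling by the factor 2: insert zeros at the odd indices. -/
def upsample (a : ℤ → ℝ) (k : ℤ) : ℝ := if Even k then a (k / 2) else 0

/-- Convolution of sequences indexed by `ℤ`. -/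
def convolve (f a : ℤ → ℝ) (k : ℤ) : ℝ := ∑' n : ℤ, f n * a (k - n)

/-- The discretizations `V_j`, generated from the initial sequence `V₀` and the noises `ε_j` by
`V_{j+1} = u_j ∗ ↑₂V_j + v_j ∗ ↑₂ε_j`. -/
def discretization (M : VelocityModel) (uhat : ℝ → ℂ) {Ω : Type*} (V₀ : ℤ → Ω → ℝ)
    (ε : ℕ → ℤ → Ω → ℝ) : ℕ → ℤ → Ω → ℝ
  | 0 => V₀
  | j + 1 => fun k ω =>
      convolve (timeFilter (lowFilterHat M uhat j))
        (upsample fun m => discretization M uhat V₀ ε j m ω) k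
      + convolve (timeFilter (highFilterHat M uhat j)) (upsample fun m => ε j m ω) k

/-- Admissible random input of the algorithm: an initial sequence `V₀` which is stationary, centered
and Gaussian with the autocovariance induced by the filter `ĝ_0`, and, independent of it, standard
Gaussian white noises `ε_j`, `j ≥ 0`. -/
structure IsSimulationInput (M : VelocityModel) {Ω : Type*} [MeasurableSpace Ω] (P : Measure Ω)
    (V₀ : ℤ → Ω → ℝ) (ε : ℕ → ℤ → Ω → ℝ) : Prop where
  gaussian : IsGaussianProcess V₀ P
  centered : ∀ k, ∫ ω, V₀ k ω ∂P = 0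
  covariance : ∀ k l, ∫ ω, V₀ k ω * V₀ l ω ∂P
    = (2 * π)⁻¹ * ∫ x in (-π)..π, Real.cos (((k - l : ℤ) : ℝ) * x) * discreteFilter M 0 x ^ 2
  noise_law : ∀ j k, HasLaw (ε j k) (gaussianReal 0 1) P
  noise_indep : iIndepFun (fun (i : ℕ × ℤ) => ε i.1 i.2) P
  indep : IndepFun (fun ω (k : ℤ) => V₀ k ω) (fun ω (i : ℕ × ℤ) => ε i.1 i.2 ω) P

/-- On every compact interval `K` there is a (finite) random variable `A`, not depending on `J`, with
`sup_{t ∈ K} |2^{J/2} V_{J,⌊2^J t⌋} - V(t)| ≤ A 2^{-Jν}` for all `J`, almost surely. -/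
def ConvergesWithRate (ν : ℝ) {Ω : Type*} [MeasurableSpace Ω] (P : Measure Ω)
    (VJ : ℕ → ℤ → Ω → ℝ) (V : ℝ → Ω → ℝ) : Prop :=
  ∀ a b : ℝ, ∃ A : Ω → ℝ, Measurable A ∧ ∀ᵐ ω ∂P, ∀ J : ℕ, ∀ t ∈ Set.Icc a b,
    |(2 : ℝ) ^ ((J : ℝ) / 2) * VJ J ⌊(2 : ℝ) ^ J * t⌋ ω - V t ω| ≤ A ω * (2 : ℝ) ^ (-(J * ν))

end AnomalousDiffusion

end

open MeasureTheory ProbabilityTheory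
open scoped Real ComplexConjugate

noncomputable section

namespace AnomalousDiffusion

/-! Everything is transported to `L²(ℝ; ℂ)`, seen as a real Hilbert space, whose Hermitian elements
are the integrands against `B̃`. Write `h` for the spectral filter `ĝ`. The value `V(t)` is
represented by `h(x) e^{itx}` (`harmonicVec`), the noise `ε_{j,k}` by a dilated and modulated Meyer
wavelet (`waveletVec`), and `V_{J,k}` by a dilated and modulated product of the Meyer scaling
function with the `2π`-periodic function equal to `h(2^J y)` on `[-π, π)` (`scalingVec`).

Three properties of these vectors carry the proof. The mirror condition makes the wavelets
orthonormal and orthogonal to the scaling vectors of level `0`, whose Gram matrix is the covariance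
of `V₀`. The same condition makes the recursion of the algorithm an exact identity between vectors
(`scalingVec_succ`); its filters are absolutely summable because `û` and `v̂` vanish around the
frequencies where the factors built from `ĝ_j` degenerate. Finally the scaling function equals `1`
for `|y| ≤ 2π/3`, so `2^{J/2}` times the scaling vector at `(J, k)` coincides with the harmonic at
time `k/2^J` for `|x| ≤ 2^J · 2π/3`. Since `h²` has a moment of order `2η`, the remaining tail is of
size `2^{-Jη}` in norm (`norm_scalingVec_sub_sq_le`).

A centered Gaussian family with the Gram matrix of a family of vectors extends to an isometry `T`
from the closed span of the vectors into centered Gaussian variables (`exists_isGaussianIsometry`).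
For an input of the algorithm this span contains every scaling vector, by the recursion, and every
harmonic, as a limit. For a velocity process the span of the harmonics is given, and by uniqueness
of the Fourier transform its closure contains every Hermitian function
(`mem_closure_span_harmonicVec`), hence the vectors of an input.

A Gaussian moment of order `q` is a constant times the `q`-th power of the `L²` norm, so the rate in
`L²` is a rate in every `L^q`. For `q > 2/η` it survives summation over the order of `2^J` dyadic
points of level `J` and gives the almost sure uniform rate `ν = η/2` towards a continuous limit. A
prescribed velocity process agrees with that limit at rational times, hence everywhere by
continuity. -/

/-! ### Absolutely convergent Fourier series -/

/-- The coefficient `(2π)⁻¹ ∫_{-π}^{π} f(x) e^{ikx} dx`. -/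
def seriesCoeff (f : ℝ → ℂ) (k : ℤ) : ℂ :=
  (2 * π : ℂ)⁻¹ * ∫ x in (-π)..π, f x * Complex.exp (Complex.I * k * x)

lemma neg_pi_lt_pi : -π < π := by linarith [Real.pi_pos]

lemma fourierCoeffOn_eq_seriesCoeff (f : ℝ → ℂ) (k : ℤ) :
    fourierCoeffOn neg_pi_lt_pi f k = seriesCoeff f (-k) := by
  rw [fourierCoeffOn_eq_integral, seriesCoeff]
  have hpi : (π : ℂ) ≠ 0 := by exact_mod_cast Real.pi_ne_zero
  rw [Complex.real_smul]
  congr 1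
  · push_cast; field_simp; ring
  · refine intervalIntegral.integral_congr fun x _ => ?_
    simp only [fourier_coe_apply, smul_eq_mul]
    rw [mul_comm]
    congr 2
    push_cast
    field_simp
    ring

lemma periodic_exp_I_mul (k : ℤ) :
    Function.Periodic (fun x : ℝ => Complex.exp (Complex.I * k * x)) (2 * π) := by
  intro x
  have : Complex.I * k * ((x + 2 * π : ℝ) : ℂ)
      = Complex.I * k * x + k * (2 * π * Complex.I) := by push_cast; ring
  simp only [this, Complex.exp_add, Complex.exp_int_mul_two_pi_mul_I, mul_one]

lemma seriesCoeff_translate {f : ℝ → ℂ} (hf : Function.Periodic f (2 * π)) (k : ℤ) (s : ℝ) :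
    seriesCoeff (fun x => f (x + s)) k = Complex.exp (-(Complex.I * k * s)) * seriesCoeff f k := by
  have hper : Function.Periodic (fun x : ℝ => f x * Complex.exp (Complex.I * k * x)) (2 * π) :=
    hf.mul (periodic_exp_I_mul k)
  have h1 : ∀ x : ℝ, f (x + s) * Complex.exp (Complex.I * k * x)
      = Complex.exp (-(Complex.I * k * s)) *
        (f (x + s) * Complex.exp (Complex.I * k * ((x + s : ℝ) : ℂ))) := by
    intro x
    rw [mul_left_comm, ← Complex.exp_add]
    congr 2
    push_cast; ring
  rw [seriesCoeff, seriesCoeff]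
  simp_rw [h1]
  rw [intervalIntegral.integral_const_mul,
    intervalIntegral.integral_comp_add_right
      (fun x : ℝ => f x * Complex.exp (Complex.I * k * x)) s]
  have h2 := hper.intervalIntegral_add_eq (-π + s) (-π)
  rw [show -π + s + 2 * π = π + s by ring, show -π + 2 * π = π by ring] at h2
  rw [h2]; ring

lemma continuous_of_lipschitz_bound {f : ℝ → ℂ} {L : ℝ}
    (hL : ∀ x y, ‖f x - f y‖ ≤ L * |x - y|) : Continuous f := by
  have : LipschitzWith L.toNNReal f := by
    refine LipschitzWith.of_dist_le_mul fun x y => ?_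
    rw [dist_eq_norm, dist_eq_norm, Real.norm_eq_abs]
    exact (hL x y).trans (mul_le_mul_of_nonneg_right (Real.le_coe_toNNReal L) (abs_nonneg _))
  exact this.continuous

lemma seriesCoeff_sub {f g : ℝ → ℂ} (hf : Continuous f) (hg : Continuous g) (k : ℤ) :
    seriesCoeff (fun x => f x - g x) k = seriesCoeff f k - seriesCoeff g k := by
  simp only [seriesCoeff, sub_mul]
  rw [intervalIntegral.integral_sub, mul_sub]
  all_goals exact Continuous.intervalIntegrable (by fun_prop) _ _

/-- Formally this is Parseval's identity for `f'`, with `|f'| ≤ L`. To avoid differentiating `f`,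
Bessel's inequality is applied to the difference `f(x + t) - f(x)`, bounded by `|L t|`, whose `k`-th
coefficient has modulus `|e^{-ikt} - 1|` times that of `f`. Dividing by `t²` and letting `t → 0` in
a finite sum produces the factor `k²`. -/
lemma sum_sq_mul_seriesCoeff_le {f : ℝ → ℂ} {L : ℝ} (hf : Function.Periodic f (2 * π))
    (hL : ∀ x y, ‖f x - f y‖ ≤ L * |x - y|) (s : Finset ℤ) :
    ∑ k ∈ s, (k : ℝ) ^ 2 * ‖seriesCoeff f k‖ ^ 2 ≤ L ^ 2 := by
  have hcont := continuous_of_lipschitz_bound hL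
  -- The terms `0 + t` and `0` reproduce the shape of the quotient in
  -- `HasDerivAt.tendsto_slope_zero`, used for the limit below.
  have key : ∀ t : ℝ, t ≠ 0 →
      ∑ k ∈ s, ‖t⁻¹ • (Complex.exp (-(Complex.I * k * ((0 + t : ℝ) : ℂ)))
        - Complex.exp (-(Complex.I * k * ((0 : ℝ) : ℂ))))‖ ^ 2 * ‖seriesCoeff f k‖ ^ 2 ≤ L ^ 2 := by
    intro t ht
    set F : ℝ → ℂ := fun x => f (x + t) - f x with hF
    have hFc : Continuous F := by fun_prop
    have hFb : ∀ x, ‖F x‖ ≤ |L * t| := fun x => by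
      refine (hL _ _).trans ?_
      rw [add_sub_cancel_left, abs_mul]
      gcongr
      exact le_abs_self L
    have hmem : MemLp F 2 (volume.restrict (Set.Ioc (-π) π)) :=
      MemLp.of_bound hFc.aestronglyMeasurable _ (ae_of_all _ hFb)
    have hsum := hasSum_sq_fourierCoeffOn neg_pi_lt_pi hmem
    have hint : (π - -π)⁻¹ • ∫ x in (-π)..π, ‖F x‖ ^ 2 ≤ L ^ 2 * t ^ 2 := by
      have hle : ∫ x in (-π)..π, ‖F x‖ ^ 2 ≤ ∫ x in (-π)..π, |L * t| ^ 2 :=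
        intervalIntegral.integral_mono_on neg_pi_lt_pi.le
          (Continuous.intervalIntegrable (by fun_prop) _ _) (by simp)
          fun x _ => by gcongr; exact hFb x
      rw [intervalIntegral.integral_const, smul_eq_mul, sq_abs] at hle
      have hp : 0 < π - -π := by linarith [Real.pi_pos]
      rw [smul_eq_mul]
      calc (π - -π)⁻¹ * ∫ x in (-π)..π, ‖F x‖ ^ 2
          ≤ (π - -π)⁻¹ * ((π - -π) * (L * t) ^ 2) := by gcongr
        _ = L ^ 2 * t ^ 2 := by field_simp
    have hco : ∀ k : ℤ, ‖fourierCoeffOn neg_pi_lt_pi F (-k)‖ ^ 2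
        = ‖Complex.exp (-(Complex.I * k * t)) - 1‖ ^ 2 * ‖seriesCoeff f k‖ ^ 2 := by
      intro k
      rw [fourierCoeffOn_eq_seriesCoeff, neg_neg, hF, seriesCoeff_sub (by fun_prop) hcont,
        seriesCoeff_translate hf, ← sub_one_mul, norm_mul, mul_pow]
    have hsum' := (Equiv.neg ℤ).hasSum_iff.mpr hsum
    have hle := sum_le_hasSum s (fun k _ => sq_nonneg _) hsum'
    simp only [Equiv.neg_apply, hco] at hle
    have ht2 : 0 < t ^ 2 := by positivity
    calc _ = (t ^ 2)⁻¹ * ∑ k ∈ s, ‖Complex.exp (-(Complex.I * k * t)) - 1‖ ^ 2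
          * ‖seriesCoeff f k‖ ^ 2 := by
          rw [Finset.mul_sum]
          refine Finset.sum_congr rfl fun k _ => ?_
          rw [norm_smul, mul_pow, norm_inv, inv_pow, Real.norm_eq_abs, sq_abs]
          simp [mul_assoc]
      _ ≤ (t ^ 2)⁻¹ * (L ^ 2 * t ^ 2) := by gcongr; exact hle.trans hint
      _ = L ^ 2 := by field_simp
  have hlim : Filter.Tendsto (fun t : ℝ => ∑ k ∈ s,
      ‖t⁻¹ • (Complex.exp (-(Complex.I * k * ((0 + t : ℝ) : ℂ)))
        - Complex.exp (-(Complex.I * k * ((0 : ℝ) : ℂ))))‖ ^ 2 * ‖seriesCoeff f k‖ ^ 2)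
      (nhdsWithin 0 {0}ᶜ) (nhds (∑ k ∈ s, (k : ℝ) ^ 2 * ‖seriesCoeff f k‖ ^ 2)) := by
    refine tendsto_finsetSum _ fun k _ => Filter.Tendsto.mul_const _ ?_
    have hd : HasDerivAt (fun t : ℝ => Complex.exp (-(Complex.I * k * (t : ℂ))))
        (-(Complex.I * k)) 0 := by
      have h1 : HasDerivAt (fun t : ℝ => -(Complex.I * k * (t : ℂ))) (-(Complex.I * k)) 0 := by
        simpa using ((Complex.ofRealCLM.hasDerivAt (x := (0 : ℝ))).const_mul (Complex.I * k)).fun_neg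
      simpa using h1.cexp
    have := (hd.tendsto_slope_zero.norm).pow 2
    simpa using this
  exact le_of_tendsto hlim (by
    filter_upwards [self_mem_nhdsWithin] with t ht using key t ht)

/-- With `a = k⁻²` and `b = k² ‖c_k‖²`, both summable, `‖c_k‖² = ab ≤ (a + b)²` for `k ≠ 0`. -/
lemma summable_norm_seriesCoeff {f : ℝ → ℂ} {L : ℝ} (hf : Function.Periodic f (2 * π))
    (hL : ∀ x y, ‖f x - f y‖ ≤ L * |x - y|) : Summable fun k => ‖seriesCoeff f k‖ := by
  have h1 : Summable fun k : ℤ => (k : ℝ) ^ 2 * ‖seriesCoeff f k‖ ^ 2 :=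
    summable_of_sum_le (fun k => by positivity) (sum_sq_mul_seriesCoeff_le hf hL)
  have h2 : Summable fun k : ℤ => 1 / (k : ℝ) ^ 2 := Real.summable_one_div_int_pow.mpr one_lt_two
  refine Summable.of_norm_bounded_eventually (h2.add h1) ?_
  filter_upwards [(Set.finite_singleton (0 : ℤ)).compl_mem_cofinite] with k hk
  have hk0 : (k : ℝ) ≠ 0 := by exact_mod_cast hk
  have h3 : 1 / (k : ℝ) ^ 2 * ((k : ℝ) ^ 2 * ‖seriesCoeff f k‖ ^ 2) = ‖seriesCoeff f k‖ ^ 2 := by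
    field_simp
  have ha : 0 ≤ 1 / (k : ℝ) ^ 2 := by positivity
  have hb : 0 ≤ (k : ℝ) ^ 2 * ‖seriesCoeff f k‖ ^ 2 := by positivity
  rw [norm_norm]
  refine abs_le_of_sq_le_sq' ?_ (by positivity) |>.2
  nlinarith

lemma hasSum_seriesCoeff {f : ℝ → ℂ} {L : ℝ} (hf : Function.Periodic f (2 * π))
    (hL : ∀ x y, ‖f x - f y‖ ≤ L * |x - y|) (y : ℝ) :
    HasSum (fun k : ℤ => seriesCoeff f k * Complex.exp (-(Complex.I * k * y))) (f y) := by
  have : Fact (0 < 2 * π) := ⟨Real.two_pi_pos⟩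
  have hcont := continuous_of_lipschitz_bound hL
  let G : C(AddCircle (2 * π), ℂ) := ⟨hf.lift, continuous_coinduced_dom.mpr hcont⟩
  have hG : ∀ x : ℝ, G (x : AddCircle (2 * π)) = f x := fun x => hf.lift_coe x
  have hco : ∀ k, fourierCoeff G k = seriesCoeff f (-k) := by
    intro k
    rw [fourierCoeff_eq_intervalIntegral G k (-π), seriesCoeff, Complex.real_smul,
      show -π + 2 * π = π by ring]
    have hpi : (π : ℂ) ≠ 0 := by exact_mod_cast Real.pi_ne_zero
    congr 1
    · push_cast; simp
    · refine intervalIntegral.integral_congr fun x _ => ?_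
      simp only [hG, fourier_coe_apply, smul_eq_mul]
      rw [mul_comm]
      congr 2
      push_cast
      field_simp
  have hs : Summable (fourierCoeff G) := by
    refine Summable.of_norm ?_
    simp_rw [hco]
    exact (Equiv.neg ℤ).summable_iff.mpr (summable_norm_seriesCoeff hf hL)
  have h := has_pointwise_sum_fourier_series_of_summable hs (y : AddCircle (2 * π))
  rw [hG] at h
  have h' := (Equiv.neg ℤ).hasSum_iff.mpr h
  refine h'.congr_fun ?_
  intro k
  have hpi : (π : ℂ) ≠ 0 := by exact_mod_cast Real.pi_ne_zero
  simp only [Function.comp_apply, Equiv.neg_apply, hco, neg_neg, fourier_coe_apply, smul_eq_mul]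
  congr 2
  push_cast
  field_simp

lemma conj_seriesCoeff {f : ℝ → ℂ} (hf : ∀ x, f (-x) = conj (f x)) (k : ℤ) :
    conj (seriesCoeff f k) = seriesCoeff f k := by
  have h : conj (∫ x in (-π)..π, f x * Complex.exp (Complex.I * k * x))
      = ∫ x in (-π)..π, f x * Complex.exp (Complex.I * k * x) := by
    have h1 := intervalIntegral.integral_comp_neg (a := -π) (b := π)
      (fun x : ℝ => f x * Complex.exp (Complex.I * k * x))
    rw [neg_neg] at h1
    refine Eq.trans ?_ h1
    rw [intervalIntegral.integral_of_le neg_pi_lt_pi.le, ← integral_conj,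
      intervalIntegral.integral_of_le neg_pi_lt_pi.le]
    refine integral_congr_ae (ae_of_all _ fun x => ?_)
    simp only [map_mul, hf, ← Complex.exp_conj, Complex.conj_I,
      Complex.conj_ofReal, map_intCast]
    congr 2
    push_cast; ring
  rw [seriesCoeff, map_mul, h, map_inv₀, map_mul, map_ofNat, Complex.conj_ofReal]

/-- The filters are quotients that may take meaningless values on a null set. Only integrals of them
matter, so a Lipschitz representative `f` can replace `fhat`. -/
lemma ofReal_timeFilter {fhat f : ℝ → ℂ} (hae : fhat =ᵐ[volume] f)
    (hf : ∀ x, f (-x) = conj (f x)) (k : ℤ) :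
    ((timeFilter fhat k : ℝ) : ℂ) = seriesCoeff f k := by
  have h : timeFilter fhat k = (seriesCoeff f k).re := by
    rw [timeFilter, seriesCoeff]
    congr 2
    refine intervalIntegral.integral_congr_ae ?_
    filter_upwards [hae] with x hx _
    rw [hx]
  rw [h]
  exact Complex.conj_eq_iff_re.mp (conj_seriesCoeff hf k)

/-! ### Analytic properties of the spectral filters -/

/-- The properties of the spectral filter used below: it is even, positive away from `0`, regular on
the half-line, and the spectral density `h²` has a finite moment of order `2η`. -/
structure IsSpectralWeight (h : ℝ → ℝ) (η : ℝ) : Prop where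
  even : ∀ x, h (-x) = h x
  measurable : Measurable h
  pos : ∀ x, x ≠ 0 → 0 < h x
  contDiffOn : ContDiffOn ℝ 1 h (Set.Ioi 0)
  integrable_sq : Integrable fun x => h x ^ 2
  integrable_moment : Integrable fun x => |x| ^ (2 * η) * h x ^ 2
  exponent_pos : 0 < η
  exponent_lt_one : η < 1

lemma integrable_of_even {f : ℝ → ℝ} (heven : ∀ x, f (-x) = f x)
    (hf : IntegrableOn f (Set.Ioi 0)) : Integrable f := by
  have h2 : IntegrableOn f (Set.Iic 0) := by
    have h3 := IntegrableOn.comp_neg_Iic (c := (0 : ℝ))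
      (by simpa using Iff.mpr integrableOn_Ici_iff_integrableOn_Ioi hf)
    simpa only [heven] using h3
  rw [← integrableOn_univ, ← Set.Iic_union_Ioi (a := (0 : ℝ))]
  exact h2.union hf

lemma integrable_of_power_bounds {f : ℝ → ℝ} {a b C : ℝ} (hmeas : Measurable f)
    (heven : ∀ x, f (-x) = f x) (ha : -1 < a) (hb : b < -1)
    (h0 : ∀ x, 0 < x → x ≤ 1 → |f x| ≤ C * x ^ a) (h1 : ∀ x, 1 < x → |f x| ≤ C * x ^ b) :
    Integrable f := by
  refine integrable_of_even heven ?_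
  rw [← Set.Ioc_union_Ioi_eq_Ioi zero_le_one]
  refine IntegrableOn.union ?_ ?_
  · have hi : IntegrableOn (fun x : ℝ => C * x ^ a) (Set.Ioc 0 1) :=
      ((intervalIntegrable_iff_integrableOn_Ioc_of_le zero_le_one).mp
        (intervalIntegral.intervalIntegrable_rpow' ha)).const_mul C
    refine Integrable.mono' hi hmeas.aestronglyMeasurable ?_
    filter_upwards [ae_restrict_mem measurableSet_Ioc] with x hx using h0 x hx.1 hx.2
  · have hi : IntegrableOn (fun x : ℝ => C * x ^ b) (Set.Ioi 1) :=
      (integrableOn_Ioi_rpow_of_lt hb one_pos).const_mul C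
    refine Integrable.mono' hi hmeas.aestronglyMeasurable ?_
    filter_upwards [ae_restrict_mem measurableSet_Ioi] with x hx using h1 x hx

/-- The moment of order `2η` converges at infinity as long as `η < d + 1/2`, the Hölder index of the
process. The choice of half this index makes the integrand decay like `x^{-3/2-d}`, integrable
because `d > -1/2`. Near `0` the factor `|x|^{2η}` is at most `1` and costs nothing. -/
lemma isSpectralWeight_of_bounds {h : ℝ → ℝ} {a d C : ℝ} (heven : ∀ x, h (-x) = h x)
    (hmeas : Measurable h) (hpos : ∀ x, x ≠ 0 → 0 < h x) (hC1 : ContDiffOn ℝ 1 h (Set.Ioi 0))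
    (ha : -1 < a) (hd : -(1 / 2) < d) (hd' : d < 1 / 2)
    (h0 : ∀ x, 0 < x → x ≤ 1 → h x ^ 2 ≤ C * x ^ a)
    (h1 : ∀ x, 1 < x → h x ^ 2 ≤ C * x ^ (-2 - 2 * d)) :
    IsSpectralWeight h ((d + 1 / 2) / 2) where
  even := heven
  measurable := hmeas
  pos := hpos
  contDiffOn := hC1
  integrable_sq := by
    refine integrable_of_power_bounds (a := a) (b := -2 - 2 * d) (C := C) (by fun_prop)
      (by simp [heven]) ha (by linarith) ?_ ?_
    · intro x hx hx1; rw [abs_of_nonneg (sq_nonneg _)]; exact h0 x hx hx1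
    · intro x hx; rw [abs_of_nonneg (sq_nonneg _)]; exact h1 x hx
  integrable_moment := by
    refine integrable_of_power_bounds (a := a) (b := -(3 / 2) - d) (C := C) (by fun_prop)
      (by simp [heven]) ha (by linarith) ?_ ?_
    · intro x hx hx1
      rw [abs_of_nonneg (by positivity), abs_of_pos hx]
      have hle : x ^ (2 * ((d + 1 / 2) / 2)) ≤ 1 := Real.rpow_le_one hx.le hx1 (by linarith)
      calc _ ≤ 1 * h x ^ 2 := by gcongr
        _ ≤ _ := by rw [one_mul]; exact h0 x hx hx1
    · intro x hx
      have hx0 : 0 < x := by linarith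
      rw [abs_of_nonneg (by positivity), abs_of_pos hx0]
      calc _ ≤ x ^ (2 * ((d + 1 / 2) / 2)) * (C * x ^ (-2 - 2 * d)) := by
            gcongr; exact h1 x hx
        _ = C * (x ^ (2 * ((d + 1 / 2) / 2)) * x ^ (-2 - 2 * d)) := by ring
        _ = _ := by rw [← Real.rpow_add hx0]; congr 2; ring
  exponent_pos := by linarith
  exponent_lt_one := by linarith

lemma sin_pi_mul_pos {d : ℝ} (h0 : -(1 / 2) < d) (h1 : d < 1 / 2) :
    0 < Real.sin (π * (d + 1 / 2)) := by
  have := Real.pi_pos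
  apply Real.sin_pos_of_pos_of_lt_pi <;> nlinarith

lemma Gamma_pos {d : ℝ} (h0 : -(1 / 2) < d) : 0 < Real.Gamma (2 * d + 2) :=
  Real.Gamma_pos_of_pos (by linarith)

lemma FOUParams.c_pos (p : FOUParams) : 0 < p.c :=
  mul_pos p.σ_pos (Real.sqrt_pos.mpr (mul_pos (Gamma_pos p.d_gt) (sin_pi_mul_pos p.d_gt p.d_lt)))

lemma isSpectralWeight_fOU (p : FOUParams) :
    IsSpectralWeight (spectralFilter (.fOU p)) ((p.d + 1 / 2) / 2) := by
  have hc := p.c_pos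
  have hζ := p.ζ_pos
  have hd := p.d_gt
  have hd' := p.d_lt
  have hsq : ∀ x, 0 < x → spectralFilter (.fOU p) x ^ 2
      = p.c ^ 2 * (1 / (p.ζ ^ 2 + x ^ 2)) * x ^ (-2 * p.d) := by
    intro x hx
    simp only [spectralFilter]
    rw [mul_pow, mul_pow, div_pow, one_pow, Real.sq_sqrt (by positivity), abs_of_pos hx,
      ← Real.rpow_natCast (x ^ (-p.d)), ← Real.rpow_mul hx.le]
    congr 2; push_cast; ring
  refine isSpectralWeight_of_bounds (a := -2 * p.d) (C := p.c ^ 2 * (1 / p.ζ ^ 2 + 1))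
    ?_ ?_ ?_ ?_ (by linarith) hd hd' ?_ ?_
  · intro x; simp [spectralFilter]
  · unfold spectralFilter; fun_prop
  · intro x hx
    have : 0 < |x| := abs_pos.mpr hx
    simp only [spectralFilter]; positivity
  · have : ContDiffOn ℝ 1 (fun x : ℝ => p.c * (1 / √(p.ζ ^ 2 + x ^ 2)) * x ^ (-p.d))
        (Set.Ioi 0) := by
      refine ContDiffOn.mul (ContDiffOn.mul contDiffOn_const (ContDiffOn.div contDiffOn_const
        (ContDiffOn.sqrt (by fun_prop) fun x _ => by positivity) fun x _ => by positivity)) ?_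
      exact ContDiffOn.rpow_const_of_ne contDiffOn_id fun x hx => ne_of_gt hx
    refine this.congr fun x hx => ?_
    simp only [spectralFilter, abs_of_pos (show 0 < x from hx)]
  · intro x hx _
    rw [hsq x hx]
    have : 1 / (p.ζ ^ 2 + x ^ 2) ≤ 1 / p.ζ ^ 2 + 1 := by
      have : 1 / (p.ζ ^ 2 + x ^ 2) ≤ 1 / p.ζ ^ 2 := by gcongr; nlinarith
      linarith
    gcongr
  · intro x hx
    have hx0 : 0 < x := by linarith
    rw [hsq x hx0]
    have h1 : 1 / (p.ζ ^ 2 + x ^ 2) ≤ x ^ (-2 : ℝ) := by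
      rw [Real.rpow_neg hx0.le, one_div]
      norm_num
      gcongr
      nlinarith [sq_nonneg p.ζ]
    have h2 : x ^ (-2 - 2 * p.d) = x ^ (-2 : ℝ) * x ^ (-2 * p.d) := by
      rw [← Real.rpow_add hx0]; congr 1; ring
    rw [h2]
    calc _ ≤ p.c ^ 2 * x ^ (-2 : ℝ) * x ^ (-2 * p.d) := by gcongr
      _ ≤ p.c ^ 2 * (1 / p.ζ ^ 2 + 1) * (x ^ (-2 : ℝ) * x ^ (-2 * p.d)) := by
        rw [mul_assoc]
        gcongr
        have : 0 ≤ 1 / p.ζ ^ 2 := by positivity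
        nlinarith [sq_nonneg p.c]

/-! ### Positivity and growth of the fGLE denominator. -/

namespace FGLEParams

lemma sin_pos (p : FGLEParams) : 0 < Real.sin (π * (p.d + 1 / 2)) :=
  sin_pi_mul_pos (by linarith [p.d_pos]) p.d_lt

lemma gamma_pos (p : FGLEParams) : 0 < Real.Gamma (2 * p.d + 2) :=
  Gamma_pos (by linarith [p.d_pos])

lemma a_pos (p : FGLEParams) : 0 < p.a := mul_pos (mul_pos p.ζ_pos p.gamma_pos) p.sin_pos

lemma c_pos (p : FGLEParams) : 0 < p.c := by
  have := p.ζ_pos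
  have := p.kB_pos
  have := p.τ_pos
  have := p.gamma_pos
  have := p.sin_pos
  exact Real.sqrt_pos.mpr (by positivity)

/-- Here `b = -ζ Γ(2d+2) sin(πd)` is negative, and so is `γ₁`. Positivity of the denominator
therefore needs the completed square and `a > 0`. -/
lemma quadratic_eq (p : FGLEParams) (y : ℝ) :
    p.γ₀ + p.γ₁ * y + p.γ₂ * y ^ 2 = p.a ^ 2 + (p.b + p.m * y) ^ 2 := by
  simp only [γ₀, γ₁, γ₂]; ring

lemma sq_a_le_quadratic (p : FGLEParams) (y : ℝ) :
    p.a ^ 2 ≤ p.γ₀ + p.γ₁ * y + p.γ₂ * y ^ 2 := by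
  rw [quadratic_eq]; nlinarith [sq_nonneg (p.b + p.m * y)]

/-- From `(m y)² ≤ 2 (b + m y)² + 2 b²`, where the last term is absorbed using `a² ≤ Q`, `Q` being
the quadratic form. -/
lemma sq_le_mul_quadratic (p : FGLEParams) (y : ℝ) :
    y ^ 2 ≤ (2 + 2 * p.b ^ 2 / p.a ^ 2) / p.m ^ 2 * (p.γ₀ + p.γ₁ * y + p.γ₂ * y ^ 2) := by
  have ha := p.a_pos
  have hm := p.m_pos
  have hQ := p.sq_a_le_quadratic y
  rw [quadratic_eq] at hQ ⊢
  set Q := p.a ^ 2 + (p.b + p.m * y) ^ 2 with hQd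
  have h1 : 2 * p.b ^ 2 ≤ 2 * p.b ^ 2 / p.a ^ 2 * Q := by
    calc 2 * p.b ^ 2 = 2 * p.b ^ 2 / p.a ^ 2 * p.a ^ 2 := by field_simp
      _ ≤ _ := by gcongr
  have h2 : p.m ^ 2 * y ^ 2 ≤ 2 * Q + 2 * p.b ^ 2 := by
    -- The difference of the two sides is `(m y + 2 b)² + 2 a²`.
    nlinarith [sq_nonneg (p.m * y + 2 * p.b), sq_nonneg p.a]
  rw [div_mul_eq_mul_div, le_div_iff₀ (by positivity)]
  nlinarith

lemma rpow_two_mul_beta (p : FGLEParams) {x : ℝ} (hx : 0 ≤ x) :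
    x ^ (2 * p.β) = (x ^ p.β) ^ 2 := by
  rw [mul_comm, Real.rpow_mul hx]; norm_num

end FGLEParams

/-- At infinity `h²` behaves like `x^{-2β+2d}`, and `β = 1 + 2d` makes this `x^{-2-2d}`, the same
decay as for the fOU. At `0` it behaves like `x^{2d}`. -/
lemma isSpectralWeight_fGLE (p : FGLEParams) :
    IsSpectralWeight (spectralFilter (.fGLE p)) ((p.d + 1 / 2) / 2) := by
  have hc := p.c_pos
  have ha := p.a_pos
  have hm := p.m_pos
  have hd := p.d_pos
  have hd' := p.d_lt
  have hQ : ∀ x : ℝ, 0 < p.γ₀ + p.γ₁ * |x| ^ p.β + p.γ₂ * |x| ^ (2 * p.β) := by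
    intro x
    rw [p.rpow_two_mul_beta (abs_nonneg x)]
    exact lt_of_lt_of_le (by positivity) (p.sq_a_le_quadratic _)
  have hsq : ∀ x, 0 < x → spectralFilter (.fGLE p) x ^ 2
      = p.c ^ 2 * (1 / (p.γ₀ + p.γ₁ * x ^ p.β + p.γ₂ * (x ^ p.β) ^ 2)) * x ^ (2 * p.d) := by
    intro x hx
    simp only [spectralFilter]
    rw [mul_pow, mul_pow, div_pow, one_pow, Real.sq_sqrt (hQ x).le, abs_of_pos hx,
      p.rpow_two_mul_beta hx.le, ← Real.rpow_natCast (x ^ p.d), ← Real.rpow_mul hx.le]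
    congr 2; push_cast; ring
  set κ := (2 + 2 * p.b ^ 2 / p.a ^ 2) / p.m ^ 2 with hκ
  have hκ0 : 0 < κ := by positivity
  refine isSpectralWeight_of_bounds (a := 2 * p.d) (C := p.c ^ 2 * (1 / p.a ^ 2 + κ))
    ?_ ?_ ?_ ?_ (by linarith) (by linarith) hd' ?_ ?_
  · intro x; simp [spectralFilter]
  · unfold spectralFilter; fun_prop
  · intro x hx
    have : 0 < |x| := abs_pos.mpr hx
    have := hQ x
    simp only [spectralFilter]; positivity
  · have : ContDiffOn ℝ 1 (fun x : ℝ => p.c * (1 / √(p.γ₀ + p.γ₁ * x ^ p.β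
        + p.γ₂ * x ^ (2 * p.β))) * x ^ p.d) (Set.Ioi 0) := by
      have hpow : ∀ e : ℝ, ContDiffOn ℝ 1 (fun x : ℝ => x ^ e) (Set.Ioi 0) := fun e =>
        ContDiffOn.rpow_const_of_ne contDiffOn_id fun x hx => ne_of_gt hx
      have hQ' : ∀ x ∈ Set.Ioi (0 : ℝ), 0 < p.γ₀ + p.γ₁ * x ^ p.β + p.γ₂ * x ^ (2 * p.β) := by
        intro x hx
        simpa [abs_of_pos (show 0 < x from hx)] using hQ x
      refine ContDiffOn.mul (ContDiffOn.mul contDiffOn_const (ContDiffOn.div contDiffOn_const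
        (ContDiffOn.sqrt ?_ fun x hx => (hQ' x hx).ne') fun x hx =>
          (Real.sqrt_pos.mpr (hQ' x hx)).ne')) (hpow _)
      exact ((contDiffOn_const.add (contDiffOn_const.mul (hpow _))).add
        (contDiffOn_const.mul (hpow _)))
    refine this.congr fun x hx => ?_
    simp only [spectralFilter, abs_of_pos (show 0 < x from hx)]
  · intro x hx _
    rw [hsq x hx]
    have : 1 / (p.γ₀ + p.γ₁ * x ^ p.β + p.γ₂ * (x ^ p.β) ^ 2) ≤ 1 / p.a ^ 2 + κ := by
      have : 1 / (p.γ₀ + p.γ₁ * x ^ p.β + p.γ₂ * (x ^ p.β) ^ 2) ≤ 1 / p.a ^ 2 := by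
        gcongr; exact p.sq_a_le_quadratic _
      linarith
    gcongr
  · intro x hx
    have hx0 : 0 < x := by linarith
    rw [hsq x hx0]
    have hy : 0 < (x ^ p.β) ^ 2 := by positivity
    have h1 : 1 / (p.γ₀ + p.γ₁ * x ^ p.β + p.γ₂ * (x ^ p.β) ^ 2) ≤ κ * x ^ (-(2 * p.β)) := by
      have hQx := lt_of_lt_of_le (show 0 < p.a ^ 2 by positivity) (p.sq_a_le_quadratic (x ^ p.β))
      rw [Real.rpow_neg hx0.le, p.rpow_two_mul_beta hx0.le, ← div_eq_mul_inv,
        div_le_div_iff₀ hQx hy, one_mul]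
      exact p.sq_le_mul_quadratic _
    have h2 : x ^ (-2 - 2 * p.d) = x ^ (-(2 * p.β)) * x ^ (2 * p.d) := by
      rw [← Real.rpow_add hx0, FGLEParams.β]; congr 1; ring
    rw [h2]
    calc _ ≤ p.c ^ 2 * (κ * x ^ (-(2 * p.β))) * x ^ (2 * p.d) := by gcongr
      _ = p.c ^ 2 * κ * (x ^ (-(2 * p.β)) * x ^ (2 * p.d)) := by ring
      _ ≤ _ := by
        gcongr
        have : 0 ≤ 1 / p.a ^ 2 := by positivity
        linarith

lemma exists_isSpectralWeight (M : VelocityModel) : ∃ η, IsSpectralWeight (spectralFilter M) η := by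
  cases M with
  | fOU p => exact ⟨_, isSpectralWeight_fOU p⟩
  | fGLE p => exact ⟨_, isSpectralWeight_fGLE p⟩

lemma abs_two_pow_mul_rpow (j : ℕ) (x e : ℝ) :
    |(2 : ℝ) ^ j * x| ^ e = (2 : ℝ) ^ (j * e) * |x| ^ e := by
  rw [abs_mul, abs_of_pos (by positivity), Real.mul_rpow (by positivity) (abs_nonneg x),
    ← Real.rpow_natCast, ← Real.rpow_mul (by norm_num)]

/-- All discrete filters are periodized dilations of the one function `ĝ`. From here on the two
models need no separate treatment. -/
lemma discreteFilter_eq (M : VelocityModel) (j : ℕ) (x : ℝ) :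
    discreteFilter M j x = √(2 * π) * spectralFilter M ((2 : ℝ) ^ j * wrap x) := by
  cases M with
  | fOU p =>
    simp only [discreteFilter, spectralFilter, ouComponent, powerComponent, abs_two_pow_mul_rpow,
      mul_pow, ← pow_mul, mul_comm j 2]
    rw [show (j : ℝ) * -p.d = -(j * p.d) by ring]
    ring
  | fGLE p =>
    simp only [discreteFilter, spectralFilter, gleComponent, powerComponent, abs_two_pow_mul_rpow]
    rw [show (j : ℝ) * (2 * p.β) = 2 * j * p.β by ring, show -((j : ℝ) * -p.d) = j * p.d by ring,
      neg_neg]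
    simp only [mul_assoc]

/-! ### Reduction modulo `2π` -/

lemma wrap_eq (x : ℝ) : wrap x = x - toIcoDiv Real.two_pi_pos (-π) x * (2 * π) := by
  rw [wrap, toIcoMod, zsmul_eq_mul]

lemma periodic_wrap : Function.Periodic wrap (2 * π) := fun x =>
  toIcoMod_add_right Real.two_pi_pos (-π) x

lemma wrap_mem (x : ℝ) : wrap x ∈ Set.Ico (-π) π := by
  have h := toIcoMod_mem_Ico Real.two_pi_pos (-π) x
  rwa [show -π + 2 * π = π by ring] at h

lemma abs_wrap_le (x : ℝ) : |wrap x| ≤ π := abs_le.mpr ⟨(wrap_mem x).1, (wrap_mem x).2.le⟩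

lemma wrap_of_mem {x : ℝ} (hx : x ∈ Set.Ico (-π) π) : wrap x = x :=
  (toIcoMod_eq_self Real.two_pi_pos).mpr (by rwa [show -π + 2 * π = π by ring])

/-- Although `wrap` jumps at odd multiples of `π`, its absolute value is the quotient norm of the
circle. This is the source of evenness and of the Lipschitz bound `abs_wrap_sub_le`. -/
lemma abs_wrap_eq_norm (x : ℝ) : |wrap x| = ‖(x : AddCircle (2 * π))‖ := by
  have h1 : ((wrap x : ℝ) : AddCircle (2 * π)) = (x : AddCircle (2 * π)) := by
    rw [wrap_eq, AddCircle.coe_sub, ← zsmul_eq_mul, AddCircle.coe_zsmul, AddCircle.coe_period,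
      smul_zero, sub_zero]
  rw [← h1]
  refine ((AddCircle.norm_coe_eq_abs_iff (2 * π) Real.two_pi_pos.ne').mpr ?_).symm
  rw [abs_of_pos Real.two_pi_pos]
  linarith [abs_wrap_le x]

lemma abs_wrap_of_abs_le {x : ℝ} (hx : |x| ≤ π) : |wrap x| = |x| := by
  rw [abs_wrap_eq_norm]
  refine (AddCircle.norm_coe_eq_abs_iff (2 * π) Real.two_pi_pos.ne').mpr ?_
  rw [abs_of_pos Real.two_pi_pos]
  linarith

lemma abs_wrap_neg (x : ℝ) : |wrap (-x)| = |wrap x| := by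
  rw [abs_wrap_eq_norm, abs_wrap_eq_norm, AddCircle.coe_neg, norm_neg]

lemma abs_wrap_sub_le (x y : ℝ) : |(|wrap x| - |wrap y|)| ≤ |x - y| := by
  rw [abs_wrap_eq_norm, abs_wrap_eq_norm]
  refine (abs_norm_sub_norm_le _ _).trans ?_
  rw [← AddCircle.coe_sub, ← abs_wrap_eq_norm]
  by_cases h : |x - y| ≤ π
  · rw [abs_wrap_of_abs_le h]
  · exact (abs_wrap_le _).trans (le_of_not_ge h)

lemma measurable_wrap : Measurable wrap := by
  have h : wrap = fun x => x - ⌊(x - (-π)) / (2 * π)⌋ * (2 * π) := by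
    funext x
    rw [wrap_eq, toIcoDiv_eq_floor]
  rw [h]
  fun_prop

lemma ae_wrap_mul_ne_zero {c : ℝ} (hc : c ≠ 0) : ∀ᵐ x : ℝ, wrap (c * x) ≠ 0 := by
  have hsub : {x : ℝ | ¬ wrap (c * x) ≠ 0} ⊆ Set.range fun n : ℤ => c⁻¹ * (n * (2 * π)) := by
    intro x hx
    have h0 : wrap (c * x) = 0 := not_not.mp hx
    rw [wrap_eq, sub_eq_zero] at h0
    exact ⟨toIcoDiv Real.two_pi_pos (-π) (c * x), by
      change c⁻¹ * _ = x
      rw [← h0]; field_simp⟩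
  exact measure_mono_null hsub ((Set.countable_range _).measure_zero _)

lemma wrap_add_int_mul (x : ℝ) (n : ℤ) : wrap (x + n * (2 * π)) = wrap x := by
  have := periodic_wrap.int_mul n x
  simpa using this

/-- A `2π`-periodic function is determined by its values on `[-π, π)`. -/
lemma periodic_apply_wrap {α : Type*} {f : ℝ → α} (hf : Function.Periodic f (2 * π)) (x : ℝ) :
    f (wrap x) = f x := by
  rw [wrap_eq]
  exact hf.sub_int_mul_eq _

/-- Doubling on the circle folds into a tent map on `|wrap x|`. The two branches distinguish whether
`2x` leaves the fundamental period, which decides the form of the quotient in the low-pass filter.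
-/
lemma abs_wrap_two_mul (x : ℝ) :
    |wrap (2 * x)| = if |wrap x| ≤ π / 2 then 2 * |wrap x| else 2 * π - 2 * |wrap x| := by
  have hper : Function.Periodic (fun z => wrap (2 * z)) (2 * π) := fun z => by
    change wrap (2 * (z + 2 * π)) = wrap (2 * z)
    rw [← wrap_add_int_mul (2 * z) 2]; congr 1; push_cast; ring
  rw [← periodic_apply_wrap hper x]
  have hpi := Real.pi_pos
  have hle := abs_wrap_le x
  set y := wrap x
  split_ifs with h
  · rw [abs_wrap_of_abs_le (by rw [abs_mul, abs_two]; linarith), abs_mul, abs_two]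
  · push Not at h
    rcases le_total 0 y with hy | hy
    · rw [abs_of_nonneg hy] at h hle ⊢
      rw [← wrap_add_int_mul (2 * y) (-1)]
      have h1 : 2 * y + ((-1 : ℤ) : ℝ) * (2 * π) = -(2 * π - 2 * y) := by push_cast; ring
      rw [h1, abs_wrap_of_abs_le] <;> rw [abs_neg, abs_of_nonneg (by linarith)]
      linarith
    · rw [abs_of_nonpos hy] at h hle ⊢
      rw [← wrap_add_int_mul (2 * y) 1]
      have h1 : 2 * y + ((1 : ℤ) : ℝ) * (2 * π) = 2 * π - 2 * -y := by push_cast; ring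
      rw [h1, abs_wrap_of_abs_le] <;> rw [abs_of_nonneg (by linarith)]
      linarith

/-! ### Meyer filters -/

namespace IsMeyerFilter

variable {uhat : ℝ → ℂ}

lemma continuous (hu : IsMeyerFilter uhat) : Continuous uhat := hu.contDiff.continuous

lemma norm_sq_le (hu : IsMeyerFilter uhat) (x : ℝ) : ‖uhat x‖ ^ 2 ≤ 2 := by
  nlinarith [hu.mirror x, sq_nonneg ‖uhat (x + π)‖]

lemma norm_le (hu : IsMeyerFilter uhat) (x : ℝ) : ‖uhat x‖ ≤ 2 := by
  nlinarith [hu.norm_sq_le x, norm_nonneg (uhat x)]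

lemma eq_zero_of_le_abs_wrap (hu : IsMeyerFilter uhat) {x : ℝ} (hx : 2 * π / 3 ≤ |wrap x|) :
    uhat x = 0 := by
  rw [← periodic_apply_wrap hu.periodic]
  exact hu.stop_band _ hx (abs_wrap_le x)

lemma exists_lipschitz (hu : IsMeyerFilter uhat) :
    ∃ L, ∀ x y, ‖uhat x - uhat y‖ ≤ L * |x - y| := by
  have hd : Continuous (deriv uhat) := hu.contDiff.continuous_deriv (by norm_num)
  have hper : Function.Periodic (deriv uhat) (2 * π) := by
    intro x
    rw [← deriv_comp_add_const]
    congr 1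
    funext y
    exact hu.periodic y
  obtain ⟨C, hC⟩ := isCompact_Icc.exists_bound_of_continuousOn (s := Set.Icc (-π) π) hd.continuousOn
  refine ⟨C, fun x y => ?_⟩
  have hb : ∀ z ∈ (Set.univ : Set ℝ), ‖deriv uhat z‖ ≤ C := fun z _ => by
    rw [← periodic_apply_wrap hper z]
    exact hC _ (Set.Ico_subset_Icc_self (wrap_mem z))
  have := convex_univ.norm_image_sub_le_of_norm_deriv_le
    (fun z _ => (hu.contDiff.differentiable (by norm_num)).differentiableAt) hb
    (Set.mem_univ y) (Set.mem_univ x)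
  simpa [Real.norm_eq_abs] using this

lemma periodic_highPass (hu : IsMeyerFilter uhat) :
    Function.Periodic (highPass uhat) (2 * π) := by
  intro x
  have h1 := periodic_exp_I_mul (-1) x
  simp only [highPass]
  dsimp only at h1
  have h2 : ∀ z : ℝ, -(Complex.I * (z : ℂ)) = Complex.I * ((-1 : ℤ) : ℂ) * z := by
    intro z; push_cast; ring
  rw [h2, h2, h1, show x + 2 * π + π = (x + π) + 2 * π by ring, hu.periodic]

lemma norm_highPass (x : ℝ) : ‖highPass uhat x‖ = ‖uhat (x + π)‖ := by
  rw [highPass, norm_mul, RCLike.norm_conj, Complex.norm_exp]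
  simp

lemma highPass_neg (hu : IsMeyerFilter uhat) (x : ℝ) :
    highPass uhat (-x) = conj (highPass uhat x) := by
  simp only [highPass, map_mul, ← Complex.exp_conj, map_neg, Complex.conj_I, Complex.conj_ofReal,
    ← hu.hermitian]
  rw [show -(-x + π) = x + π - 2 * π by ring, hu.periodic.sub_eq, neg_neg]
  congr 2
  push_cast; ring

/-- The translation by `π` moves this neighbourhood of `0` into the stop band of `û`. -/
lemma highPass_eq_zero (hu : IsMeyerFilter uhat) {x : ℝ} (hx : |wrap x| ≤ π / 3) :
    highPass uhat x = 0 := by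
  have hpi := Real.pi_pos
  rw [← periodic_apply_wrap hu.periodic_highPass, highPass]
  set y := wrap x
  have h0 : uhat (y + π) = 0 := by
    rcases le_total 0 y with hy | hy
    · rw [abs_of_nonneg hy] at hx
      rw [← hu.periodic.sub_eq]
      refine hu.stop_band _ ?_ ?_ <;> rw [abs_of_nonpos (by linarith)] <;> linarith
    · rw [abs_of_nonpos hy] at hx
      refine hu.stop_band _ ?_ ?_ <;> rw [abs_of_nonneg (by linarith)] <;> linarith
  rw [h0]; simp

lemma continuous_highPass (hu : IsMeyerFilter uhat) : Continuous (highPass uhat) := by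
  have := hu.continuous
  unfold highPass
  fun_prop

end IsMeyerFilter

/-! ### Lipschitz regularity of the algorithm's filters -/

lemma exists_lipschitz_mul {f g : ℝ → ℂ} {A B : ℝ} (hA : ∀ x, ‖f x‖ ≤ A) (hB : ∀ x, ‖g x‖ ≤ B)
    (hf : ∃ L, ∀ x y, ‖f x - f y‖ ≤ L * |x - y|) (hg : ∃ L, ∀ x y, ‖g x - g y‖ ≤ L * |x - y|) :
    ∃ L, ∀ x y, ‖f x * g x - f y * g y‖ ≤ L * |x - y| := by
  obtain ⟨L, hL⟩ := hf
  obtain ⟨L', hL'⟩ := hg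
  have hA0 : 0 ≤ A := (norm_nonneg _).trans (hA 0)
  have hB0 : 0 ≤ B := (norm_nonneg _).trans (hB 0)
  refine ⟨A * L' + L * B, fun x y => ?_⟩
  calc ‖f x * g x - f y * g y‖ = ‖f x * (g x - g y) + (f x - f y) * g y‖ := by ring_nf
    _ ≤ ‖f x‖ * ‖g x - g y‖ + ‖f x - f y‖ * ‖g y‖ := by
      refine (norm_add_le _ _).trans ?_
      rw [norm_mul, norm_mul]
    _ ≤ A * (L' * |x - y|) + L * |x - y| * B := by
      have := hL x y
      have h0 := (norm_nonneg _).trans this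
      gcongr
      · exact hA x
      · exact hL' x y
      · exact hB y
    _ = _ := by ring

/-- The symbol `q` is regular only on `[a, b]`, away from the singularity of `ĝ`. Clamping `|wrap
x|` into `[a, b]` extends it to a globally Lipschitz periodic function, since the clamp and `|wrap
·|` are both `1`-Lipschitz. In the applications clamping does not change the filter. -/
lemma exists_lipschitz_comp_clamp {q : ℝ → ℝ} {a b : ℝ} (hab : a ≤ b)
    (hq : ContDiffOn ℝ 1 q (Set.Icc a b)) :
    (∃ B, ∀ x, ‖((q (max a (min b |wrap x|)) : ℝ) : ℂ)‖ ≤ B) ∧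
    ∃ L, ∀ x y, ‖((q (max a (min b |wrap x|)) : ℝ) : ℂ) - (q (max a (min b |wrap y|)) : ℝ)‖
      ≤ L * |x - y| := by
  have hmem : ∀ x, max a (min b |wrap x|) ∈ Set.Icc a b := fun x =>
    ⟨le_max_left _ _, max_le hab (min_le_left _ _)⟩
  constructor
  · obtain ⟨B, hB⟩ := isCompact_Icc.exists_bound_of_continuousOn hq.continuousOn
    refine ⟨B, fun x => ?_⟩
    rw [Complex.norm_real]
    exact hB _ (hmem x)
  · obtain ⟨K, hK⟩ := hq.exists_lipschitzOnWith (by norm_num) (convex_Icc a b) isCompact_Icc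
    refine ⟨K, fun x y => ?_⟩
    rw [← Complex.ofReal_sub, Complex.norm_real]
    have h1 := hK.dist_le_mul _ (hmem x) _ (hmem y)
    rw [dist_eq_norm, Real.dist_eq] at h1
    refine h1.trans ?_
    refine mul_le_mul_of_nonneg_left ?_ K.2
    have h2 := abs_max_sub_max_le_abs (min b |wrap x|) (min b |wrap y|) a
    have h3 := abs_inf_sub_inf_le_abs |wrap x| |wrap y| b
    rw [max_comm, max_comm _ a] at h2
    rw [inf_comm, inf_comm _ b] at h3
    exact h2.trans (h3.trans (abs_wrap_sub_le x y))

lemma IsSpectralWeight.apply_abs {h : ℝ → ℝ} {η : ℝ} (hh : IsSpectralWeight h η) (x : ℝ) :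
    h |x| = h x := by
  rcases abs_choice x with hx | hx <;> rw [hx]
  exact hh.even x

lemma IsSpectralWeight.apply_mul_abs {h : ℝ → ℝ} {η : ℝ} (hh : IsSpectralWeight h η) {c : ℝ}
    (hc : 0 ≤ c) (x : ℝ) : h (c * |x|) = h (c * x) := by
  rw [← hh.apply_abs (c * x), abs_mul, abs_of_nonneg hc]

lemma timeFilter_series {fhat f : ℝ → ℂ} (hae : fhat =ᵐ[volume] f)
    (hper : Function.Periodic f (2 * π)) (hherm : ∀ x, f (-x) = conj (f x))
    (hL : ∃ L, ∀ x y, ‖f x - f y‖ ≤ L * |x - y|) :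
    Summable (fun k => |timeFilter fhat k|) ∧ ∀ᵐ y : ℝ, HasSum
      (fun k : ℤ => (timeFilter fhat k : ℂ) * Complex.exp (-(Complex.I * k * y))) (fhat y) := by
  obtain ⟨L, hL⟩ := hL
  constructor
  · refine (summable_norm_seriesCoeff hper hL).congr fun k => ?_
    rw [← ofReal_timeFilter hae hherm, Complex.norm_real, Real.norm_eq_abs]
  · filter_upwards [hae] with y hy
    rw [hy]
    simp_rw [ofReal_timeFilter hae hherm]
    exact hasSum_seriesCoeff hper hL y

/-- Where `|wrap x| ≤ π/2` the doubled frequency is not folded, and numerator and denominator cancel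
to `1`, which is also `q(π/2)`. Between `π/2` and `2π/3` the quotient is `q(|wrap x|)`, whose
denominator has its argument at least `2^{j+1} π/3`. Beyond `2π/3` the factor `û` vanishes. So the
filter agrees almost everywhere with a Lipschitz function; the zeros of `wrap` are excluded because
the quotient may be `0/0` there. -/
lemma lowFilter_series (M : VelocityModel) {uhat : ℝ → ℂ} (hu : IsMeyerFilter uhat) (j : ℕ) :
    Summable (fun k => |timeFilter (lowFilterHat M uhat j) k|) ∧ ∀ᵐ y : ℝ, HasSum
      (fun k : ℤ => (timeFilter (lowFilterHat M uhat j) k : ℂ)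
        * Complex.exp (-(Complex.I * k * y))) (lowFilterHat M uhat j y) := by
  obtain ⟨η, hh⟩ := exists_isSpectralWeight M
  set h := spectralFilter M with hdef
  have hpi := Real.pi_pos
  have h2 : (0 : ℝ) < 2 ^ (j + 1) := by positivity
  set q : ℝ → ℝ := fun m => h (2 ^ (j + 1) * m) / h (2 ^ (j + 1) * (π - m)) with hq
  have hqC : ContDiffOn ℝ 1 q (Set.Icc (π / 2) (2 * π / 3)) := by
    have hm1 : ∀ m ∈ Set.Icc (π / 2) (2 * π / 3), 2 ^ (j + 1) * m ∈ Set.Ioi (0 : ℝ) := fun m hm =>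
      mul_pos h2 (by linarith [hm.1])
    have hm2 : ∀ m ∈ Set.Icc (π / 2) (2 * π / 3), 2 ^ (j + 1) * (π - m) ∈ Set.Ioi (0 : ℝ) :=
      fun m hm => mul_pos h2 (by linarith [hm.2])
    refine ContDiffOn.div (hh.contDiffOn.comp (by fun_prop) hm1)
      (hh.contDiffOn.comp (by fun_prop) hm2) fun m hm => (hh.pos _ (ne_of_gt (hm2 m hm))).ne'
  obtain ⟨⟨B, hB⟩, hL⟩ := exists_lipschitz_comp_clamp (by linarith) hqC
  refine timeFilter_series
    (f := fun x => (q (max (π / 2) (min (2 * π / 3) |wrap x|)) : ℂ) * uhat x) ?_ ?_ ?_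
    (exists_lipschitz_mul hB hu.norm_le hL hu.exists_lipschitz)
  · filter_upwards [ae_wrap_mul_ne_zero one_ne_zero] with x hx
    rw [one_mul] at hx
    have hx0 : 0 < |wrap x| := abs_pos.mpr hx
    have hs : √(2 * π) ≠ 0 := (Real.sqrt_pos.mpr Real.two_pi_pos).ne'
    simp only [lowFilterHat, discreteFilter_eq, ← hdef, mul_div_mul_left _ _ hs]
    rcases le_or_gt (2 * π / 3) |wrap x| with h3 | h3
    · rw [hu.eq_zero_of_le_abs_wrap h3, mul_zero, mul_zero]
    congr 2
    rw [← hh.apply_mul_abs h2.le, ← hh.apply_mul_abs (show (0 : ℝ) ≤ 2 ^ j by positivity),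
      abs_wrap_two_mul, min_eq_right h3.le]
    split_ifs with h4
    · rw [max_eq_left h4, hq]
      simp only
      rw [show π - π / 2 = π / 2 by ring, show (2 : ℝ) ^ j * (2 * |wrap x|) = 2 ^ (j + 1) * |wrap x|
        by ring, div_self (hh.pos _ (by positivity)).ne', div_self (hh.pos _ (by positivity)).ne']
    · rw [max_eq_right (le_of_not_ge h4), hq]
      simp only
      congr 2
      ring
  · intro x; simp only [periodic_wrap x, hu.periodic x]
  · intro x; simp only [abs_wrap_neg, hu.hermitian, map_mul, Complex.conj_ofReal]

/-- The only bad point of `ĝ_{j+1}` in a period is `0`, and `v̂` vanishes for `|wrap x| ≤ π/3`. At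
`±π` there is no jump, since the filter depends on `|wrap x|` only. -/
lemma highFilter_series (M : VelocityModel) {uhat : ℝ → ℂ} (hu : IsMeyerFilter uhat) (j : ℕ) :
    Summable (fun k => |timeFilter (highFilterHat M uhat j) k|) ∧ ∀ᵐ y : ℝ, HasSum
      (fun k : ℤ => (timeFilter (highFilterHat M uhat j) k : ℂ)
        * Complex.exp (-(Complex.I * k * y))) (highFilterHat M uhat j y) := by
  obtain ⟨η, hh⟩ := exists_isSpectralWeight M
  set h := spectralFilter M with hdef
  have hpi := Real.pi_pos
  have h2 : (0 : ℝ) < 2 ^ (j + 1) := by positivity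
  set q : ℝ → ℝ := fun m => √(2 * π) * h (2 ^ (j + 1) * m) with hq
  have hqC : ContDiffOn ℝ 1 q (Set.Icc (π / 3) π) := by
    refine contDiffOn_const.mul (hh.contDiffOn.comp (by fun_prop) fun m hm => ?_)
    exact mul_pos h2 (by linarith [hm.1])
  obtain ⟨⟨B, hB⟩, hL⟩ := exists_lipschitz_comp_clamp (by linarith) hqC
  have hvL : ∃ L, ∀ x y, ‖highPass uhat x - highPass uhat y‖ ≤ L * |x - y| := by
    refine exists_lipschitz_mul (A := 1) (B := 2) (fun x => ?_) (fun x => ?_) ⟨1, fun x y => ?_⟩ ?_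
    · rw [Complex.norm_exp]; simp
    · rw [RCLike.norm_conj]; exact hu.norm_le _
    · have h1 : Complex.exp (-(Complex.I * x)) - Complex.exp (-(Complex.I * y))
          = Complex.exp (-(Complex.I * y)) * (Complex.exp (Complex.I * ((y - x : ℝ) : ℂ)) - 1) := by
        rw [mul_sub, ← Complex.exp_add, mul_one]
        congr 2; push_cast; ring
      rw [h1, norm_mul, Complex.norm_exp]
      have := Real.norm_exp_I_mul_ofReal_sub_one_le (x := y - x)
      rw [Real.norm_eq_abs, abs_sub_comm] at this
      simpa using this
    · obtain ⟨L, hL⟩ := hu.exists_lipschitz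
      refine ⟨L, fun x y => ?_⟩
      rw [← map_sub, RCLike.norm_conj]
      refine (hL _ _).trans (le_of_eq ?_)
      congr 2; ring
  refine timeFilter_series
    (f := fun x => (q (max (π / 3) (min π |wrap x|)) : ℂ) * highPass uhat x) ?_ ?_ ?_
    (exists_lipschitz_mul hB (B := 2) (fun x => ?_) hL hvL)
  · refine ae_of_all _ fun x => ?_
    simp only [highFilterHat, discreteFilter_eq, ← hdef]
    rcases le_or_gt |wrap x| (π / 3) with h3 | h3
    · rw [hu.highPass_eq_zero h3, mul_zero, mul_zero]
    · rw [min_eq_right (abs_wrap_le x), max_eq_right h3.le, hq, ← hh.apply_mul_abs h2.le]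
  · intro x; simp only [periodic_wrap x, hu.periodic_highPass x]
  · intro x; simp only [abs_wrap_neg, hu.highPass_neg, map_mul, Complex.conj_ofReal]
  · rw [IsMeyerFilter.norm_highPass]; exact hu.norm_le _

/-! ### The Meyer scaling function and wavelet on the Fourier side -/

/-- The complex conjugate of the Fourier transform of the Meyer scaling function. -/
def scalingHat (uhat : ℝ → ℂ) (y : ℝ) : ℂ :=
  if |y| ≤ 2 * π then conj (uhat (y / 2)) / (√2 : ℝ) else 0

/-- The complex conjugate of the Fourier transform of the Meyer wavelet. -/
def waveletHat (uhat : ℝ → ℂ) (y : ℝ) : ℂ :=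
  conj (highPass uhat (y / 2)) * scalingHat uhat (y / 2) / (√2 : ℝ)

lemma ofReal_sqrt_two_ne_zero : ((√2 : ℝ) : ℂ) ≠ 0 := by
  simp

lemma ofReal_sqrt_two_mul_self : ((√2 : ℝ) : ℂ) * (√2 : ℝ) = 2 := by
  rw [← Complex.ofReal_mul, Real.mul_self_sqrt (by norm_num)]
  norm_num

lemma scalingHat_neg {uhat : ℝ → ℂ} (hu : IsMeyerFilter uhat) (y : ℝ) :
    scalingHat uhat (-y) = conj (scalingHat uhat y) := by
  simp only [scalingHat, abs_neg]
  split_ifs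
  · rw [neg_div, hu.hermitian, map_div₀, Complex.conj_ofReal]
  · simp

lemma waveletHat_neg {uhat : ℝ → ℂ} (hu : IsMeyerFilter uhat) (y : ℝ) :
    waveletHat uhat (-y) = conj (waveletHat uhat y) := by
  simp only [waveletHat, neg_div, hu.highPass_neg, scalingHat_neg hu, map_div₀, map_mul,
    Complex.conj_ofReal]

lemma scalingHat_eq_one {uhat : ℝ → ℂ} (hu : IsMeyerFilter uhat) {y : ℝ} (hy : |y| ≤ 2 * π / 3) :
    scalingHat uhat y = 1 := by
  have hpi := Real.pi_pos
  rw [scalingHat, if_pos (by linarith), hu.pass_band, Complex.conj_ofReal,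
    div_self ofReal_sqrt_two_ne_zero]
  rw [abs_div, abs_two]; linarith

lemma scalingHat_eq_zero {uhat : ℝ → ℂ} (hu : IsMeyerFilter uhat) {y : ℝ} (hy : 4 * π / 3 ≤ |y|) :
    scalingHat uhat y = 0 := by
  rw [scalingHat]
  split_ifs with h
  · rw [hu.stop_band, map_zero, zero_div] <;> rw [abs_div, abs_two] <;> linarith
  · rfl

/-- This is the two-scale equation. The infinite product defining a scaling function has collapsed
to one factor because `û = √2` on the pass band: the second factor on the right is `1` for `|y| ≤
2π/3`, then `û(y) = 0` up to `4π/3` (beyond `π` by periodicity), and after that the second factor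
itself is `0`. -/
lemma scalingHat_two_mul {uhat : ℝ → ℂ} (hu : IsMeyerFilter uhat) (y : ℝ) :
    scalingHat uhat (2 * y) = conj (uhat y) * scalingHat uhat y / (√2 : ℝ) := by
  have hpi := Real.pi_pos
  rcases le_or_gt |y| π with h | h
  · rw [scalingHat, if_pos (by rw [abs_mul, abs_two]; linarith),
      show 2 * y / 2 = y by ring]
    rcases le_or_gt |y| (2 * π / 3) with h2 | h2
    · rw [scalingHat_eq_one hu h2, mul_one]
    · rw [hu.stop_band y h2.le h]; simp
  · rw [scalingHat, if_neg (by rw [abs_mul, abs_two]; linarith)]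
    rcases le_or_gt (4 * π / 3) |y| with h2 | h2
    · rw [scalingHat_eq_zero hu h2]; simp
    · have h0 : uhat y = 0 := by
        rcases le_total 0 y with hy | hy
        · rw [abs_of_nonneg hy] at h h2
          rw [← hu.periodic.sub_eq]
          refine hu.stop_band _ ?_ ?_ <;> rw [abs_of_nonpos (by linarith)] <;> linarith
        · rw [abs_of_nonpos hy] at h h2
          rw [← hu.periodic]
          refine hu.stop_band _ ?_ ?_ <;> rw [abs_of_nonneg (by linarith)] <;> linarith
      rw [h0]; simp

lemma waveletHat_two_mul (uhat : ℝ → ℂ) (y : ℝ) :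
    waveletHat uhat (2 * y) = conj (highPass uhat y) * scalingHat uhat y / (√2 : ℝ) := by
  rw [waveletHat, show 2 * y / 2 = y by ring]

lemma norm_scalingHat_le_one {uhat : ℝ → ℂ} (hu : IsMeyerFilter uhat) (y : ℝ) :
    ‖scalingHat uhat y‖ ≤ 1 := by
  rw [scalingHat]
  split_ifs
  · rw [norm_div, RCLike.norm_conj, Complex.norm_real, Real.norm_eq_abs,
      abs_of_nonneg (Real.sqrt_nonneg 2), div_le_one (by positivity)]
    exact Real.le_sqrt_of_sq_le (hu.norm_sq_le _)
  · simp

lemma norm_waveletHat_le {uhat : ℝ → ℂ} (hu : IsMeyerFilter uhat) (y : ℝ) :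
    ‖waveletHat uhat y‖ ≤ 2 := by
  have h2 : 1 ≤ √2 := Real.one_le_sqrt.mpr (by norm_num)
  rw [waveletHat, norm_div, norm_mul, RCLike.norm_conj, Complex.norm_real, Real.norm_eq_abs,
    abs_of_nonneg (Real.sqrt_nonneg 2), IsMeyerFilter.norm_highPass, div_le_iff₀ (by positivity)]
  have h3 := hu.norm_le (y / 2 + π)
  have h4 := norm_scalingHat_le_one hu (y / 2)
  have h5 := norm_nonneg (uhat (y / 2 + π))
  have h6 := norm_nonneg (scalingHat uhat (y / 2))
  nlinarith

lemma measurable_scalingHat {uhat : ℝ → ℂ} (hu : IsMeyerFilter uhat) :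
    Measurable (scalingHat uhat) := by
  have hc := hu.continuous.measurable
  unfold scalingHat
  refine Measurable.ite (measurableSet_le (by fun_prop) (by fun_prop)) ?_ measurable_const
  exact (Complex.continuous_conj.measurable.comp (hc.comp (by fun_prop))).div_const _

lemma measurable_waveletHat {uhat : ℝ → ℂ} (hu : IsMeyerFilter uhat) :
    Measurable (waveletHat uhat) := by
  have hc := hu.continuous_highPass.measurable
  have hs := measurable_scalingHat hu
  unfold waveletHat
  exact ((Complex.continuous_conj.measurable.comp (hc.comp (by fun_prop))).mul
    (hs.comp (by fun_prop))).div_const _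

lemma scalingHat_eq_zero_of_lt {uhat : ℝ → ℂ} {y : ℝ} (hy : 4 * π < |y|) :
    scalingHat uhat y = 0 := by
  rw [scalingHat, if_neg (by linarith [Real.pi_pos])]

lemma waveletHat_eq_zero_of_lt {uhat : ℝ → ℂ} {y : ℝ} (hy : 4 * π < |y|) :
    waveletHat uhat y = 0 := by
  have : scalingHat uhat (y / 2) = 0 := by
    rw [scalingHat, if_neg (by rw [abs_div, abs_two]; linarith [Real.pi_pos])]
  rw [waveletHat, this]; simp

/-! ### Integrals of periodic functions against products of scaling functions and wavelets -/

lemma IntervalIntegrable.of_periodic {p : ℝ → ℂ} (hp : Function.Periodic p (2 * π))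
    (hint : IntervalIntegrable p volume (-π) π) (a b : ℝ) : IntervalIntegrable p volume a b :=
  hp.intervalIntegrable Real.two_pi_pos.ne' (t := -π)
    (by rwa [show -π + 2 * π = π by ring]) a b

lemma periodic_comp_two_mul {α : Type*} {p : ℝ → α} (hp : Function.Periodic p (2 * π)) :
    Function.Periodic (fun z => p (2 * z)) (2 * π) := fun z => by
  change p (2 * (z + 2 * π)) = p (2 * z)
  rw [show 2 * (z + 2 * π) = 2 * z + 2 * π + 2 * π by ring, hp, hp]

lemma intervalIntegrable_comp_two_mul {p : ℝ → ℂ} (hp : Function.Periodic p (2 * π))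
    (hint : IntervalIntegrable p volume (-π) π) (a b : ℝ) :
    IntervalIntegrable (fun z => p (2 * z)) volume a b := by
  have h := (IntervalIntegrable.of_periodic hp hint (2 * a) (2 * b)).comp_mul_left (c := 2)
  simpa using h

lemma integral_comp_two_mul_of_periodic {p : ℝ → ℂ} (hp : Function.Periodic p (2 * π))
    (hint : IntervalIntegrable p volume (-π) π) :
    ∫ z in (-π)..π, p (2 * z) = ∫ z in (-π)..π, p z := by
  rw [intervalIntegral.integral_comp_mul_left _ two_ne_zero]
  have h := hp.intervalIntegral_add_zsmul_eq 2 (2 * -π) (IntervalIntegrable.of_periodic hp hint)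
  have h' := hp.intervalIntegral_add_eq (2 * -π) (-π)
  rw [show -π + 2 * π = π by ring] at h'
  rw [h', show 2 * -π + (2 : ℤ) • (2 * π) = 2 * π by rw [zsmul_eq_mul]; push_cast; ring] at h
  rw [h, ← Int.cast_smul_eq_zsmul ℝ, smul_smul]
  norm_num

/-- The translation by `π` preserves `z ↦ p(2z)`, so `r` may be replaced by its average with its
translate, which is the constant `c/2`. -/
lemma integral_comp_two_mul_mul {p r : ℝ → ℂ} {c : ℂ} (hp : Function.Periodic p (2 * π))
    (hint : IntervalIntegrable p volume (-π) π) (hr : Function.Periodic r (2 * π))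
    (hrc : Continuous r) (hc : ∀ z, r z + r (z + π) = c) :
    ∫ z in (-π)..π, p (2 * z) * r z = c / 2 * ∫ z in (-π)..π, p z := by
  have hG : Function.Periodic (fun z => p (2 * z) * r z) (2 * π) := (periodic_comp_two_mul hp).mul hr
  have hGi : ∀ a b, IntervalIntegrable (fun z => p (2 * z) * r z) volume a b := fun a b =>
    (intervalIntegrable_comp_two_mul hp hint a b).mul_continuousOn hrc.continuousOn
  have hshift : ∫ z in (-π)..π, p (2 * (z + π)) * r (z + π) = ∫ z in (-π)..π, p (2 * z) * r z := by
    rw [intervalIntegral.integral_comp_add_right (fun z => p (2 * z) * r z) π]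
    have := hG.intervalIntegral_add_eq (-π + π) (-π)
    rw [show -π + 2 * π = π by ring, show -π + π + 2 * π = π + π by ring] at this
    exact this
  have hshift_int : IntervalIntegrable (fun z => p (2 * (z + π)) * r (z + π)) volume (-π) π := by
    have := (hGi (-π + π) (π + π)).comp_add_right π
    simpa using this
  have hadd : (∫ z in (-π)..π, p (2 * z) * r z) + ∫ z in (-π)..π, p (2 * z) * r z
      = c * ∫ z in (-π)..π, p z := by
    nth_rewrite 2 [← hshift]
    rw [← intervalIntegral.integral_add (hGi _ _) hshift_int,
      ← integral_comp_two_mul_of_periodic hp hint, ← intervalIntegral.integral_const_mul]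
    refine intervalIntegral.integral_congr fun z _ => ?_
    rw [show 2 * (z + π) = 2 * z + 2 * π by ring, hp, ← mul_add, hc, mul_comm]
  linear_combination hadd / 2

lemma integrable_periodic_mul {p F : ℝ → ℂ} {C R : ℝ} (hp : Function.Periodic p (2 * π))
    (hint : IntervalIntegrable p volume (-π) π) (hF : Measurable F) (hC : ∀ y, ‖F y‖ ≤ C)
    (hR : ∀ y, R < |y| → F y = 0) : Integrable fun y => p y * F y := by
  have h1 : IntegrableOn p (Set.Icc (-|R|) |R|) := by
    rw [integrableOn_Icc_iff_integrableOn_Ioc]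
    exact (intervalIntegrable_iff_integrableOn_Ioc_of_le (by linarith [abs_nonneg R])).mp
      (IntervalIntegrable.of_periodic hp hint _ _)
  have h2 : IntegrableOn (fun y => p y * F y) (Set.Icc (-|R|) |R|) :=
    Integrable.mul_bdd (c := C) h1 hF.aestronglyMeasurable (ae_of_all _ hC)
  refine (integrableOn_iff_integrable_of_support_subset fun y hy => ?_).mp h2
  rw [Set.mem_Icc, ← abs_le]
  by_contra hlt
  push Not at hlt
  exact hy (by simp only [hR y ((le_abs_self R).trans_lt hlt), mul_zero])

/-- Weak form of `∑ₙ |φ̂(y + 2πn)|² = 1`, that is, of the orthonormality of the integer translates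
of the scaling function. On its support the squared modulus is `|û(y/2)|²/2`, and the mirror
condition gives `c = 1` in `integral_comp_two_mul_mul`. The periodic weight `p` is kept general so
as to absorb `h`, exponentials and filters of other scales. -/
lemma integral_periodic_mul_scalingHat {uhat : ℝ → ℂ} (hu : IsMeyerFilter uhat) {p : ℝ → ℂ}
    (hp : Function.Periodic p (2 * π)) (hint : IntervalIntegrable p volume (-π) π) :
    ∫ y, p y * (scalingHat uhat y * conj (scalingHat uhat y)) = ∫ y in (-π)..π, p y := by
  have hpi := Real.pi_pos
  have h1 : ∫ y, p y * (scalingHat uhat y * conj (scalingHat uhat y))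
      = ∫ y in (-(2 * π))..(2 * π), p (2 * (y / 2)) * (uhat (y / 2) * conj (uhat (y / 2)) / 2) := by
    rw [intervalIntegral.integral_of_le (by linarith), ← integral_Icc_eq_integral_Ioc,
      ← setIntegral_eq_integral_of_forall_compl_eq_zero (s := Set.Icc (-(2 * π)) (2 * π))]
    · refine setIntegral_congr_fun measurableSet_Icc fun y hy => ?_
      simp only [scalingHat]
      rw [if_pos (abs_le.mpr hy), map_div₀, Complex.conj_conj, Complex.conj_ofReal, div_mul_div_comm,
        ofReal_sqrt_two_mul_self, mul_comm (conj _), mul_div_cancel₀ y two_ne_zero]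
    · intro y hy
      rw [scalingHat, if_neg (fun h => hy (abs_le.mp h))]; simp
  have hr : ∀ z, uhat z * conj (uhat z) / 2 + uhat (z + π) * conj (uhat (z + π)) / 2 = 1 := by
    intro z
    have := hu.mirror z
    rw [Complex.mul_conj, Complex.mul_conj, Complex.normSq_eq_norm_sq, Complex.normSq_eq_norm_sq,
      ← add_div, ← Complex.ofReal_add, this]
    norm_num
  have hcont := hu.continuous
  rw [h1, intervalIntegral.integral_comp_div
    (fun z => p (2 * z) * (uhat z * conj (uhat z) / 2)) two_ne_zero,
    show -(2 * π) / 2 = -π by ring, show 2 * π / 2 = π by ring,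
    integral_comp_two_mul_mul hp hint (r := fun z => uhat z * conj (uhat z) / 2) (c := 1)
      (fun z => by simp only [hu.periodic z]) (by fun_prop) hr]
  rw [Complex.real_smul]; push_cast; ring

lemma integral_eq_two_mul_integral_comp (F : ℝ → ℂ) : ∫ y, F y = 2 * ∫ z, F (2 * z) := by
  rw [Measure.integral_comp_mul_left F 2, Complex.real_smul]
  rw [abs_of_pos (by norm_num)]
  push_cast; ring

lemma intervalIntegrable_comp_two_mul_mul {p r : ℝ → ℂ} (hp : Function.Periodic p (2 * π))
    (hint : IntervalIntegrable p volume (-π) π) (hr : Continuous r) (a b : ℝ) :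
    IntervalIntegrable (fun z => p (2 * z) * r z) volume a b :=
  (intervalIntegrable_comp_two_mul hp hint a b).mul_continuousOn hr.continuousOn

/-- The substitution `y = 2z` and the two-scale equations turn the integrand into a periodic weight
times `|φ̂(z)|²`. Its factor `conj(v̂) û` changes sign under `z ↦ z + π`, so the averaging constant
is `c = 0`. -/
lemma integral_periodic_mul_waveletHat_mul_scalingHat {uhat : ℝ → ℂ} (hu : IsMeyerFilter uhat)
    {p : ℝ → ℂ} (hp : Function.Periodic p (2 * π)) (hint : IntervalIntegrable p volume (-π) π) :
    ∫ y, p y * (waveletHat uhat y * conj (scalingHat uhat y)) = 0 := by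
  have hc := hu.continuous
  have hc' := hu.continuous_highPass
  have hrp : Function.Periodic (fun z => conj (highPass uhat z) * uhat z / 2) (2 * π) := fun z => by
    simp only [hu.periodic z, hu.periodic_highPass z]
  have hrc : Continuous fun z => conj (highPass uhat z) * uhat z / 2 := by fun_prop
  have h1 : ∀ z, p (2 * z) * (waveletHat uhat (2 * z) * conj (scalingHat uhat (2 * z)))
      = p (2 * z) * (conj (highPass uhat z) * uhat z / 2)
        * (scalingHat uhat z * conj (scalingHat uhat z)) := by
    intro z
    rw [waveletHat_two_mul, scalingHat_two_mul hu, map_div₀, map_mul, Complex.conj_conj,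
      Complex.conj_ofReal, div_mul_div_comm, ofReal_sqrt_two_mul_self]
    ring
  rw [integral_eq_two_mul_integral_comp]
  simp_rw [h1]
  rw [integral_periodic_mul_scalingHat hu
      (p := fun z => p (2 * z) * (conj (highPass uhat z) * uhat z / 2))
      ((periodic_comp_two_mul hp).mul hrp)
      (intervalIntegrable_comp_two_mul_mul hp hint hrc _ _),
    integral_comp_two_mul_mul hp hint hrp hrc (c := 0)]
  · simp
  · intro z
    simp only [highPass, map_mul, Complex.conj_conj, ← Complex.exp_conj, map_neg, Complex.conj_I,
      Complex.conj_ofReal]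
    rw [show z + π + π = z + 2 * π by ring, hu.periodic]
    have : Complex.exp (-(-Complex.I * ((z + π : ℝ) : ℂ)))
        = -Complex.exp (-(-Complex.I * (z : ℂ))) := by
      rw [show -(-Complex.I * ((z + π : ℝ) : ℂ)) = -(-Complex.I * (z : ℂ)) + π * Complex.I by
        push_cast; ring, Complex.exp_add, Complex.exp_pi_mul_I]
      ring
    rw [this]; ring

/-- Same reduction, now with `|v̂(z)|²/2`, for which the mirror condition gives `c = 1`. -/
lemma integral_periodic_mul_waveletHat {uhat : ℝ → ℂ} (hu : IsMeyerFilter uhat) {p : ℝ → ℂ}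
    (hp : Function.Periodic p (2 * π)) (hint : IntervalIntegrable p volume (-π) π) :
    ∫ y, p y * (waveletHat uhat y * conj (waveletHat uhat y)) = ∫ y in (-π)..π, p y := by
  have hc := hu.continuous
  have hc' := hu.continuous_highPass
  have hrp : Function.Periodic (fun z => conj (highPass uhat z) * highPass uhat z / 2) (2 * π) :=
    fun z => by simp only [hu.periodic_highPass z]
  have hrc : Continuous fun z => conj (highPass uhat z) * highPass uhat z / 2 := by fun_prop
  have h1 : ∀ z, p (2 * z) * (waveletHat uhat (2 * z) * conj (waveletHat uhat (2 * z)))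
      = p (2 * z) * (conj (highPass uhat z) * highPass uhat z / 2)
        * (scalingHat uhat z * conj (scalingHat uhat z)) := by
    intro z
    rw [waveletHat_two_mul, map_div₀, map_mul, Complex.conj_conj,
      Complex.conj_ofReal, div_mul_div_comm, ofReal_sqrt_two_mul_self]
    ring
  rw [integral_eq_two_mul_integral_comp]
  simp_rw [h1]
  rw [integral_periodic_mul_scalingHat hu
      (p := fun z => p (2 * z) * (conj (highPass uhat z) * highPass uhat z / 2))
      ((periodic_comp_two_mul hp).mul hrp)
      (intervalIntegrable_comp_two_mul_mul hp hint hrc _ _),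
    integral_comp_two_mul_mul hp hint hrp hrc (c := 1)]
  · ring
  · intro z
    have := hu.mirror z
    rw [← add_div, Complex.conj_mul', Complex.conj_mul', IsMeyerFilter.norm_highPass,
      IsMeyerFilter.norm_highPass, show z + π + π = z + 2 * π by ring, hu.periodic, add_comm]
    have h2 : ((‖uhat z‖ : ℂ)) ^ 2 + (‖uhat (z + π)‖ : ℂ) ^ 2 = 2 := by exact_mod_cast this
    rw [h2]; norm_num

/-! ### Relations across several scales. -/

lemma exists_scalingHat_two_pow_mul {uhat : ℝ → ℂ} (hu : IsMeyerFilter uhat) (r : ℕ) :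
    ∃ m : ℝ → ℂ, Continuous m ∧ Function.Periodic m (2 * π) ∧
      ∀ y, scalingHat uhat (2 ^ r * y) = m y * scalingHat uhat y := by
  have hc := hu.continuous
  induction r with
  | zero => exact ⟨fun _ => 1, continuous_const, fun _ => rfl, fun y => by simp⟩
  | succ r ih =>
    obtain ⟨m, hm, hper, h⟩ := ih
    refine ⟨fun y => m (2 * y) * (conj (uhat y) / (√2 : ℝ)), by fun_prop, ?_, fun y => ?_⟩
    · exact (periodic_comp_two_mul hper).mul fun y => by simp only [hu.periodic y]
    · rw [show (2 : ℝ) ^ (r + 1) * y = 2 ^ r * (2 * y) by ring, h, scalingHat_two_mul hu]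
      ring

lemma periodic_comp_two_pow_mul {α : Type*} {p : ℝ → α} (hp : Function.Periodic p (2 * π))
    (r : ℕ) : Function.Periodic (fun z => p (2 ^ r * z)) (2 * π) := fun z => by
  have := hp.int_mul (2 ^ r) (2 ^ r * z)
  change p (2 ^ r * (z + 2 * π)) = p (2 ^ r * z)
  rw [← this]; congr 1; push_cast; ring

/-- A coarser function, seen at the finer scale, is a periodic multiple of the finer scaling
function. Orthogonality between different levels thereby reduces to that of wavelet and scaling
function at one level. -/
lemma exists_waveletHat_two_pow_mul {uhat : ℝ → ℂ} (hu : IsMeyerFilter uhat) (r : ℕ) :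
    ∃ m : ℝ → ℂ, Continuous m ∧ Function.Periodic m (2 * π) ∧
      ∀ y, waveletHat uhat (2 ^ (r + 1) * y) = m y * scalingHat uhat y := by
  obtain ⟨m, hm, hper, h⟩ := exists_scalingHat_two_pow_mul hu r
  have hc := hu.continuous_highPass
  refine ⟨fun y => conj (highPass uhat (2 ^ r * y)) * m y / (√2 : ℝ), by fun_prop, ?_, fun y => ?_⟩
  · intro y
    have h1 := periodic_comp_two_pow_mul hu.periodic_highPass r y
    simp only at h1
    simp only [h1, hper y]
  · rw [show (2 : ℝ) ^ (r + 1) * y = 2 * (2 ^ r * y) by ring, waveletHat_two_mul, h]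
    ring

/-! ### Square integrable functions -/

lemma Lp_norm_sq_eq {f : ℝ → ℂ} {X : Lp ℂ 2 (volume : Measure ℝ)} (hX : X =ᵐ[volume] f) :
    ‖X‖ ^ 2 = ∫ x, ‖f x‖ ^ 2 := by
  rw [← real_inner_self_eq_norm_sq, L2.inner_def]
  refine integral_congr_ae ?_
  filter_upwards [hX] with x hx
  rw [real_inner_self_eq_norm_sq, hx]

lemma inner_toLp_eq {f g : ℝ → ℂ} (hf : MemLp f 2) (hg : MemLp g 2) :
    inner ℝ (hf.toLp f) (hg.toLp g) = (∫ x, g x * conj (f x)).re := by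
  have hint : Integrable fun x => g x * conj (f x) := hg.integrable_mul hf.star
  have h1 := integral_re (𝕜 := ℂ) hint
  simp only [RCLike.re_to_complex] at h1
  rw [← h1, L2.inner_def]
  refine integral_congr_ae ?_
  filter_upwards [hf.coeFn_toLp, hg.coeFn_toLp] with x hx hy
  rw [hx, hy, Complex.inner]

/-- The sum of a summable series in `Lp` agrees almost everywhere with the pointwise sum. -/
lemma Lp_tsum_ae_eq {α E : Type*} [MeasurableSpace α] {μ : Measure α} [NormedAddCommGroup E]
    {F : ℤ → Lp E 2 μ} {g : α → E} {S : Lp E 2 μ} (hF : HasSum F S)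
    (hg : ∀ᵐ x ∂μ, HasSum (fun n => F n x) (g x)) : S =ᵐ[μ] g := by
  -- Convergence along symmetric intervals provides a sequence. Convergence in `L²` then implies
  -- convergence in measure, and a subsequence converges almost everywhere.
  have hs : Filter.Tendsto (fun N : ℕ => Finset.Icc (-(N : ℤ)) N) Filter.atTop Filter.atTop :=
    Finset.tendsto_Icc_neg_atTop_atTop.comp tendsto_natCast_atTop_atTop
  have h1 := tendstoInMeasure_of_tendsto_Lp (hF.comp hs)
  obtain ⟨ns, hns, hlim⟩ := h1.exists_seq_tendsto_ae
  have hco : ∀ᵐ x ∂μ, ∀ N : ℕ, (∑ n ∈ Finset.Icc (-(N : ℤ)) N, F n : Lp E 2 μ) x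
      = ∑ n ∈ Finset.Icc (-(N : ℤ)) N, F n x := by
    rw [ae_all_iff]
    intro N
    filter_upwards [Lp.coeFn_finsetSum (Finset.Icc (-(N : ℤ)) N) F] with x hx
    rw [hx, Finset.sum_apply]
  filter_upwards [hlim, hco, hg] with x hx hc hgx
  have h2 : Filter.Tendsto (fun i => ∑ n ∈ Finset.Icc (-(ns i : ℤ)) (ns i), F n x) Filter.atTop
      (nhds (g x)) := (hgx.comp hs).comp hns.tendsto_atTop
  refine tendsto_nhds_unique hx (h2.congr fun i => ?_)
  exact (hc (ns i)).symm

lemma ae_comp_affine {P : ℝ → Prop} (hP : ∀ᵐ y : ℝ, P y) {c : ℝ} (hc : c ≠ 0) (b : ℝ) :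
    ∀ᵐ x : ℝ, P (x / c + b) := by
  have h1 : ∀ᵐ y : ℝ, P (y + b) :=
    (measurePreserving_add_right volume b).quasiMeasurePreserving.ae hP
  rw [ae_iff] at h1 ⊢
  have h2 := Real.volume_preimage_mul_left (inv_ne_zero hc) {y | ¬ P (y + b)}
  rw [h1, mul_zero] at h2
  convert h2 using 2
  ext x
  simp [div_eq_inv_mul]

/-! ### Dilated and modulated functions -/

/-- The function `2^{-J/2} F(2^{-J} x) e^{i k 2^{-J} x}`. -/
def atom (F : ℝ → ℂ) (J : ℕ) (k : ℤ) (x : ℝ) : ℂ :=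
  ((√2 : ℝ) : ℂ)⁻¹ ^ J * F (x / 2 ^ J) * Complex.exp (Complex.I * k * ((x / 2 ^ J : ℝ) : ℂ))

lemma norm_exp_I_mul (k : ℤ) (x : ℝ) : ‖Complex.exp (Complex.I * k * x)‖ = 1 := by
  rw [Complex.norm_exp]; simp

lemma measurable_atom {F : ℝ → ℂ} (hF : Measurable F) (J : ℕ) (k : ℤ) :
    Measurable (atom F J k) := by
  unfold atom
  fun_prop

lemma memLp_atom {F : ℝ → ℂ} (hF : Measurable F) (hi : Integrable fun y => ‖F y‖ ^ 2) (J : ℕ)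
    (k : ℤ) : MemLp (atom F J k) 2 := by
  rw [memLp_two_iff_integrable_sq_norm (measurable_atom hF J k).aestronglyMeasurable]
  have h1 := (hi.comp_div (R := 2 ^ J) (by positivity)).const_mul (‖((√2 : ℝ) : ℂ)⁻¹ ^ J‖ ^ 2)
  refine h1.congr (ae_of_all _ fun x => ?_)
  simp only [atom, norm_mul, norm_exp_I_mul, mul_one, mul_pow]

lemma inv_sqrt_two_pow_mul_self (J : ℕ) :
    ((√2 : ℝ) : ℂ)⁻¹ ^ J * ((√2 : ℝ) : ℂ)⁻¹ ^ J = (2 ^ J)⁻¹ := by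
  rw [← mul_pow, ← mul_inv, ofReal_sqrt_two_mul_self, inv_pow]

lemma conj_inv_sqrt_two_pow (J : ℕ) :
    conj (((√2 : ℝ) : ℂ)⁻¹ ^ J) = ((√2 : ℝ) : ℂ)⁻¹ ^ J := by
  rw [map_pow, map_inv₀, Complex.conj_ofReal]

lemma conj_exp_I_mul (k : ℤ) (x : ℝ) :
    conj (Complex.exp (Complex.I * k * x)) = Complex.exp (Complex.I * (-k : ℤ) * x) := by
  rw [← Complex.exp_conj]
  simp

lemma integral_atom_mul_conj_atom (F G : ℝ → ℂ) (J : ℕ) (k l : ℤ) :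
    ∫ x, atom G J l x * conj (atom F J k x)
      = ∫ y, G y * conj (F y) * Complex.exp (Complex.I * (l - k : ℤ) * y) := by
  have h1 : ∀ x, atom G J l x * conj (atom F J k x) = (2 ^ J : ℂ)⁻¹ *
      (G (x / 2 ^ J) * conj (F (x / 2 ^ J)) *
        Complex.exp (Complex.I * (l - k : ℤ) * ((x / 2 ^ J : ℝ) : ℂ))) := by
    intro x
    simp only [atom, map_mul, conj_inv_sqrt_two_pow, conj_exp_I_mul]
    have h2 : Complex.exp (Complex.I * (l - k : ℤ) * ((x / 2 ^ J : ℝ) : ℂ))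
        = Complex.exp (Complex.I * l * ((x / 2 ^ J : ℝ) : ℂ))
          * Complex.exp (Complex.I * (-k : ℤ) * ((x / 2 ^ J : ℝ) : ℂ)) := by
      rw [← Complex.exp_add]; congr 1; push_cast; ring
    rw [h2, ← inv_sqrt_two_pow_mul_self]
    ring
  simp_rw [h1]
  rw [integral_const_mul, Measure.integral_comp_div
    (fun y : ℝ => G y * conj (F y) * Complex.exp (Complex.I * (l - k : ℤ) * (y : ℂ))) (2 ^ J),
    abs_of_pos (by positivity), Complex.real_smul]
  push_cast
  rw [inv_mul_cancel_left₀ (pow_ne_zero J two_ne_zero)]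

/-- Rescaling by the finer scale `2^{J+r}` turns the coarse frequency `k` into the integer `2^r k`,
so the modulations combine into one `2π`-periodic exponential. -/
lemma integral_atom_mul_conj_atom_eq_zero {F G : ℝ → ℂ} (J r : ℕ) (k l : ℤ)
    (h : ∀ n : ℤ, ∫ y : ℝ, Complex.exp (Complex.I * n * y) * (G y * conj (F (2 ^ r * y))) = 0) :
    ∫ x, atom G (J + r) l x * conj (atom F J k x) = 0 := by
  have h1 : ∀ x, atom G (J + r) l x * conj (atom F J k x)
      = ((√2 : ℝ) : ℂ)⁻¹ ^ (J + r) * ((√2 : ℝ) : ℂ)⁻¹ ^ J *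
      (Complex.exp (Complex.I * (l - 2 ^ r * k : ℤ) * ((x / 2 ^ (J + r) : ℝ) : ℂ)) *
        (G (x / 2 ^ (J + r)) * conj (F (2 ^ r * (x / 2 ^ (J + r)))))) := by
    intro x
    have h3 : x / 2 ^ J = 2 ^ r * (x / 2 ^ (J + r)) := by rw [pow_add]; field_simp
    simp only [atom, map_mul, conj_inv_sqrt_two_pow, conj_exp_I_mul, h3]
    set z := x / 2 ^ (J + r)
    have h2 : Complex.exp (Complex.I * (l - 2 ^ r * k : ℤ) * (z : ℂ))
        = Complex.exp (Complex.I * l * (z : ℂ))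
          * Complex.exp (Complex.I * (-k : ℤ) * ((2 ^ r * z : ℝ) : ℂ)) := by
      rw [← Complex.exp_add]; congr 1; push_cast; ring
    rw [h2]
    ring
  simp_rw [h1]
  rw [integral_const_mul, Measure.integral_comp_div (fun y : ℝ =>
    Complex.exp (Complex.I * (l - 2 ^ r * k : ℤ) * (y : ℂ)) * (G y * conj (F (2 ^ r * y))))
    (2 ^ (J + r)), h, smul_zero, mul_zero]

/-! ### The spectral representation of the algorithm -/

section vectors

variable {h : ℝ → ℝ} {η : ℝ} {uhat : ℝ → ℂ}

/-- The profile of the spectral function representing `V_{J,k}`. -/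
def scalingProfile (h : ℝ → ℝ) (uhat : ℝ → ℂ) (J : ℕ) (y : ℝ) : ℂ :=
  (h (2 ^ J * wrap y) : ℂ) * scalingHat uhat y

/-- The profile of the spectral function representing `ε_{J,k}`. -/
def waveletProfile (uhat : ℝ → ℂ) (y : ℝ) : ℂ := ((√(2 * π))⁻¹ : ℝ) * waveletHat uhat y

/-- The spectral function `ĝ(x) e^{itx}` representing `V(t)`. -/
def harmonic (h : ℝ → ℝ) (t x : ℝ) : ℂ := (h x : ℂ) * Complex.exp (Complex.I * t * x)

lemma IsSpectralWeight.intervalIntegrable_sq_wrap (hh : IsSpectralWeight h η) (J : ℕ) :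
    IntervalIntegrable (fun y => ((h (2 ^ J * wrap y) : ℂ)) ^ 2) volume (-π) π := by
  have h1 : Integrable fun y => ((h (2 ^ J * y) ^ 2 : ℝ) : ℂ) :=
    (hh.integrable_sq.comp_mul_left' (by positivity)).ofReal
  refine (h1.intervalIntegrable (a := -π) (b := π)).congr ?_
  intro y hy
  rw [Set.uIoc_of_le neg_pi_lt_pi.le] at hy
  have h2 : (0 : ℝ) ≤ 2 ^ J := by positivity
  simp only
  -- The endpoint `π` wraps to `-π`; evenness of `h` absorbs this.
  rw [← hh.apply_mul_abs h2 (wrap y), abs_wrap_of_abs_le (abs_le.mpr ⟨hy.1.le, hy.2⟩),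
    hh.apply_mul_abs h2]
  push_cast; rfl

lemma IsSpectralWeight.intervalIntegrable_wrap (hh : IsSpectralWeight h η) (J : ℕ) :
    IntervalIntegrable (fun y => ((h (2 ^ J * wrap y) : ℂ))) volume (-π) π := by
  have h1 := hh.intervalIntegrable_sq_wrap J
  have h2 : IntervalIntegrable (fun _ => (1 : ℝ)) volume (-π) π := intervalIntegrable_const
  refine (h2.add h1.norm).mono_fun ?_ ?_
  · have := hh.measurable
    have := measurable_wrap
    exact Measurable.aestronglyMeasurable (by fun_prop)
  · refine ae_of_all _ fun y => ?_
    beta_reduce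
    rw [norm_pow, Real.norm_eq_abs]
    refine le_trans ?_ (le_abs_self _)
    nlinarith [sq_nonneg (‖((h (2 ^ J * wrap y) : ℂ))‖ - 1), norm_nonneg ((h (2 ^ J * wrap y) : ℂ))]

lemma periodic_wrap_comp {α : Type*} (f : ℝ → α) : Function.Periodic (fun y => f (wrap y)) (2 * π) :=
  fun y => by simp only [periodic_wrap y]

lemma measurable_scalingProfile (hh : IsSpectralWeight h η) (hu : IsMeyerFilter uhat) (J : ℕ) :
    Measurable (scalingProfile h uhat J) := by
  have h1 := hh.measurable
  have h2 := measurable_wrap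
  have h3 := measurable_scalingHat hu
  unfold scalingProfile
  fun_prop

lemma integrable_norm_sq_scalingProfile (hh : IsSpectralWeight h η) (hu : IsMeyerFilter uhat)
    (J : ℕ) : Integrable fun y => ‖scalingProfile h uhat J y‖ ^ 2 := by
  have hm := measurable_scalingHat hu
  have h1 := (integrable_periodic_mul (F := fun y => scalingHat uhat y ^ 2) (C := 1) (R := 4 * π)
    (periodic_wrap_comp fun y => ((h (2 ^ J * y) : ℂ)) ^ 2) (hh.intervalIntegrable_sq_wrap J)
    (by fun_prop) (fun y => ?_) fun y hy => by
      rw [scalingHat_eq_zero_of_lt hy, zero_pow two_ne_zero]).norm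
  · refine h1.congr (ae_of_all _ fun y => ?_)
    simp only [scalingProfile, norm_mul, norm_pow, mul_pow]
  · rw [norm_pow]
    exact pow_le_one₀ (norm_nonneg _) (norm_scalingHat_le_one hu y)

lemma measurable_waveletProfile (hu : IsMeyerFilter uhat) : Measurable (waveletProfile uhat) := by
  have h3 := measurable_waveletHat hu
  unfold waveletProfile
  fun_prop

lemma integrable_norm_sq_waveletProfile (hu : IsMeyerFilter uhat) :
    Integrable fun y => ‖waveletProfile uhat y‖ ^ 2 := by
  have hm := measurable_waveletHat hu
  have h1 := (integrable_periodic_mul (F := fun y => waveletHat uhat y ^ 2) (C := 2 ^ 2) (R := 4 * π)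
    (p := fun _ => ((√(2 * π))⁻¹ : ℝ) ^ 2) (fun _ => rfl) (by simp)
    (by fun_prop) (fun y => ?_) fun y hy => by
      rw [waveletHat_eq_zero_of_lt hy, zero_pow two_ne_zero]).norm
  · refine h1.congr (ae_of_all _ fun y => ?_)
    simp only [waveletProfile, norm_mul, norm_pow, mul_pow]
  · rw [norm_pow]
    exact pow_le_pow_left₀ (norm_nonneg _) (norm_waveletHat_le hu y) 2

lemma norm_exp_I_mul_real (t x : ℝ) : ‖Complex.exp (Complex.I * t * x)‖ = 1 := by
  rw [Complex.norm_exp]; simp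

lemma memLp_harmonic (hh : IsSpectralWeight h η) (t : ℝ) : MemLp (harmonic h t) 2 := by
  have hm := hh.measurable
  have hm' : Measurable (harmonic h t) := by unfold harmonic; fun_prop
  rw [memLp_two_iff_integrable_sq_norm hm'.aestronglyMeasurable]
  refine hh.integrable_sq.congr (ae_of_all _ fun x => ?_)
  simp only [harmonic, norm_mul, norm_exp_I_mul_real, mul_one, Complex.norm_real, Real.norm_eq_abs,
    sq_abs]

/-- The vector of `L²(ℝ)` representing `V_{J,k}`. -/
def scalingVec (hh : IsSpectralWeight h η) (hu : IsMeyerFilter uhat) (J : ℕ) (k : ℤ) :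
    Lp ℂ 2 (volume : Measure ℝ) :=
  (memLp_atom (measurable_scalingProfile hh hu J) (integrable_norm_sq_scalingProfile hh hu J)
    J k).toLp _

/-- The vector of `L²(ℝ)` representing `ε_{J,k}`. -/
def waveletVec (hu : IsMeyerFilter uhat) (J : ℕ) (k : ℤ) : Lp ℂ 2 (volume : Measure ℝ) :=
  (memLp_atom (measurable_waveletProfile hu) (integrable_norm_sq_waveletProfile hu) J k).toLp _

/-- The vector of `L²(ℝ)` representing `V(t)`. -/
def harmonicVec (hh : IsSpectralWeight h η) (t : ℝ) : Lp ℂ 2 (volume : Measure ℝ) :=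
  (memLp_harmonic hh t).toLp _

lemma scalingVec_ae_eq (hh : IsSpectralWeight h η) (hu : IsMeyerFilter uhat) (J : ℕ) (k : ℤ) :
    scalingVec hh hu J k =ᵐ[volume] atom (scalingProfile h uhat J) J k := MemLp.coeFn_toLp _

lemma waveletVec_ae_eq (hu : IsMeyerFilter uhat) (J : ℕ) (k : ℤ) :
    waveletVec hu J k =ᵐ[volume] atom (waveletProfile uhat) J k := MemLp.coeFn_toLp _

lemma harmonicVec_ae_eq (hh : IsSpectralWeight h η) (t : ℝ) :
    harmonicVec hh t =ᵐ[volume] harmonic h t := MemLp.coeFn_toLp _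

/-! ### Gram matrix of the scaling vectors, wavelets and harmonics. -/

lemma integral_re_eq_re_integral {a b : ℝ} (hab : a ≤ b) {f : ℝ → ℂ}
    (hf : IntervalIntegrable f volume a b) : (∫ x in a..b, f x).re = ∫ x in a..b, (f x).re := by
  rw [intervalIntegral.integral_of_le hab, intervalIntegral.integral_of_le hab]
  have := integral_re (𝕜 := ℂ) ((intervalIntegrable_iff_integrableOn_Ioc_of_le hab).mp hf)
  simpa using this.symm

lemma re_exp_I_mul (t x : ℝ) : (Complex.exp (Complex.I * t * x)).re = Real.cos (t * x) := by
  rw [show Complex.I * t * x = ((t * x : ℝ) : ℂ) * Complex.I by push_cast; ring,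
    Complex.exp_ofReal_mul_I_re]

lemma inner_scalingVec_zero (hh : IsSpectralWeight h η) (hu : IsMeyerFilter uhat) (k l : ℤ) :
    inner ℝ (scalingVec hh hu 0 k) (scalingVec hh hu 0 l)
      = ∫ x in (-π)..π, Real.cos (((k - l : ℤ) : ℝ) * x) * h (wrap x) ^ 2 := by
  have hsq := hh.intervalIntegrable_sq_wrap 0
  have hper : Function.Periodic (fun y : ℝ => ((h (2 ^ 0 * wrap y) : ℂ)) ^ 2
      * Complex.exp (Complex.I * (l - k : ℤ) * y)) (2 * π) :=
    (periodic_wrap_comp fun y => ((h (2 ^ 0 * y) : ℂ)) ^ 2).mul (periodic_exp_I_mul (l - k))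
  have hint : IntervalIntegrable (fun y : ℝ => ((h (2 ^ 0 * wrap y) : ℂ)) ^ 2
      * Complex.exp (Complex.I * (l - k : ℤ) * y)) volume (-π) π :=
    hsq.mul_continuousOn (by fun_prop)
  rw [scalingVec, scalingVec, inner_toLp_eq, integral_atom_mul_conj_atom]
  have h1 : ∀ y : ℝ, scalingProfile h uhat 0 y * conj (scalingProfile h uhat 0 y)
      * Complex.exp (Complex.I * (l - k : ℤ) * y)
      = (((h (2 ^ 0 * wrap y) : ℂ)) ^ 2 * Complex.exp (Complex.I * (l - k : ℤ) * y))
        * (scalingHat uhat y * conj (scalingHat uhat y)) := by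
    intro y
    simp only [scalingProfile, map_mul, Complex.conj_ofReal]
    ring
  simp_rw [h1]
  rw [integral_periodic_mul_scalingHat hu hper hint,
    integral_re_eq_re_integral neg_pi_lt_pi.le hint]
  refine intervalIntegral.integral_congr fun x _ => ?_
  have h2 := re_exp_I_mul ((l - k : ℤ) : ℝ) x
  rw [Complex.ofReal_intCast] at h2
  simp only [← Complex.ofReal_pow, Complex.re_ofReal_mul, h2, pow_zero, one_mul]
  rw [mul_comm, ← Real.cos_neg]
  congr 2
  push_cast; ring

lemma integral_exp_mul_waveletProfile_eq_zero (hu : IsMeyerFilter uhat) (n : ℤ) (r : ℕ) :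
    ∫ y : ℝ, Complex.exp (Complex.I * n * y)
      * (waveletProfile uhat y * conj (waveletProfile uhat (2 ^ (r + 1) * y))) = 0 := by
  obtain ⟨m, hm, hper, hmul⟩ := exists_waveletHat_two_pow_mul hu r
  have h1 : ∀ y : ℝ, Complex.exp (Complex.I * n * y)
      * (waveletProfile uhat y * conj (waveletProfile uhat (2 ^ (r + 1) * y)))
      = (Complex.exp (Complex.I * n * y) * (conj (m y) * (((√(2 * π))⁻¹ : ℝ) ^ 2)))
        * (waveletHat uhat y * conj (scalingHat uhat y)) := by
    intro y
    simp only [waveletProfile, hmul, map_mul, Complex.conj_ofReal]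
    ring
  simp_rw [h1]
  refine integral_periodic_mul_waveletHat_mul_scalingHat hu
    ((periodic_exp_I_mul n).mul fun y => by simp only [hper y]) ?_
  exact Continuous.intervalIntegrable (by fun_prop) _ _

/-- The factor `h(wrap(2^r y))` is again `2π`-periodic in `y`, so it joins the weight. Orthogonality
is unaffected by the size or the singularity of `h`, which only has to be integrable over a period.
-/
lemma integral_exp_mul_scalingProfile_eq_zero (hh : IsSpectralWeight h η) (hu : IsMeyerFilter uhat)
    (n : ℤ) (r : ℕ) :
    ∫ y : ℝ, Complex.exp (Complex.I * n * y)
      * (waveletProfile uhat y * conj (scalingProfile h uhat 0 (2 ^ r * y))) = 0 := by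
  obtain ⟨m, hm, hper, hmul⟩ := exists_scalingHat_two_pow_mul hu r
  have hper2 : Function.Periodic (fun y : ℝ => ((h (2 ^ 0 * wrap (2 ^ r * y)) : ℝ) : ℂ)) (2 * π) :=
    periodic_comp_two_pow_mul (periodic_wrap_comp fun y => ((h (2 ^ 0 * y) : ℝ) : ℂ)) r
  have hint2 : IntervalIntegrable (fun y : ℝ => ((h (2 ^ 0 * wrap (2 ^ r * y)) : ℝ) : ℂ))
      volume (-π) π := by
    have := (IntervalIntegrable.of_periodic (periodic_wrap_comp fun y => ((h (2 ^ 0 * y) : ℝ) : ℂ))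
      (hh.intervalIntegrable_wrap 0) (2 ^ r * -π) (2 ^ r * π)).comp_mul_left (c := 2 ^ r)
    rwa [mul_div_cancel_left₀ _ (by positivity), mul_div_cancel_left₀ _ (by positivity)] at this
  have h1 : ∀ y : ℝ, Complex.exp (Complex.I * n * y)
      * (waveletProfile uhat y * conj (scalingProfile h uhat 0 (2 ^ r * y)))
      = (((h (2 ^ 0 * wrap (2 ^ r * y)) : ℝ) : ℂ) *
          (Complex.exp (Complex.I * n * y) * (conj (m y) * ((√(2 * π))⁻¹ : ℝ))))
        * (waveletHat uhat y * conj (scalingHat uhat y)) := by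
    intro y
    simp only [waveletProfile, scalingProfile, hmul, map_mul, Complex.conj_ofReal]
    ring
  simp_rw [h1]
  refine integral_periodic_mul_waveletHat_mul_scalingHat hu
    (hper2.mul ((periodic_exp_I_mul n).mul fun y => by simp only [hper y])) ?_
  exact hint2.mul_continuousOn (by fun_prop)

lemma inner_scalingVec_waveletVec (hh : IsSpectralWeight h η) (hu : IsMeyerFilter uhat) (k l : ℤ)
    (j : ℕ) : inner ℝ (scalingVec hh hu 0 k) (waveletVec hu j l) = 0 := by
  rw [scalingVec, waveletVec, inner_toLp_eq]
  have := integral_atom_mul_conj_atom_eq_zero (F := scalingProfile h uhat 0)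
    (G := waveletProfile uhat) 0 j k l (integral_exp_mul_scalingProfile_eq_zero hh hu · j)
  rw [zero_add] at this
  rw [this, Complex.zero_re]

lemma integral_exp_I_mul (n : ℤ) :
    ∫ x in (-π)..π, Complex.exp (Complex.I * n * x) = if n = 0 then (2 * π : ℂ) else 0 := by
  split_ifs with hn
  · subst hn; simp; ring
  · have hc : Complex.I * n ≠ 0 := mul_ne_zero Complex.I_ne_zero (by exact_mod_cast hn)
    rw [integral_exp_mul_complex hc]
    have := periodic_exp_I_mul n (-π)
    simp only [show -π + 2 * π = π by ring] at this
    rw [this, sub_self, zero_div]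

lemma inner_waveletVec_same (hu : IsMeyerFilter uhat) (j : ℕ) (k l : ℤ) :
    inner ℝ (waveletVec hu j k) (waveletVec hu j l) = if k = l then 1 else 0 := by
  have hpi := Real.pi_pos
  rw [waveletVec, waveletVec, inner_toLp_eq, integral_atom_mul_conj_atom]
  have h1 : ∀ y : ℝ, waveletProfile uhat y * conj (waveletProfile uhat y)
      * Complex.exp (Complex.I * (l - k : ℤ) * y)
      = (Complex.exp (Complex.I * (l - k : ℤ) * y) * ((2 * π)⁻¹ : ℝ))
        * (waveletHat uhat y * conj (waveletHat uhat y)) := by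
    intro y
    have h2 : ((2 * π)⁻¹ : ℝ) = (√(2 * π))⁻¹ * (√(2 * π))⁻¹ := by
      rw [← mul_inv, Real.mul_self_sqrt (by positivity)]
    rw [h2]
    simp only [waveletProfile, map_mul, Complex.conj_ofReal]
    push_cast
    ring
  simp_rw [h1]
  rw [integral_periodic_mul_waveletHat hu (fun y => by
      have := periodic_exp_I_mul (l - k) y
      simp only at this ⊢
      rw [this]) (Continuous.intervalIntegrable (by fun_prop) _ _),
    intervalIntegral.integral_mul_const, integral_exp_I_mul]
  have h3 : (l - k = 0) ↔ k = l := by omega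
  simp only [h3]
  split_ifs
  · push_cast
    rw [mul_inv_cancel₀ (mul_ne_zero two_ne_zero (by exact_mod_cast hpi.ne')), Complex.one_re]
  · simp

lemma inner_waveletVec_of_lt (hu : IsMeyerFilter uhat) {j j' : ℕ} (hj : j < j') (k l : ℤ) :
    inner ℝ (waveletVec hu j k) (waveletVec hu j' l) = 0 := by
  obtain ⟨r, rfl⟩ := Nat.exists_eq_add_of_lt hj
  rw [waveletVec, waveletVec, inner_toLp_eq]
  have := integral_atom_mul_conj_atom_eq_zero (F := waveletProfile uhat)
    (G := waveletProfile uhat) j (r + 1) k l (integral_exp_mul_waveletProfile_eq_zero hu · r)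
  rw [← add_assoc] at this
  rw [this, Complex.zero_re]

lemma inner_waveletVec (hu : IsMeyerFilter uhat) (i i' : ℕ × ℤ) :
    inner ℝ (waveletVec hu i.1 i.2) (waveletVec hu i'.1 i'.2) = if i = i' then 1 else 0 := by
  obtain ⟨j, k⟩ := i
  obtain ⟨j', l⟩ := i'
  rcases lt_trichotomy j j' with hj | hj | hj
  · rw [inner_waveletVec_of_lt hu hj, if_neg (by simp [hj.ne])]
  · subst hj
    rw [inner_waveletVec_same]; simp
  · rw [real_inner_comm, inner_waveletVec_of_lt hu hj, if_neg (by simp [hj.ne'])]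

lemma inner_harmonicVec (hh : IsSpectralWeight h η) (s t : ℝ) :
    inner ℝ (harmonicVec hh s) (harmonicVec hh t)
      = ∫ x : ℝ, Real.cos ((s - t) * x) * h x ^ 2 := by
  rw [L2.inner_def]
  refine integral_congr_ae ?_
  filter_upwards [harmonicVec_ae_eq hh s, harmonicVec_ae_eq hh t] with x hx hy
  rw [hx, hy, Complex.inner, harmonic, harmonic, map_mul, Complex.conj_ofReal, ← Complex.exp_conj]
  have h1 : (h x : ℂ) * Complex.exp (Complex.I * t * x) *
      ((h x : ℂ) * Complex.exp (conj (Complex.I * s * x)))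
      = ((h x ^ 2 : ℝ) : ℂ) * Complex.exp (Complex.I * ((t - s : ℝ) : ℂ) * x) := by
    have : Complex.exp (Complex.I * ((t - s : ℝ) : ℂ) * x)
        = Complex.exp (Complex.I * t * x) * Complex.exp (conj (Complex.I * s * x)) := by
      rw [← Complex.exp_add]; congr 1
      simp only [map_mul, Complex.conj_I, Complex.conj_ofReal]; push_cast; ring
    rw [this]; push_cast; ring
  rw [h1, Complex.re_ofReal_mul, re_exp_I_mul, mul_comm, ← Real.cos_neg]
  congr 2; ring

end vectors

/-! ### The refinement recursion in `L²(ℝ)` -/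

/-- Upsampling by the factor 2 in an arbitrary additive group. -/
def upsampleVec {V : Type*} [Zero V] (a : ℤ → V) (k : ℤ) : V := if Even k then a (k / 2) else 0

lemma norm_upsampleVec_le {V : Type*} [NormedAddCommGroup V] {a : ℤ → V} {C : ℝ}
    (hC : ∀ k, ‖a k‖ ≤ C) (k : ℤ) : ‖upsampleVec a k‖ ≤ C := by
  rw [upsampleVec]
  split_ifs
  · exact hC _
  · rw [norm_zero]; exact (norm_nonneg _).trans (hC 0)

lemma summable_smul_of_bounded {V : Type*} [NormedAddCommGroup V] [NormedSpace ℝ V]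
    [CompleteSpace V] {f : ℤ → ℝ} (hf : Summable fun n => |f n|) {a : ℤ → V} {C : ℝ}
    (hC : ∀ k, ‖a k‖ ≤ C) (k : ℤ) : Summable fun n => f n • a (k - n) := by
  refine Summable.of_norm_bounded (hf.mul_right C) fun n => ?_
  rw [norm_smul, Real.norm_eq_abs]
  gcongr
  exact hC _

lemma neg_one_zpow_mul_exp (k n : ℤ) (y : ℝ) :
    (-1 : ℂ) ^ k * Complex.exp (-(Complex.I * n * ((y + π : ℝ) : ℂ)))
      = (-1 : ℂ) ^ (k - n) * Complex.exp (-(Complex.I * n * y)) := by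
  have h1 : Complex.exp (-(Complex.I * n * ((y + π : ℝ) : ℂ)))
      = Complex.exp (-(Complex.I * n * y)) * (-1 : ℂ) ^ (-n) := by
    rw [← Complex.exp_pi_mul_I, ← Complex.exp_int_mul, ← Complex.exp_add]
    congr 1; push_cast; ring
  rw [h1, sub_eq_add_neg, zpow_add₀ (by norm_num)]
  ring

/-- The even indices are selected by `(1 + (-1)^{k-n})/2`, and the factor `(-1)^n` amounts to a
translation of the frequency by `π`. Upsampling therefore produces the values of the filter at both
`y` and `y + π`. -/
lemma hasSum_upsample_atom {F fhat : ℝ → ℂ} {f : ℤ → ℝ} {y : ℝ}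
    (h1 : HasSum (fun n : ℤ => (f n : ℂ) * Complex.exp (-(Complex.I * n * y))) (fhat y))
    (h2 : HasSum (fun n : ℤ => (f n : ℂ) * Complex.exp (-(Complex.I * n * ((y + π : ℝ) : ℂ))))
      (fhat (y + π))) (J : ℕ) (k : ℤ) :
    HasSum (fun n : ℤ => (f n : ℂ) * upsampleVec (fun m => atom F J m (2 ^ (J + 1) * y)) (k - n))
      (((√2 : ℝ) : ℂ)⁻¹ ^ J * F (2 * y) * Complex.exp (Complex.I * k * y) / 2
        * (fhat y + (-1) ^ k * fhat (y + π))) := by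
  have h3 := (h1.add (h2.mul_left ((-1) ^ k))).mul_left
    (((√2 : ℝ) : ℂ)⁻¹ ^ J * F (2 * y) * Complex.exp (Complex.I * k * y) / 2)
  refine h3.congr_fun fun n => ?_
  rw [mul_left_comm ((-1 : ℂ) ^ k), neg_one_zpow_mul_exp]
  have hy : (2 : ℝ) ^ (J + 1) * y / 2 ^ J = 2 * y := by rw [pow_succ]; field_simp
  rw [upsampleVec]
  split_ifs with he
  · obtain ⟨m, hm⟩ := he
    have hm2 : (k - n) / 2 = m := by omega
    have hk : k = n + 2 * m := by omega
    rw [hm2, atom, hy, (show Even (k - n) from ⟨m, hm⟩).neg_one_zpow, hk]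
    have : Complex.exp (Complex.I * m * ((2 * y : ℝ) : ℂ))
        = Complex.exp (Complex.I * (n + 2 * m : ℤ) * y) * Complex.exp (-(Complex.I * n * y)) := by
      rw [← Complex.exp_add]; congr 1; push_cast; ring
    rw [this]
    ring
  · rw [(Int.not_even_iff_odd.mp he).neg_one_zpow]
    ring

section recursion

variable {uhat : ℝ → ℂ} {η : ℝ}

lemma norm_scalingVec_le {h : ℝ → ℝ} (hh : IsSpectralWeight h η) (hu : IsMeyerFilter uhat) (J : ℕ) :
    ∃ C, ∀ k, ‖scalingVec hh hu J k‖ ≤ C := by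
  refine ⟨‖scalingVec hh hu J 0‖, fun k => le_of_eq ?_⟩
  refine (sq_eq_sq₀ (norm_nonneg _) (norm_nonneg _)).mp ?_
  rw [Lp_norm_sq_eq (scalingVec_ae_eq hh hu J k), Lp_norm_sq_eq (scalingVec_ae_eq hh hu J 0)]
  simp only [atom, norm_mul, norm_exp_I_mul]

lemma norm_waveletVec (hu : IsMeyerFilter uhat) (J : ℕ) (k : ℤ) : ‖waveletVec hu J k‖ = 1 := by
  have h := inner_waveletVec_same hu J k k
  rw [real_inner_self_eq_norm_sq, if_pos rfl] at h
  nlinarith [norm_nonneg (waveletVec hu J k)]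

lemma ae_upsampleVec_eq {α E : Type*} [MeasurableSpace α] {μ : Measure α} [NormedAddCommGroup E]
    {V : ℤ → Lp E 2 μ} {g : ℤ → α → E} (hV : ∀ m, V m =ᵐ[μ] g m) :
    ∀ᵐ x ∂μ, ∀ k, (upsampleVec V k) x = upsampleVec (fun m => g m x) k := by
  rw [ae_all_iff]
  intro k
  simp only [upsampleVec]
  split_ifs
  · exact hV _
  · filter_upwards [Lp.coeFn_zero E 2 μ] with x hx
    rw [hx]; rfl

lemma tsum_upsample_ae_eq {F fhat : ℝ → ℂ} {f : ℤ → ℝ} (J : ℕ)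
    {V : ℤ → Lp ℂ 2 (volume : Measure ℝ)} {C : ℝ} (hC : ∀ m, ‖V m‖ ≤ C)
    (hV : ∀ m, V m =ᵐ[volume] atom F J m) (hf : Summable fun n => |f n|)
    (hser : ∀ᵐ y : ℝ, HasSum (fun n : ℤ => (f n : ℂ) * Complex.exp (-(Complex.I * n * y))) (fhat y))
    (k : ℤ) :
    (∑' n : ℤ, f n • upsampleVec V (k - n) : Lp ℂ 2 (volume : Measure ℝ)) =ᵐ[volume] fun x =>
      ((√2 : ℝ) : ℂ)⁻¹ ^ J * F (2 * (x / 2 ^ (J + 1)))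
        * Complex.exp (Complex.I * k * ((x / 2 ^ (J + 1) : ℝ) : ℂ)) / 2
        * (fhat (x / 2 ^ (J + 1)) + (-1) ^ k * fhat (x / 2 ^ (J + 1) + π)) := by
  have hs := summable_smul_of_bounded hf (norm_upsampleVec_le hC) k
  refine Lp_tsum_ae_eq hs.hasSum ?_
  have h2 : (2 : ℝ) ^ (J + 1) ≠ 0 := by positivity
  have hsm : ∀ᵐ x, ∀ n : ℤ, (f n • upsampleVec V (k - n) : Lp ℂ 2 (volume : Measure ℝ)) x
      = f n • (upsampleVec V (k - n)) x := by
    rw [ae_all_iff]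
    intro n
    filter_upwards [Lp.coeFn_smul (f n) (upsampleVec V (k - n))] with x hx
    rw [hx]; rfl
  filter_upwards [ae_comp_affine hser h2 0, ae_comp_affine hser h2 π, ae_upsampleVec_eq hV, hsm]
    with x hx1 hx2 hx3 hx4
  rw [add_zero] at hx1
  have h3 := hasSum_upsample_atom (F := F) hx1 hx2 J k
  rw [mul_div_cancel₀ x h2] at h3
  refine h3.congr_fun fun n => ?_
  rw [hx4, hx3, Complex.real_smul]

lemma lowFilterHat_mul (M : VelocityModel) (hh : IsSpectralWeight (spectralFilter M) η) {j : ℕ}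
    {y : ℝ} (hy : wrap (2 * y) ≠ 0) :
    lowFilterHat M uhat j y * (spectralFilter M (2 ^ j * wrap (2 * y)) : ℂ)
      = (spectralFilter M (2 ^ (j + 1) * wrap y) : ℂ) * uhat y := by
  have hs : √(2 * π) ≠ 0 := (Real.sqrt_pos.mpr Real.two_pi_pos).ne'
  have hne : spectralFilter M (2 ^ j * wrap (2 * y)) ≠ 0 :=
    (hh.pos _ (mul_ne_zero (by positivity) hy)).ne'
  rw [lowFilterHat, discreteFilter_eq, discreteFilter_eq, mul_div_mul_left _ _ hs, mul_right_comm,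
    ← Complex.ofReal_mul, div_mul_cancel₀ _ hne]

lemma highFilterHat_mul (M : VelocityModel) (j : ℕ) (y : ℝ) :
    highFilterHat M uhat j y * ((√(2 * π))⁻¹ : ℝ)
      = (spectralFilter M (2 ^ (j + 1) * wrap y) : ℂ) * highPass uhat y := by
  have hs : √(2 * π) ≠ 0 := (Real.sqrt_pos.mpr Real.two_pi_pos).ne'
  rw [highFilterHat, discreteFilter_eq, mul_right_comm, ← Complex.ofReal_mul]
  congr 2
  field_simp

/-- Cancellation of the aliased components of the two branches. -/
lemma highPass_add_pi (hu : IsMeyerFilter uhat) (y : ℝ) :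
    uhat (y + π) * conj (uhat y) + highPass uhat (y + π) * conj (highPass uhat y) = 0 := by
  simp only [highPass, map_mul, Complex.conj_conj, ← Complex.exp_conj, map_neg, Complex.conj_I,
    Complex.conj_ofReal]
  rw [show y + π + π = y + 2 * π by ring, hu.periodic]
  have : Complex.exp (-(Complex.I * ((y + π : ℝ) : ℂ))) * Complex.exp (-(-Complex.I * (y : ℂ)))
      = -1 := by
    rw [← Complex.exp_add, show -(Complex.I * ((y + π : ℝ) : ℂ)) + -(-Complex.I * (y : ℂ))
      = -(π * Complex.I) by push_cast; ring, Complex.exp_neg, Complex.exp_pi_mul_I]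
    norm_num
  linear_combination (uhat (y + π) * conj (uhat y)) * this

lemma uhat_mul_conj_add (hu : IsMeyerFilter uhat) (y : ℝ) :
    uhat y * conj (uhat y) + highPass uhat y * conj (highPass uhat y) = 2 := by
  rw [Complex.mul_conj', Complex.mul_conj', IsMeyerFilter.norm_highPass]
  exact_mod_cast hu.mirror y

/-- The vectors representing the discretizations satisfy the recursion of the algorithm. -/
lemma scalingVec_succ (M : VelocityModel) (hh : IsSpectralWeight (spectralFilter M) η)
    (hu : IsMeyerFilter uhat) (J : ℕ) (k : ℤ) :
    scalingVec hh hu (J + 1) k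
      = ∑' n : ℤ, timeFilter (lowFilterHat M uhat J) n • upsampleVec (scalingVec hh hu J) (k - n)
      + ∑' n : ℤ, timeFilter (highFilterHat M uhat J) n • upsampleVec (waveletVec hu J) (k - n) := by
  obtain ⟨C, hC⟩ := norm_scalingVec_le hh hu J
  obtain ⟨hs1, hser1⟩ := lowFilter_series M hu J
  obtain ⟨hs2, hser2⟩ := highFilter_series M hu J
  have h1 := tsum_upsample_ae_eq J hC (scalingVec_ae_eq hh hu J) hs1 hser1 k
  have h2 := tsum_upsample_ae_eq J (fun m => (norm_waveletVec hu J m).le) (waveletVec_ae_eq hu J)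
    hs2 hser2 k
  apply Lp.ext
  refine (scalingVec_ae_eq hh hu (J + 1) k).trans ?_
  refine Filter.EventuallyEq.symm ((Lp.coeFn_add _ _).trans ?_)
  have h2J : (2 : ℝ) ^ (J + 1) ≠ 0 := by positivity
  filter_upwards [h1, h2, ae_comp_affine (ae_wrap_mul_ne_zero two_ne_zero) h2J 0] with x hx1 hx2 hx3
  rw [Pi.add_apply, hx1, hx2, atom]
  rw [add_zero] at hx3
  set y := x / 2 ^ (J + 1)
  have hw : wrap (2 * (y + π)) = wrap (2 * y) := by
    rw [show 2 * (y + π) = 2 * y + 2 * π by ring, periodic_wrap]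
  have e1 := lowFilterHat_mul (uhat := uhat) M hh (j := J) hx3
  have e2 := lowFilterHat_mul (uhat := uhat) M hh (j := J) (y := y + π) (by rwa [hw])
  rw [hw] at e2
  have e3 := highFilterHat_mul (uhat := uhat) M J y
  have e4 := highFilterHat_mul (uhat := uhat) M J (y + π)
  have e5 := uhat_mul_conj_add hu y
  have e6 := highPass_add_pi hu y
  simp only [scalingProfile, waveletProfile, scalingHat_two_mul hu, waveletHat_two_mul]
  rw [pow_succ]
  set c := ((√2 : ℝ) : ℂ)⁻¹ ^ J
  set E := Complex.exp (Complex.I * k * y)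
  set Φ := scalingHat uhat y
  rw [div_eq_mul_inv (_ * Φ), div_eq_mul_inv (_ * Φ)]
  set s := ((√2 : ℝ) : ℂ)⁻¹
  -- By `e1`–`e4` each filter times the coarse profile becomes `h(2^{J+1} wrap ·)` times `û` or
  -- `v̂`. The contributions at `y` add up through `e5` to `2 h`, compensating the `1/2` of
  -- upsampling, and those at `y + π` vanish by `e6`.
  linear_combination (c * E * Φ * s * conj (uhat y) / 2) * (e1 + (-1) ^ k * e2)
    + (c * E * Φ * s * conj (highPass uhat y) / 2) * (e3 + (-1) ^ k * e4)
    + (c * E * Φ * s / 2) * ((spectralFilter M (2 ^ (J + 1) * wrap y) : ℂ) * e5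
      + (-1) ^ k * (spectralFilter M (2 ^ (J + 1) * wrap (y + π)) : ℂ) * e6)

end recursion

/-! ### Rates in `L²(ℝ)` -/

section rates

variable {h : ℝ → ℝ} {uhat : ℝ → ℂ} {η : ℝ}

/-- Interpolation between the bounds `|θ|` and `2`; it lets a moment of fractional order control
increments of the harmonics. -/
lemma norm_exp_I_mul_sub_one_le {η : ℝ} (h0 : 0 < η) (h1 : η < 1) (θ : ℝ) :
    ‖Complex.exp (Complex.I * θ) - 1‖ ^ 2 ≤ 4 * |θ| ^ (2 * η) := by
  have hsq : |θ| ^ (2 * η) = (|θ| ^ η) ^ 2 := by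
    rw [mul_comm, Real.rpow_mul (abs_nonneg _)]; norm_num
  have key : ‖Complex.exp (Complex.I * θ) - 1‖ ≤ 2 * |θ| ^ η := by
    rcases le_or_gt |θ| 1 with hθ | hθ
    · have h2 := Real.norm_exp_I_mul_ofReal_sub_one_le (x := θ)
      rw [Real.norm_eq_abs] at h2
      have h3 : |θ| ≤ |θ| ^ η := by
        rcases (abs_nonneg θ).eq_or_lt with h4 | h4
        · rw [← h4]; positivity
        · simpa using Real.rpow_le_rpow_of_exponent_ge h4 hθ h1.le
      have : 0 ≤ |θ| ^ η := by positivity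
      linarith
    · have h2 : ‖Complex.exp (Complex.I * θ) - 1‖ ≤ 2 := by
        refine (norm_sub_le _ _).trans ?_
        rw [Complex.norm_exp]; simp; norm_num
      have h3 : 1 ≤ |θ| ^ η := Real.one_le_rpow hθ.le h0.le
      linarith
  calc _ ≤ (2 * |θ| ^ η) ^ 2 := by gcongr
    _ = _ := by rw [hsq]; ring

lemma norm_harmonicVec_sub_sq_le (hh : IsSpectralWeight h η) (s t : ℝ) :
    ‖harmonicVec hh s - harmonicVec hh t‖ ^ 2
      ≤ 4 * (∫ x, |x| ^ (2 * η) * h x ^ 2) * |s - t| ^ (2 * η) := by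
  have hae : (harmonicVec hh s - harmonicVec hh t : Lp ℂ 2 (volume : Measure ℝ)) =ᵐ[volume]
      fun x => harmonic h s x - harmonic h t x := by
    filter_upwards [Lp.coeFn_sub (harmonicVec hh s) (harmonicVec hh t), harmonicVec_ae_eq hh s,
      harmonicVec_ae_eq hh t] with x h1 h2 h3
    rw [h1, Pi.sub_apply, h2, h3]
  rw [Lp_norm_sq_eq hae]
  calc ∫ x, ‖harmonic h s x - harmonic h t x‖ ^ 2
      ≤ ∫ x, (4 * |s - t| ^ (2 * η)) * (|x| ^ (2 * η) * h x ^ 2) := by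
        refine integral_mono_of_nonneg (ae_of_all _ fun x => by positivity)
          (hh.integrable_moment.const_mul _) (ae_of_all _ fun x => ?_)
        have e1 : harmonic h s x - harmonic h t x = (h x : ℂ) * Complex.exp (Complex.I * t * x)
            * (Complex.exp (Complex.I * (((s - t) * x : ℝ) : ℂ)) - 1) := by
          have : Complex.exp (Complex.I * s * x) = Complex.exp (Complex.I * t * x)
              * Complex.exp (Complex.I * (((s - t) * x : ℝ) : ℂ)) := by
            rw [← Complex.exp_add]; congr 1; push_cast; ring
          rw [harmonic, harmonic, this]; ring
        have e2 := norm_exp_I_mul_sub_one_le hh.exponent_pos hh.exponent_lt_one ((s - t) * x)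
        rw [abs_mul, Real.mul_rpow (abs_nonneg _) (abs_nonneg _)] at e2
        beta_reduce
        rw [e1, norm_mul, norm_mul, norm_exp_I_mul_real, mul_one, Complex.norm_real, mul_pow,
          Real.norm_eq_abs, sq_abs]
        calc _ ≤ h x ^ 2 * (4 * (|s - t| ^ (2 * η) * |x| ^ (2 * η))) := by gcongr
          _ = _ := by ring
    _ = _ := by rw [integral_const_mul]; ring

/-- By a Chebyshev argument `κ` dominates `h²` for `|x| ≥ 2^J · 2π/3`. With `y = x/2^J`, the
difference is `0` for `|y| ≤ 2π/3`. Up to `|y| = π` the wrapping is harmless. Between `π` and `4π/3`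
it moves `y` by `2π`, to a point whose modulus still exceeds `2π/3`, which explains the two
translates of `κ`. Beyond `4π/3` only `h` itself remains. -/
lemma norm_sq_profile_sub_le (hh : IsSpectralWeight h η) (hu : IsMeyerFilter uhat) (J : ℕ)
    {κ : ℝ → ℝ} (hκ : κ = fun x => (2 ^ J * (2 * π / 3)) ^ (-(2 * η)) * (|x| ^ (2 * η) * h x ^ 2))
    (x : ℝ) :
    ‖scalingProfile h uhat J (x / 2 ^ J) - (h x : ℂ)‖ ^ 2
      ≤ 2 * (κ x + κ (x - 2 ^ J * (2 * π)) + κ (x + 2 ^ J * (2 * π))) + 2 * κ x := by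
  have hpi := Real.pi_pos
  set P : ℝ := 2 ^ J with hP
  have hP0 : 0 < P := by positivity
  have hR : 0 < P * (2 * π / 3) := by positivity
  have hκ0 : ∀ z, 0 ≤ κ z := fun z => by rw [hκ]; positivity
  have hκh : ∀ z, 2 * π / 3 ≤ |z / P| → h z ^ 2 ≤ κ z := by
    intro z hz
    rw [abs_div, abs_of_pos hP0, le_div_iff₀ hP0] at hz
    have h1 : 1 ≤ (P * (2 * π / 3)) ^ (-(2 * η)) * |z| ^ (2 * η) := by
      rw [Real.rpow_neg hR.le, inv_mul_eq_div, one_le_div (by positivity)]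
      exact Real.rpow_le_rpow hR.le (by linarith) (by linarith [hh.exponent_pos])
    rw [hκ]
    simp only
    rw [← mul_assoc]
    nlinarith [sq_nonneg (h z)]
  have hPy : P * (x / P) = x := mul_div_cancel₀ x hP0.ne'
  rcases le_or_gt |x / P| (2 * π / 3) with hx | hx
  · have h1 : scalingProfile h uhat J (x / P) = (h x : ℂ) := by
      rw [scalingProfile, scalingHat_eq_one hu hx, mul_one, wrap_of_mem, hPy]
      rw [abs_le] at hx
      exact ⟨by linarith, by linarith⟩
    rw [h1, sub_self, norm_zero, zero_pow two_ne_zero]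
    linarith [hκ0 x, hκ0 (x - P * (2 * π)), hκ0 (x + P * (2 * π))]
  · have hxκ := hκh x hx.le
    have hmain : ‖scalingProfile h uhat J (x / P)‖ ^ 2
        ≤ κ x + κ (x - P * (2 * π)) + κ (x + P * (2 * π)) := by
      have a1 := hκ0 x
      have a2 := hκ0 (x - P * (2 * π))
      have a3 := hκ0 (x + P * (2 * π))
      rcases le_or_gt (4 * π / 3) |x / P| with h4 | h4
      · rw [scalingProfile, scalingHat_eq_zero hu h4, mul_zero, norm_zero, zero_pow two_ne_zero]
        linarith
      have hle : ‖scalingProfile h uhat J (x / P)‖ ^ 2 ≤ h (P * wrap (x / P)) ^ 2 := by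
        rw [scalingProfile, norm_mul, Complex.norm_real, Real.norm_eq_abs, mul_pow, sq_abs]
        have := norm_scalingHat_le_one hu (x / P)
        have h5 : ‖scalingHat uhat (x / P)‖ ^ 2 ≤ 1 := pow_le_one₀ (norm_nonneg _) this
        nlinarith [sq_nonneg (h (P * wrap (x / P)))]
      refine hle.trans ?_
      rcases le_or_gt |x / P| π with h5 | h5
      · rw [← hh.apply_mul_abs hP0.le, abs_wrap_of_abs_le h5, hh.apply_mul_abs hP0.le, hPy]
        linarith
      · rcases le_total 0 (x / P) with h6 | h6
        · rw [abs_of_nonneg h6] at h4 h5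
          have hz : (x - P * (2 * π)) / P = x / P - 2 * π := by field_simp
          rw [← periodic_wrap.sub_eq, wrap_of_mem ⟨by linarith, by linarith⟩, mul_sub, hPy]
          have := hκh (x - P * (2 * π)) (by
            rw [hz, abs_of_nonpos (by linarith)]; linarith)
          linarith
        · rw [abs_of_nonpos h6] at h4 h5
          have hz : (x + P * (2 * π)) / P = x / P + 2 * π := by field_simp
          rw [← periodic_wrap, wrap_of_mem ⟨by linarith, by linarith⟩, mul_add, hPy]
          have := hκh (x + P * (2 * π)) (by
            rw [hz, abs_of_nonneg (by linarith)]; linarith)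
          linarith
    have htri : ‖scalingProfile h uhat J (x / P) - (h x : ℂ)‖ ^ 2
        ≤ 2 * ‖scalingProfile h uhat J (x / P)‖ ^ 2 + 2 * h x ^ 2 := by
      have h7 := norm_sub_le (scalingProfile h uhat J (x / P)) (h x : ℂ)
      rw [Complex.norm_real, Real.norm_eq_abs] at h7
      have h8 : ‖scalingProfile h uhat J (x / P) - (h x : ℂ)‖ ^ 2
          ≤ (‖scalingProfile h uhat J (x / P)‖ + |h x|) ^ 2 := by gcongr
      rw [← sq_abs (h x)]
      nlinarith [sq_nonneg (‖scalingProfile h uhat J (x / P)‖ - |h x|)]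
    linarith

lemma norm_scalingVec_sub_sq_le (hh : IsSpectralWeight h η) (hu : IsMeyerFilter uhat) (J : ℕ)
    (k : ℤ) :
    ‖(√2 ^ J) • scalingVec hh hu J k - harmonicVec hh (k / 2 ^ J)‖ ^ 2
      ≤ 8 * ((2 ^ J * (2 * π / 3)) ^ (-(2 * η)) * ∫ x, |x| ^ (2 * η) * h x ^ 2) := by
  set κ : ℝ → ℝ := fun x => (2 ^ J * (2 * π / 3)) ^ (-(2 * η)) * (|x| ^ (2 * η) * h x ^ 2) with hκ
  have hint : Integrable κ := hh.integrable_moment.const_mul _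
  have hs2 : ((√2 : ℝ) : ℂ) ^ J ≠ 0 := pow_ne_zero _ ofReal_sqrt_two_ne_zero
  have hae : ((√2 ^ J) • scalingVec hh hu J k - harmonicVec hh (k / 2 ^ J) :
      Lp ℂ 2 (volume : Measure ℝ)) =ᵐ[volume] fun x =>
      (scalingProfile h uhat J (x / 2 ^ J) - (h x : ℂ))
        * Complex.exp (Complex.I * k * ((x / 2 ^ J : ℝ) : ℂ)) := by
    filter_upwards [Lp.coeFn_sub ((√2 ^ J) • scalingVec hh hu J k) (harmonicVec hh (k / 2 ^ J)),
      Lp.coeFn_smul (√2 ^ J) (scalingVec hh hu J k), scalingVec_ae_eq hh hu J k,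
      harmonicVec_ae_eq hh (k / 2 ^ J)] with x h1 h2 h3 h4
    rw [h1, Pi.sub_apply, h2, Pi.smul_apply, h3, h4, atom, harmonic, Complex.real_smul]
    push_cast
    rw [show Complex.I * ((k : ℂ) / 2 ^ J) * x = Complex.I * k * (x / 2 ^ J) by ring, inv_pow]
    field_simp
  rw [Lp_norm_sq_eq hae]
  calc _ ≤ ∫ x, (2 * (κ x + κ (x - 2 ^ J * (2 * π)) + κ (x + 2 ^ J * (2 * π))) + 2 * κ x) := by
        refine integral_mono_of_nonneg (ae_of_all _ fun x => by positivity) ?_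
          (ae_of_all _ fun x => ?_)
        · exact (((hint.add (hint.comp_sub_right _)).add (hint.comp_add_right _)).const_mul 2).add
            (hint.const_mul 2)
        · beta_reduce
          rw [norm_mul, norm_exp_I_mul, mul_one]
          exact norm_sq_profile_sub_le hh hu J hκ x
    -- Translates have the same integral, hence `8 = 2 · 3 + 2`.
    _ = 8 * ∫ x, κ x := by
        have i1 := hint.comp_sub_right (2 ^ J * (2 * π))
        have i2 := hint.comp_add_right (2 ^ J * (2 * π))
        have i3 : Integrable fun x => κ x + κ (x - 2 ^ J * (2 * π)) := hint.add i1
        have i4 : Integrable fun x => κ x + κ (x - 2 ^ J * (2 * π)) + κ (x + 2 ^ J * (2 * π)) :=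
          i3.add i2
        rw [integral_add (i4.const_mul 2) (hint.const_mul 2), integral_const_mul,
          integral_const_mul, integral_add i3 i2, integral_add hint i1, integral_sub_right_eq_self,
            integral_add_right_eq_self]
        ring
    _ = _ := by rw [hκ, integral_const_mul]

end rates

/-! ### Density of the functions `ĝ(x) e^{itx}` among Hermitian functions -/

lemma integrable_mul_exp {G : ℝ → ℂ} (hG : Integrable G) (t : ℝ) :
    Integrable fun x : ℝ => G x * Complex.exp (Complex.I * t * x) :=
  hG.mul_bdd (c := 1) (Continuous.aestronglyMeasurable (by fun_prop))
    (ae_of_all _ fun x => (norm_exp_I_mul_real t x).le)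

/-- The positive and negative parts of `g` are densities of two finite measures with the same
characteristic function, so these measures coincide. Two parts that are equal almost everywhere must
vanish, one of them being `0` at each point. -/
lemma ae_eq_zero_of_fourier_eq_zero_real {g : ℝ → ℝ} (hg : Integrable g)
    (h : ∀ t : ℝ, ∫ x : ℝ, (g x : ℂ) * Complex.exp (Complex.I * t * x) = 0) :
    g =ᵐ[volume] 0 := by
  set p : ℝ → ENNReal := fun x => ENNReal.ofReal (g x) with hp
  set q : ℝ → ENNReal := fun x => ENNReal.ofReal (-g x) with hq
  have hpm : AEMeasurable p := hg.aemeasurable.ennreal_ofReal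
  have hqm : AEMeasurable q := hg.neg.aemeasurable.ennreal_ofReal
  have hpt : ∫⁻ x, p x ≠ ⊤ := (hg.lintegral_lt_top).ne
  have hqt : ∫⁻ x, q x ≠ ⊤ := (hg.neg.lintegral_lt_top).ne
  have : IsFiniteMeasure (volume.withDensity p) := isFiniteMeasure_withDensity hpt
  have : IsFiniteMeasure (volume.withDensity q) := isFiniteMeasure_withDensity hqt
  have heq : volume.withDensity p = volume.withDensity q := by
    refine Measure.ext_of_charFun ?_
    funext t
    rw [charFun_apply_real, charFun_apply_real,
      integral_withDensity_eq_integral_toReal_smul₀ hpm (ae_of_all _ fun x => by simp [hp]),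
      integral_withDensity_eq_integral_toReal_smul₀ hqm (ae_of_all _ fun x => by simp [hq]),
      ← sub_eq_zero, ← integral_sub, ← h t]
    · refine integral_congr_ae (ae_of_all _ fun x => ?_)
      simp only [hp, hq, ENNReal.toReal_ofReal', Complex.real_smul]
      rw [← sub_mul, ← Complex.ofReal_sub, max_zero_sub_max_neg_zero_eq_self]
      congr 2
      ring
    · refine (integrable_mul_exp (hg.pos_part.ofReal (𝕜 := ℂ)) t).congr (ae_of_all _ fun x => ?_)
      simp only [hp, ENNReal.toReal_ofReal', Complex.real_smul, mul_comm, mul_left_comm]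
      rfl
    · refine (integrable_mul_exp (hg.neg_part.ofReal (𝕜 := ℂ)) t).congr (ae_of_all _ fun x => ?_)
      simp only [hq, ENNReal.toReal_ofReal', Complex.real_smul, mul_comm, mul_left_comm]
      rfl
  filter_upwards [(withDensity_eq_iff hpm hqm hpt).mp heq] with x hx
  simp only [hp, hq] at hx
  rcases le_total 0 (g x) with h0 | h0
  · rw [ENNReal.ofReal_of_nonpos (by linarith : -g x ≤ 0), ENNReal.ofReal_eq_zero] at hx
    exact le_antisymm hx h0
  · rw [ENNReal.ofReal_of_nonpos h0, eq_comm, ENNReal.ofReal_eq_zero] at hx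
    simp only [Pi.zero_apply]; linarith

/-- An integrable function whose Fourier transform vanishes is zero almost everywhere. -/
lemma ae_eq_zero_of_fourier_eq_zero {G : ℝ → ℂ} (hG : Integrable G)
    (h : ∀ t : ℝ, ∫ x : ℝ, G x * Complex.exp (Complex.I * t * x) = 0) : G =ᵐ[volume] 0 := by
  have hconj : ∀ t : ℝ, ∫ x : ℝ, conj (G x) * Complex.exp (Complex.I * t * x) = 0 := by
    intro t
    have h1 := congrArg conj (h (-t))
    rw [← integral_conj, map_zero] at h1
    rw [← h1]
    refine integral_congr_ae (ae_of_all _ fun x => ?_)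
    simp only [map_mul, ← Complex.exp_conj, Complex.conj_I, Complex.conj_ofReal]
    congr 2
    push_cast; ring
  have hGc : Integrable fun x => conj (G x) := by
    refine hG.norm.mono' (Complex.continuous_conj.comp_aestronglyMeasurable hG.aestronglyMeasurable)
      (ae_of_all _ fun x => ?_)
    rw [RCLike.norm_conj]
  have hre : (fun x => (G x).re) =ᵐ[volume] 0 := by
    refine ae_eq_zero_of_fourier_eq_zero_real hG.re fun t => ?_
    have h1 : ∀ x : ℝ, ((G x).re : ℂ) * Complex.exp (Complex.I * t * x)
        = (1 / 2 : ℂ) * (G x * Complex.exp (Complex.I * t * x)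
          + conj (G x) * Complex.exp (Complex.I * t * x)) := by
      intro x; rw [Complex.re_eq_add_conj]; ring
    simp_rw [h1]
    rw [integral_const_mul, integral_add (integrable_mul_exp hG t) (integrable_mul_exp hGc t), h,
      hconj]
    simp
  have him : (fun x => (G x).im) =ᵐ[volume] 0 := by
    refine ae_eq_zero_of_fourier_eq_zero_real hG.im fun t => ?_
    have h1 : ∀ x : ℝ, ((G x).im : ℂ) * Complex.exp (Complex.I * t * x)
        = (1 / (2 * Complex.I) : ℂ) * (G x * Complex.exp (Complex.I * t * x)
          - conj (G x) * Complex.exp (Complex.I * t * x)) := by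
      intro x; rw [Complex.im_eq_sub_conj]; ring
    simp_rw [h1]
    rw [integral_const_mul, integral_sub (integrable_mul_exp hG t) (integrable_mul_exp hGc t), h,
      hconj]
    simp
  filter_upwards [hre, him] with x h1 h2
  exact Complex.ext h1 h2

section density

variable {h : ℝ → ℝ} {η : ℝ} {uhat : ℝ → ℂ}

/-- The real inner product sees only the real part of `∫ conj(z) h e^{itx}`. Since `h` is even,
twice this real part is the Fourier transform of `h(x) (conj(z(x)) + z(-x))`. Uniqueness and `h ≠ 0`
off the origin make `z` anti-Hermitian, which is the exact orthogonal complement of the Hermitian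
functions. -/
lemma ae_neg_eq_of_inner_harmonicVec_eq_zero (hh : IsSpectralWeight h η)
    {z : Lp ℂ 2 (volume : Measure ℝ)} (hz : ∀ t, inner ℝ (harmonicVec hh t) z = 0) :
    ∀ᵐ x : ℝ, z (-x) = -conj (z x) := by
  have hzm : MemLp z 2 := Lp.memLp z
  have hzn : MemLp (fun x => z (-x)) 2 :=
    hzm.comp_measurePreserving (Measure.measurePreserving_neg volume)
  have hzc : MemLp (fun x => conj (z x)) 2 := hzm.star
  have hhm : MemLp (fun x => (h x : ℂ)) 2 := by
    have h1 : harmonic h 0 = fun x => (h x : ℂ) := by funext x; simp [harmonic]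
    rw [← h1]
    exact memLp_harmonic hh 0
  have hi1 : Integrable fun x => conj (z x) * h x := hzc.integrable_mul hhm
  have hi2 : Integrable fun x => z (-x) * h x := hzn.integrable_mul hhm
  have hG : Integrable fun x => conj (z x) * h x + z (-x) * h x := hi1.add hi2
  have hfour : ∀ t : ℝ, ∫ x : ℝ, (conj (z x) * h x + z (-x) * h x)
      * Complex.exp (Complex.I * t * x) = 0 := by
    intro t
    simp_rw [add_mul]
    rw [integral_add (integrable_mul_exp hi1 t) (integrable_mul_exp hi2 t)]
    have e1 : ∫ x : ℝ, z (-x) * h x * Complex.exp (Complex.I * t * x)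
        = conj (∫ x : ℝ, conj (z x) * h x * Complex.exp (Complex.I * t * x)) := by
      rw [← integral_neg_eq_self, ← integral_conj]
      refine integral_congr_ae (ae_of_all _ fun x => ?_)
      simp only [neg_neg, hh.even, map_mul, Complex.conj_conj, Complex.conj_ofReal,
        ← Complex.exp_conj, Complex.conj_I]
      congr 2
      push_cast; ring
    have e2 : (∫ x : ℝ, conj (z x) * h x * Complex.exp (Complex.I * t * x)).re = 0 := by
      have e3 := integral_re (𝕜 := ℂ) (integrable_mul_exp hi1 t)
      simp only [RCLike.re_to_complex] at e3
      rw [← e3, ← hz t, real_inner_comm, L2.inner_def]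
      refine integral_congr_ae ?_
      filter_upwards [harmonicVec_ae_eq hh t] with x hx
      rw [hx, Complex.inner, harmonic]
      congr 1
      ring
    rw [e1, Complex.add_conj, e2]
    simp
  have hne : ∀ᵐ x : ℝ, x ≠ 0 := by simp [ae_iff]
  filter_upwards [ae_eq_zero_of_fourier_eq_zero hG hfour, hne] with x hx hx0
  have hpos : ((h x : ℝ) : ℂ) ≠ 0 := by exact_mod_cast (hh.pos x hx0).ne'
  rw [← add_mul, Pi.zero_apply, mul_eq_zero, or_iff_left hpos] at hx
  exact eq_neg_of_add_eq_zero_right hx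

/-- Hermitian functions of `L²(ℝ)` lie in the closed real span of the functions `ĝ(x) e^{itx}`. -/
lemma mem_closure_span_harmonicVec (hh : IsSpectralWeight h η) {X : Lp ℂ 2 (volume : Measure ℝ)}
    {f : ℝ → ℂ} (hX : X =ᵐ[volume] f) (hf : ∀ x, f (-x) = conj (f x)) :
    X ∈ (Submodule.span ℝ (Set.range (harmonicVec hh))).topologicalClosure := by
  rw [← Submodule.orthogonal_orthogonal_eq_closure, Submodule.mem_orthogonal]
  intro z hz
  have hz' : ∀ t, inner ℝ (harmonicVec hh t) z = 0 := fun t =>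
    (Submodule.mem_orthogonal _ _).mp hz _ (Submodule.subset_span ⟨t, rfl⟩)
  have hneg := ae_neg_eq_of_inner_harmonicVec_eq_zero hh hz'
  have e1 : inner ℝ z X = ∫ x, (f x * conj (z x)).re := by
    rw [L2.inner_def]
    refine integral_congr_ae ?_
    filter_upwards [hX] with x hx
    rw [hx, Complex.inner]
  -- The reflection `x ↦ -x` conjugates `f` and sends `z` to `-conj z`, so the real part changes
  -- sign.
  have e2 : ∫ x, (f x * conj (z x)).re = -∫ x, (f x * conj (z x)).re := by
    nth_rewrite 1 [← integral_neg_eq_self]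
    rw [← integral_neg]
    refine integral_congr_ae ?_
    filter_upwards [hneg] with x hx
    rw [hf, hx, map_neg, Complex.conj_conj]
    simp [Complex.mul_re]
  rw [e1]
  linarith

lemma atom_neg {F : ℝ → ℂ} (hF : ∀ y, F (-y) = conj (F y)) (J : ℕ) (k : ℤ) (x : ℝ) :
    atom F J k (-x) = conj (atom F J k x) := by
  simp only [atom, neg_div, hF, map_mul, conj_inv_sqrt_two_pow, conj_exp_I_mul]
  congr 2
  push_cast; ring

lemma scalingVec_mem_closure_span (hh : IsSpectralWeight h η) (hu : IsMeyerFilter uhat) (J : ℕ)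
    (k : ℤ) : scalingVec hh hu J k
      ∈ (Submodule.span ℝ (Set.range (harmonicVec hh))).topologicalClosure := by
  refine mem_closure_span_harmonicVec hh (scalingVec_ae_eq hh hu J k) (atom_neg (fun y => ?_) J k)
  have h2 : (0 : ℝ) ≤ 2 ^ J := by positivity
  rw [scalingProfile, scalingProfile, ← hh.apply_mul_abs h2 (wrap (-y)), abs_wrap_neg,
    hh.apply_mul_abs h2, scalingHat_neg hu, map_mul, Complex.conj_ofReal]

lemma waveletVec_mem_closure_span (hh : IsSpectralWeight h η) (hu : IsMeyerFilter uhat) (J : ℕ)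
    (k : ℤ) : waveletVec hu J k
      ∈ (Submodule.span ℝ (Set.range (harmonicVec hh))).topologicalClosure := by
  refine mem_closure_span_harmonicVec hh (waveletVec_ae_eq hu J k) (atom_neg (fun y => ?_) J k)
  rw [waveletProfile, waveletProfile, waveletHat_neg hu, map_mul, Complex.conj_ofReal]

end density

/-! ### Gaussian Hilbert spaces -/

lemma inner_linearCombination {ι H L : Type*} [NormedAddCommGroup H] [InnerProductSpace ℝ H]
    [NormedAddCommGroup L] [InnerProductSpace ℝ L] {w : ι → H} {X : ι → L}
    (hG : ∀ i j, inner ℝ (X i) (X j) = inner ℝ (w i) (w j)) (a b : ι →₀ ℝ) :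
    inner ℝ (Finsupp.linearCombination ℝ X a) (Finsupp.linearCombination ℝ X b)
      = inner ℝ (Finsupp.linearCombination ℝ w a) (Finsupp.linearCombination ℝ w b) := by
  simp only [Finsupp.linearCombination_apply, Finsupp.sum, sum_inner, inner_sum,
    real_inner_smul_left, real_inner_smul_right, hG]

/-- Two families with the same Gram matrix are related by a map which is isometric on the closed
span of the first one. -/
lemma exists_isometric_extension {ι H L : Type*} [NormedAddCommGroup H] [InnerProductSpace ℝ H]
    [CompleteSpace H] [NormedAddCommGroup L] [InnerProductSpace ℝ L] [CompleteSpace L]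
    {w : ι → H} {X : ι → L} (hG : ∀ i j, inner ℝ (X i) (X j) = inner ℝ (w i) (w j)) :
    ∃ T : H →L[ℝ] L, (∀ i, T (w i) = X i) ∧
      (∀ x ∈ (Submodule.span ℝ (Set.range w)).topologicalClosure,
        ∀ y ∈ (Submodule.span ℝ (Set.range w)).topologicalClosure,
          inner ℝ (T x) (T y) = inner ℝ x y) ∧
      ∀ x ∈ (Submodule.span ℝ (Set.range w)).topologicalClosure,
        T x ∈ (Submodule.span ℝ (Set.range X)).topologicalClosure := by
  set K := (Submodule.span ℝ (Set.range w)).topologicalClosure with hK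
  have hmem : ∀ a, Finsupp.linearCombination ℝ w a ∈ K := fun a =>
    Submodule.le_topologicalClosure _ (by
      rw [← Finsupp.range_linearCombination]; exact LinearMap.mem_range_self _ a)
  have : CompleteSpace K :=
    (Submodule.isClosed_topologicalClosure _).completeSpace_coe
  let e : (ι →₀ ℝ) →ₗ[ℝ] K := (Finsupp.linearCombination ℝ w).codRestrict K hmem
  let f : (ι →₀ ℝ) →ₗ[ℝ] L := Finsupp.linearCombination ℝ X
  have hin : ∀ a b, inner ℝ (f a) (f b) = inner ℝ (e a) (e b) := fun a b =>
    inner_linearCombination hG a b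
  have hdense : DenseRange e := by
    intro x
    rw [closure_subtype]
    have hx : (x : H) ∈ closure ((Submodule.span ℝ (Set.range w) : Submodule ℝ H) : Set H) := x.2
    refine closure_mono ?_ hx
    intro y hy
    rw [SetLike.mem_coe, ← Finsupp.range_linearCombination] at hy
    obtain ⟨a, rfl⟩ := hy
    exact ⟨e a, ⟨a, rfl⟩, rfl⟩
  -- Equal norms make the map well defined on values: coefficients with the same combination of the
  -- `w i` give the same combination of the `X i`.
  have hnorm : ∃ C, ∀ a, ‖f a‖ ≤ C * ‖e a‖ := by
    refine ⟨1, fun a => ?_⟩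
    have h1 := hin a a
    rw [real_inner_self_eq_norm_sq, real_inner_self_eq_norm_sq] at h1
    rw [one_mul, (sq_eq_sq₀ (norm_nonneg _) (norm_nonneg _)).mp h1]
  set T₀ : K →L[ℝ] L := f.extendOfNorm e with hT₀
  have hT₀e : ∀ a, T₀ (e a) = f a := LinearMap.extendOfNorm_eq hdense hnorm
  have hT₀in : ∀ x y : K, inner ℝ (T₀ x) (T₀ y) = inner ℝ x y := by
    intro x y
    refine hdense.induction_on₂ (p := fun x y => inner ℝ (T₀ x) (T₀ y) = inner ℝ x y) ?_ ?_ x y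
    · exact isClosed_eq (by fun_prop) (by fun_prop)
    · intro a b; rw [hT₀e, hT₀e, hin]
  have hT₀mem : ∀ x : K, T₀ x ∈ (Submodule.span ℝ (Set.range X)).topologicalClosure := by
    intro x
    refine hdense.induction_on (p := fun x => T₀ x ∈ (Submodule.span ℝ
      (Set.range X)).topologicalClosure) x ?_ ?_
    · exact (Submodule.isClosed_topologicalClosure _).preimage T₀.continuous
    · intro a
      rw [hT₀e]
      refine Submodule.le_topologicalClosure _ ?_
      rw [← Finsupp.range_linearCombination]
      exact LinearMap.mem_range_self _ a
  have hTx : ∀ x : K, (T₀ ∘L K.orthogonalProjectionOnto) (x : H) = T₀ x := fun x => by simp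
  -- Composing with the projection only serves to have a map on all of `H`; its values matter on `K`
  -- alone.
  refine ⟨T₀ ∘L K.orthogonalProjectionOnto, fun i => ?_, fun x hx y hy => ?_, fun x hx => ?_⟩
  · have h1 : w i = ((e (Finsupp.single i 1) : K) : H) := by
      simp [e]
    rw [h1, hTx, hT₀e]
    simp [f]
  · rw [hTx ⟨x, hx⟩, hTx ⟨y, hy⟩, hT₀in]; rfl
  · rw [hTx ⟨x, hx⟩]; exact hT₀mem _

section gaussian

variable {Ω : Type*} [MeasurableSpace Ω] {P : Measure Ω}

lemma aemeasurable_Lp (X : Lp ℝ 2 P) : AEMeasurable X P := (Lp.aestronglyMeasurable X).aemeasurable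

lemma norm_sq_Lp_eq (X : Lp ℝ 2 P) : ‖X‖ ^ 2 = ∫ ω, X ω ^ 2 ∂P := by
  rw [← real_inner_self_eq_norm_sq, L2.inner_def]
  simp [pow_two]

lemma inner_Lp_eq (X Y : Lp ℝ 2 P) : inner ℝ X Y = ∫ ω, X ω * Y ω ∂P := by
  rw [L2.inner_def]
  simp [mul_comm]

/-- A centered Gaussian element of `L²(P)`. -/
def IsCenteredGaussian (X : Lp ℝ 2 P) : Prop := P.map X = gaussianReal 0 (‖X‖₊ ^ 2)

lemma isCenteredGaussian_iff [IsProbabilityMeasure P] (X : Lp ℝ 2 P) : IsCenteredGaussian X ↔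
    ∀ t : ℝ, ∫ ω, Complex.exp (t * X ω * Complex.I) ∂P = Complex.exp (-(‖X‖ ^ 2 * t ^ 2 / 2)) := by
  have h1 : ∀ t : ℝ, charFun (P.map X) t = ∫ ω, Complex.exp (t * X ω * Complex.I) ∂P := by
    intro t
    rw [charFun_apply_real, integral_map (aemeasurable_Lp X)
      (Continuous.aestronglyMeasurable (by fun_prop))]
  have h2 : ∀ t : ℝ, charFun (gaussianReal 0 (‖X‖₊ ^ 2)) t
      = Complex.exp (-(‖X‖ ^ 2 * t ^ 2 / 2)) := by
    intro t
    rw [charFun_gaussianReal]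
    congr 1
    push_cast
    simp
  have : IsProbabilityMeasure (P.map X) := Measure.isProbabilityMeasure_map (aemeasurable_Lp X)
  constructor
  · intro h t
    rw [← h1, ← h2, h]
  · intro h
    refine Measure.ext_of_charFun ?_
    funext t
    rw [h1, h2, h]

/-- An `L²` limit is an almost sure limit along a subsequence, so characteristic functions converge
by domination. Their explicit Gaussian form passes to the limit because the variance is the squared
norm. -/
lemma isClosed_isCenteredGaussian [IsProbabilityMeasure P] :
    IsClosed {X : Lp ℝ 2 P | IsCenteredGaussian X} := by
  refine IsSeqClosed.isClosed fun Y X hY hlim => ?_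
  obtain ⟨ns, hns, hae⟩ := (tendstoInMeasure_of_tendsto_Lp hlim).exists_seq_tendsto_ae
  rw [Set.mem_ofPred_eq, isCenteredGaussian_iff]
  intro t
  have h1 : Filter.Tendsto (fun i => ∫ ω, Complex.exp (t * Y (ns i) ω * Complex.I) ∂P) Filter.atTop
      (nhds (∫ ω, Complex.exp (t * X ω * Complex.I) ∂P)) := by
    refine tendsto_integral_of_dominated_convergence (fun _ => 1) (fun i => ?_)
      (integrable_const _) (fun i => ae_of_all _ fun ω => ?_) ?_
    · have := (aemeasurable_Lp (Y (ns i)))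
      exact AEMeasurable.aestronglyMeasurable (by fun_prop)
    · rw [Complex.norm_exp]; simp
    · filter_upwards [hae] with ω hω
      have hc : Continuous fun r : ℝ => Complex.exp (t * r * Complex.I) := by fun_prop
      exact (hc.tendsto _).comp hω
  have h2 : Filter.Tendsto (fun i => Complex.exp (-(‖Y (ns i)‖ ^ 2 * t ^ 2 / 2))) Filter.atTop
      (nhds (Complex.exp (-(‖X‖ ^ 2 * t ^ 2 / 2)))) := by
    have hc : Continuous fun Z : Lp ℝ 2 P => Complex.exp (-((‖Z‖ : ℂ) ^ 2 * t ^ 2 / 2)) := by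
      fun_prop
    exact (hc.tendsto _).comp (hlim.comp hns.tendsto_atTop)
  refine tendsto_nhds_unique h1 (h2.congr fun i => ?_)
  exact ((isCenteredGaussian_iff _).mp (hY (ns i)) t).symm

lemma isCenteredGaussian_of_hasGaussianLaw {X : Lp ℝ 2 P} (hX : HasGaussianLaw X P)
    (h0 : ∫ ω, X ω ∂P = 0) : IsCenteredGaussian X := by
  rw [IsCenteredGaussian, hX.map_eq_gaussianReal, h0]
  congr 1
  rw [variance_of_integral_eq_zero (aemeasurable_Lp X) h0, ← norm_sq_Lp_eq]
  ext
  simp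

lemma IsCenteredGaussian.hasLaw {X : Lp ℝ 2 P} (hX : IsCenteredGaussian X) :
    HasLaw X (gaussianReal 0 (‖X‖₊ ^ 2)) P := ⟨aemeasurable_Lp X, hX⟩

lemma IsCenteredGaussian.integral_eq_zero {X : Lp ℝ 2 P} (hX : IsCenteredGaussian X) :
    ∫ ω, X ω ∂P = 0 := by
  have h := integral_map (aemeasurable_Lp X) (f := fun x : ℝ => x)
    (Continuous.aestronglyMeasurable (by fun_prop))
  rw [← h, hX, integral_id_gaussianReal]

/-- The closed span of a centered Gaussian family consists of centered Gaussian variables. -/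
lemma isCenteredGaussian_of_mem_closure_span [IsProbabilityMeasure P] {ι : Type*}
    {X : ι → Ω → ℝ} (hX : IsGaussianProcess X P)
    (h0 : ∀ i, ∫ ω, X i ω ∂P = 0) {Xv : ι → Lp ℝ 2 P} (hXv : ∀ i, Xv i =ᵐ[P] X i) {Y : Lp ℝ 2 P}
    (hY : Y ∈ (Submodule.span ℝ (Set.range Xv)).topologicalClosure) : IsCenteredGaussian Y := by
  have hle : closure ((Submodule.span ℝ (Set.range Xv) : Submodule ℝ (Lp ℝ 2 P)) : Set (Lp ℝ 2 P))
      ⊆ {Y | IsCenteredGaussian Y} := by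
    refine closure_minimal (fun Z hZ => ?_) isClosed_isCenteredGaussian
    rw [SetLike.mem_coe, ← Finsupp.range_linearCombination] at hZ
    obtain ⟨c, rfl⟩ := hZ
    have hae : (Finsupp.linearCombination ℝ Xv c : Lp ℝ 2 P) =ᵐ[P]
        fun ω => ∑ i ∈ c.support, c i • X i ω := by
      rw [Finsupp.linearCombination_apply, Finsupp.sum]
      refine (Lp.coeFn_finsetSum _ _).trans ?_
      have h1 : ∀ᵐ ω ∂P, ∀ i ∈ c.support, (c i • Xv i : Lp ℝ 2 P) ω = c i • X i ω := by
        rw [Finset.eventually_all]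
        intro i _
        filter_upwards [Lp.coeFn_smul (c i) (Xv i), hXv i] with ω h2 h3
        rw [h2, Pi.smul_apply, h3]
      filter_upwards [h1] with ω hω
      rw [Finset.sum_apply]
      exact Finset.sum_congr rfl hω
    have hlaw : HasGaussianLaw (fun ω => ∑ i ∈ c.support, c i • X i ω) P :=
      (hX.smul c).hasGaussianLaw_fun_sum
    refine isCenteredGaussian_of_hasGaussianLaw (hlaw.congr hae.symm) ?_
    rw [integral_congr_ae hae, integral_finsetSum]
    · refine Finset.sum_eq_zero fun i _ => ?_
      rw [integral_smul, h0, smul_zero]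
    · exact fun i _ => (hX.hasGaussianLaw_eval i).integrable.smul (c i)
  rw [← SetLike.mem_coe, Submodule.topologicalClosure_coe] at hY
  exact hle hY

/-- A family in a linear space of centered Gaussian variables is a Gaussian process. -/
lemma isGaussianProcess_of_mem {ι : Type*} {S : Submodule ℝ (Lp ℝ 2 P)}
    (hS : ∀ Y ∈ S, IsCenteredGaussian Y) {Z : ι → Lp ℝ 2 P} (hZ : ∀ i, Z i ∈ S) :
    IsGaussianProcess (fun i ω => Z i ω) P where
  hasGaussianLaw I := by
    have hmeas : AEMeasurable (fun ω => I.restrict (fun i => Z i ω)) P :=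
      aemeasurable_pi_iff.mpr fun i => aemeasurable_Lp (Z i)
    refine ⟨isGaussian_of_map_eq_gaussianReal fun L => ?_⟩
    classical
    -- The functional `L` written in coordinates: a linear combination of the `Z i`, hence an
    -- element of `S`.
    set Y : Lp ℝ 2 P := ∑ i : I, L (Pi.single i 1) • Z i with hYdef
    have hY : Y ∈ S := S.sum_mem fun i _ => S.smul_mem _ (hZ i)
    refine ⟨0, ‖Y‖₊ ^ 2, ?_⟩
    rw [AEMeasurable.map_map_of_aemeasurable (by fun_prop) hmeas, ← hS Y hY]
    refine Measure.map_congr ?_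
    have h1 : ∀ᵐ ω ∂P, ∀ i : I, (L (Pi.single i 1) • Z i : Lp ℝ 2 P) ω
        = L (Pi.single i 1) • Z i ω := by
      rw [ae_all_iff]
      intro i
      filter_upwards [Lp.coeFn_smul (L (Pi.single i 1)) (Z i)] with ω h2
      rw [h2, Pi.smul_apply]
    filter_upwards [h1, Lp.coeFn_finsetSum Finset.univ
      (fun i : I => L (Pi.single i 1) • Z i)] with ω h2 h3
    rw [hYdef, h3, Finset.sum_apply, Finset.sum_congr rfl fun i _ => h2 i, Function.comp_apply]
    have h4 : (I.restrict fun i => Z i ω) = ∑ i : I, (Z i ω) • (Pi.single i (1 : ℝ) : I → ℝ) := by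
      ext i
      simp [Finset.sum_apply, Pi.single_apply]
    rw [h4, map_sum]
    refine Finset.sum_congr rfl fun i _ => ?_
    rw [map_smul, smul_eq_mul, smul_eq_mul, mul_comm]

/-- The law of `X` is that of `‖X‖` times a standard Gaussian, so the `L²` norm controls every
moment. -/
lemma IsCenteredGaussian.lintegral_pow_le {X : Lp ℝ 2 P} (hX : IsCenteredGaussian X) (q : ℕ) :
    ∫⁻ ω, ENNReal.ofReal (|X ω| ^ q) ∂P
      ≤ ENNReal.ofReal (‖X‖ ^ q * ∫ x, |x| ^ q ∂(gaussianReal 0 1)) := by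
  have hmap : gaussianReal 0 (‖X‖₊ ^ 2) = (gaussianReal 0 1).map (‖X‖ * ·) := by
    rw [gaussianReal_map_const_mul, mul_zero, mul_one]
    congr 1
  have h1 : ∫⁻ ω, ENNReal.ofReal (|X ω| ^ q) ∂P
      = ∫⁻ x, ENNReal.ofReal (|x| ^ q) ∂(P.map X) :=
    (lintegral_map' (f := fun x : ℝ => ENNReal.ofReal (|x| ^ q)) (by fun_prop)
      (aemeasurable_Lp X)).symm
  have hint : Integrable (fun x : ℝ => |x| ^ q) (gaussianReal 0 1) := by
    have := (memLp_id_gaussianReal (μ := 0) (v := 1) q).integrable_norm_pow'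
    simpa using this
  rw [h1, hX, hmap, lintegral_map (by fun_prop) (by fun_prop),
    ← integral_const_mul, ofReal_integral_eq_lintegral_ofReal (hint.const_mul _)
      (ae_of_all _ fun x => by positivity)]
  refine le_of_eq (lintegral_congr fun x => ?_)
  rw [abs_mul, abs_norm, mul_pow]

end gaussian

/-- The random input of the algorithm is jointly Gaussian. -/
lemma IsSimulationInput.isGaussianProcess_elim {M : VelocityModel} {Ω : Type*} [MeasurableSpace Ω]
    {P : Measure Ω} {V₀ : ℤ → Ω → ℝ} {ε : ℕ → ℤ → Ω → ℝ} (hin : IsSimulationInput M P V₀ ε) :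
    IsGaussianProcess (Sum.elim V₀ fun i : ℕ × ℤ => ε i.1 i.2) P where
  hasGaussianLaw I := by
    have h1 : HasGaussianLaw (fun ω => I.toLeft.restrict (V₀ · ω)) P :=
      hin.gaussian.hasGaussianLaw _
    have h2 : HasGaussianLaw (fun ω (i : I.toRight) => ε i.1.1 i.1.2 ω) P := by
      refine iIndepFun.hasGaussianLaw (X := fun (i : I.toRight) => ε i.1.1 i.1.2)
        (fun i => (hin.noise_law _ _).hasGaussianLaw) ?_
      exact hin.noise_indep.precomp (g := fun i : I.toRight => i.1) Subtype.val_injective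
    have hind : IndepFun (fun ω => I.toLeft.restrict (V₀ · ω))
        (fun ω (i : I.toRight) => ε i.1.1 i.1.2 ω) P :=
      hin.indep.comp (φ := fun a : ℤ → ℝ => I.toLeft.restrict a)
        (ψ := fun (a : ℕ × ℤ → ℝ) (i : I.toRight) => a i) (by fun_prop) (by fun_prop)
    have h3 := hind.hasGaussianLaw h1 h2
    let L : ((I.toLeft → ℝ) × (I.toRight → ℝ)) →L[ℝ] (I → ℝ) :=
      ContinuousLinearMap.pi fun i => match i with
        | ⟨Sum.inl k, hk⟩ => (ContinuousLinearMap.proj ⟨k, Finset.mem_toLeft.mpr hk⟩).comp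
            (ContinuousLinearMap.fst ℝ _ _)
        | ⟨Sum.inr k, hk⟩ => (ContinuousLinearMap.proj ⟨k, Finset.mem_toRight.mpr hk⟩).comp
            (ContinuousLinearMap.snd ℝ _ _)
    refine (h3.map_fun L).congr (ae_of_all _ fun ω => ?_)
    funext i
    rcases i with ⟨k | k, hk⟩ <;> rfl

/-! ### Convergence of dyadic approximations -/

lemma abs_floor_le {N : ℕ} {t : ℝ} (ht : |t| ≤ N) (J : ℕ) :
    |⌊(2 : ℝ) ^ J * t⌋| ≤ (N : ℤ) * 2 ^ J := by
  have hp : (0 : ℝ) < 2 ^ J := by positivity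
  rw [abs_le] at ht ⊢
  constructor
  · rw [Int.le_floor]; push_cast; nlinarith [ht.1]
  · have h1 : (2 : ℝ) ^ J * t ≤ (((N : ℤ) * 2 ^ J : ℤ) : ℝ) := by push_cast; nlinarith [ht.2]
    exact_mod_cast (Int.floor_le _).trans h1

lemma floor_two_pow_succ (J : ℕ) (t : ℝ) : ∃ e : ℤ, 0 ≤ e ∧ e ≤ 1 ∧
    ⌊(2 : ℝ) ^ (J + 1) * t⌋ = 2 * ⌊(2 : ℝ) ^ J * t⌋ + e := by
  refine ⟨⌊(2 : ℝ) ^ (J + 1) * t⌋ - 2 * ⌊(2 : ℝ) ^ J * t⌋, ?_, ?_, by ring⟩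
  · have h1 := Int.floor_le ((2 : ℝ) ^ J * t)
    have : 2 * ⌊(2 : ℝ) ^ J * t⌋ ≤ ⌊(2 : ℝ) ^ (J + 1) * t⌋ := by
      rw [Int.le_floor, pow_succ]; push_cast; linarith
    linarith
  · have h1 := Int.lt_floor_add_one ((2 : ℝ) ^ J * t)
    have : ⌊(2 : ℝ) ^ (J + 1) * t⌋ < 2 * ⌊(2 : ℝ) ^ J * t⌋ + 2 := by
      rw [Int.floor_lt, pow_succ]; push_cast; linarith
    linarith

/-- The floors at consecutive levels satisfy `k ↦ 2k + e` with `e ∈ {0, 1}`, so the approximations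
of a fixed `t` have increments below a geometric sequence, whose tail sums to the stated bound. -/
lemma abs_sub_limUnder_le {x : ℕ → ℤ → ℝ} {ρ A : ℝ} {N : ℕ} (h1 : ρ < 1)
    (hx : ∀ J : ℕ, ∀ k e : ℤ, |k| ≤ N * 2 ^ J → 0 ≤ e → e ≤ 1 →
      |x (J + 1) (2 * k + e) - x J k| ≤ A * ρ ^ J) {t : ℝ} (ht : |t| ≤ N) (J : ℕ) :
    |x J ⌊(2 : ℝ) ^ J * t⌋ - Filter.limUnder Filter.atTop fun J => x J ⌊(2 : ℝ) ^ J * t⌋|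
      ≤ A * ρ ^ J / (1 - ρ) := by
  have hstep : ∀ J, dist (x J ⌊(2 : ℝ) ^ J * t⌋) (x (J + 1) ⌊(2 : ℝ) ^ (J + 1) * t⌋)
      ≤ A * ρ ^ J := by
    intro J
    obtain ⟨e, he0, he1, he⟩ := floor_two_pow_succ J t
    rw [he, dist_comm, Real.dist_eq]
    exact hx J _ e (abs_floor_le ht J) he0 he1
  have hc := cauchySeq_of_le_geometric ρ A h1 hstep
  rw [← Real.dist_eq]
  exact dist_le_of_le_geometric_of_tendsto ρ A h1 hstep hc.tendsto_limUnder J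

lemma floor_sub_le {s t : ℝ} {J : ℕ} (hst : s ≤ t) (h : t - s ≤ (1 / 2) ^ J) :
    ⌊(2 : ℝ) ^ J * t⌋ = ⌊(2 : ℝ) ^ J * s⌋ ∨ ⌊(2 : ℝ) ^ J * t⌋ = ⌊(2 : ℝ) ^ J * s⌋ + 1 := by
  have hp : (0 : ℝ) < 2 ^ J := by positivity
  have h2 : (2 : ℝ) ^ J * t ≤ 2 ^ J * s + 1 := by
    have : (2 : ℝ) ^ J * (1 / 2) ^ J = 1 := by rw [← mul_pow]; norm_num
    nlinarith
  have h3 : ⌊(2 : ℝ) ^ J * s⌋ ≤ ⌊(2 : ℝ) ^ J * t⌋ := Int.floor_le_floor (by gcongr)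
  have h4 : ⌊(2 : ℝ) ^ J * t⌋ ≤ ⌊(2 : ℝ) ^ J * s⌋ + 1 := by
    rw [← Int.floor_add_one]; exact Int.floor_le_floor h2
  omega

/-- Times at distance at most `2^{-J}` have equal or adjacent floors at level `J`. Their limits
differ by two approximation errors and at most one increment between neighbours, all of order `ρ^J`.
-/
lemma continuous_limUnder {x : ℕ → ℤ → ℝ} {ρ : ℝ} (h0 : 0 < ρ) (h1 : ρ < 1)
    (hx : ∀ N : ℕ, ∃ A, (∀ J : ℕ, ∀ k e : ℤ, |k| ≤ N * 2 ^ J → 0 ≤ e → e ≤ 1 →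
        |x (J + 1) (2 * k + e) - x J k| ≤ A * ρ ^ J) ∧
      ∀ J : ℕ, ∀ k : ℤ, |k| ≤ N * 2 ^ J → |x J (k + 1) - x J k| ≤ A * ρ ^ J) :
    Continuous fun t : ℝ => Filter.limUnder Filter.atTop fun J => x J ⌊(2 : ℝ) ^ J * t⌋ := by
  set V : ℝ → ℝ := fun t : ℝ => Filter.limUnder Filter.atTop fun J => x J ⌊(2 : ℝ) ^ J * t⌋ with hV
  rw [Metric.continuous_iff]
  intro t ε hε
  -- The extra `1` keeps all `s` within distance `1` of `t` in the range of the same constant `A`.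
  obtain ⟨N, hN⟩ := exists_nat_ge (|t| + 1)
  obtain ⟨A, hA1, hA2⟩ := hx N
  have hA0 : 0 ≤ A := by
    have := (abs_nonneg _).trans (hA2 0 0 (by simp))
    simpa using this
  have h1ρ : 0 < 1 - ρ := by linarith
  have hlim : Filter.Tendsto (fun J : ℕ => (2 * A / (1 - ρ) + A) * ρ ^ J) Filter.atTop (nhds 0) := by
    have := (tendsto_pow_atTop_nhds_zero_of_lt_one h0.le h1).const_mul (2 * A / (1 - ρ) + A)
    simpa using this
  obtain ⟨J, hJ⟩ := (hlim.eventually (gt_mem_nhds hε)).exists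
  have key : ∀ r s : ℝ, |r| ≤ N → |s| ≤ N → r ≤ s → s - r ≤ (1 / 2) ^ J →
      |V s - V r| ≤ (2 * A / (1 - ρ) + A) * ρ ^ J := by
    intro r s hr hs hrs hd
    have e1 := abs_sub_limUnder_le h1 hA1 hr J
    have e2 := abs_sub_limUnder_le h1 hA1 hs J
    have e3 : |x J ⌊(2 : ℝ) ^ J * s⌋ - x J ⌊(2 : ℝ) ^ J * r⌋| ≤ A * ρ ^ J := by
      rcases floor_sub_le hrs hd with hf | hf
      · rw [hf, sub_self, abs_zero]; positivity
      · rw [hf]; exact hA2 J _ (abs_floor_le hr J)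
    change |x J ⌊(2 : ℝ) ^ J * r⌋ - V r| ≤ _ at e1
    change |x J ⌊(2 : ℝ) ^ J * s⌋ - V s| ≤ _ at e2
    have e4 : (2 * A / (1 - ρ) + A) * ρ ^ J
        = A * ρ ^ J / (1 - ρ) + A * ρ ^ J / (1 - ρ) + A * ρ ^ J := by ring
    rw [e4]
    rw [abs_le] at *
    constructor <;> linarith [e1.1, e1.2, e2.1, e2.2, e3.1, e3.2]
  refine ⟨min 1 ((1 / 2) ^ J), by positivity, fun s hs => ?_⟩
  rw [Real.dist_eq, lt_min_iff] at hs
  have hst : |s| ≤ N := by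
    have := abs_sub_abs_le_abs_sub s t
    linarith [hs.1]
  have htN : |t| ≤ N := by linarith
  rw [Real.dist_eq]
  refine lt_of_le_of_lt ?_ hJ
  rcases le_total t s with hts | hts
  · exact key t s htN hst hts (by rw [abs_of_nonneg (by linarith)] at hs; exact hs.2.le)
  · rw [abs_sub_comm]
    exact key s t hst htN hts (by
      rw [abs_sub_comm, abs_of_nonneg (by linarith)] at hs; exact hs.2.le)

/-! ### Uniform bounds from moment bounds -/

section moments

variable {Ω : Type*} [MeasurableSpace Ω] {P : Measure Ω}

/-- Moment bounds at dyadic points give a uniform almost sure rate on compact sets. -/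
lemma exists_uniform_bound {D : ℕ → ℤ → Ω → ℝ} (hD : ∀ J k, Measurable (D J k)) {q : ℕ}
    {η ν C : ℝ} (hC : 0 ≤ C) (hq : 1 < q * (η - ν)) (hq0 : q ≠ 0)
    (hmom : ∀ J k, ∫⁻ ω, ENNReal.ofReal (|D J k ω| ^ q) ∂P
      ≤ ENNReal.ofReal (C * (((2 : ℝ) ^ (-η)) ^ q) ^ J)) (N : ℕ) :
    ∃ A : Ω → ℝ, Measurable A ∧ (∀ ω, 0 ≤ A ω) ∧ ∀ᵐ ω ∂P, ∀ J : ℕ, ∀ k : ℤ,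
      |k| ≤ N * 2 ^ J → |D J k ω| ≤ A ω * ((2 : ℝ) ^ (-ν)) ^ J := by
  set σ : ℝ := (2 : ℝ) ^ ν with hσ
  have hσ0 : 0 < σ := by positivity
  have hσinv : (2 : ℝ) ^ (-ν) = σ⁻¹ := Real.rpow_neg (by norm_num) _
  set I : ℕ → Finset ℤ := fun J => Finset.Icc (-((N : ℤ) * 2 ^ J)) (N * 2 ^ J) with hI
  -- One variable dominates all levels and points at once. Level `J` has at most `(2N + 1) 2^J`
  -- points, each contributing at most `C (σ 2^{-η})^{qJ}` in mean, so the expectation of `S` is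
  -- bounded by a geometric series of ratio `2^{1-q(η-ν)} < 1`. The constant sought is `S^{1/q}`.
  set S : Ω → ENNReal := fun ω => ∑' J, ∑ k ∈ I J, ENNReal.ofReal ((σ ^ J * |D J k ω|) ^ q) with hS
  have hmeas1 : ∀ J k, Measurable fun ω => ENNReal.ofReal ((σ ^ J * |D J k ω|) ^ q) := by
    intro J k
    have := hD J k
    have h2 : Measurable fun ω => |D J k ω| := by simpa [Real.norm_eq_abs] using this.norm
    exact ((h2.const_mul _).pow_const _).ennreal_ofReal
  have hSm : Measurable S := Measurable.tsum fun J => Finset.measurable_fun_sum _ fun k _ =>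
    hmeas1 J k
  set ρ : ℝ := 2 * (σ * (2 : ℝ) ^ (-η)) ^ q with hρ
  have hρ0 : 0 ≤ ρ := by positivity
  have hρ1 : ρ < 1 := by
    have e1 : ρ = (2 : ℝ) ^ (1 - q * (η - ν)) := by
      rw [hρ, hσ, ← Real.rpow_add (by norm_num), ← Real.rpow_mul_natCast (by norm_num)]
      nth_rewrite 1 [← Real.rpow_one 2]
      rw [← Real.rpow_add (by norm_num)]
      congr 1; ring
    rw [e1]
    exact Real.rpow_lt_one_of_one_lt_of_neg (by norm_num) (by linarith)
  have hfin : ∫⁻ ω, S ω ∂P ≠ ⊤ := by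
    have e1 : ∫⁻ ω, S ω ∂P
        = ∑' J, ∑ k ∈ I J, ∫⁻ ω, ENNReal.ofReal ((σ ^ J * |D J k ω|) ^ q) ∂P := by
      rw [hS, lintegral_tsum fun J => (Finset.measurable_fun_sum _ fun k _ =>
        hmeas1 J k).aemeasurable]
      congr 1; funext J
      rw [lintegral_finsetSum _ fun k _ => hmeas1 J k]
    have e2 : ∀ J k, ∫⁻ ω, ENNReal.ofReal ((σ ^ J * |D J k ω|) ^ q) ∂P
        ≤ ENNReal.ofReal (C * ((σ * (2 : ℝ) ^ (-η)) ^ q) ^ J) := by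
      intro J k
      have e3 : ∀ ω, ENNReal.ofReal ((σ ^ J * |D J k ω|) ^ q)
          = ENNReal.ofReal ((σ ^ J) ^ q) * ENNReal.ofReal (|D J k ω| ^ q) := by
        intro ω
        rw [mul_pow, ENNReal.ofReal_mul (by positivity)]
      simp_rw [e3]
      rw [lintegral_const_mul' _ _ ENNReal.ofReal_ne_top]
      calc _ ≤ ENNReal.ofReal ((σ ^ J) ^ q)
            * ENNReal.ofReal (C * (((2 : ℝ) ^ (-η)) ^ q) ^ J) := by gcongr; exact hmom J k
        _ = _ := by
          rw [← ENNReal.ofReal_mul (by positivity)]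
          congr 1
          rw [mul_pow σ, mul_pow (σ ^ q), ← pow_mul, ← pow_mul, mul_comm J q]
          ring
    have e4 : ∀ J, ∑ k ∈ I J, ∫⁻ ω, ENNReal.ofReal ((σ ^ J * |D J k ω|) ^ q) ∂P
        ≤ ENNReal.ofReal ((2 * N + 1) * C * ρ ^ J) := by
      intro J
      refine (Finset.sum_le_card_nsmul _ _ _ fun k _ => e2 J k).trans ?_
      rw [nsmul_eq_mul, ← ENNReal.ofReal_natCast, ← ENNReal.ofReal_mul (by positivity)]
      refine ENNReal.ofReal_le_ofReal ?_
      have hcard : ((I J).card : ℝ) ≤ (2 * N + 1) * 2 ^ J := by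
        rw [hI, Int.card_Icc]
        have h5 : ((N : ℤ) * 2 ^ J + 1 - -((N : ℤ) * 2 ^ J)).toNat = 2 * (N * 2 ^ J) + 1 := by
          have : (N : ℤ) * 2 ^ J = ((N * 2 ^ J : ℕ) : ℤ) := by push_cast; ring
          omega
        rw [h5]
        push_cast
        have : (1 : ℝ) ≤ 2 ^ J := one_le_pow₀ (by norm_num)
        nlinarith
      calc _ ≤ (2 * N + 1) * 2 ^ J * (C * ((σ * (2 : ℝ) ^ (-η)) ^ q) ^ J) := by gcongr
        _ = _ := by rw [hρ, mul_pow 2]; ring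
    rw [e1]
    refine ne_top_of_le_ne_top ?_ (ENNReal.tsum_le_tsum e4)
    have hsum : Summable fun J : ℕ => (2 * N + 1) * C * ρ ^ J :=
      (summable_geometric_of_lt_one hρ0 hρ1).mul_left _
    exact hsum.tsum_ofReal_ne_top
  have hae : ∀ᵐ ω ∂P, S ω < ⊤ := ae_lt_top hSm hfin
  refine ⟨fun ω => (S ω).toReal ^ ((q : ℝ)⁻¹), by fun_prop, fun ω => by positivity, ?_⟩
  filter_upwards [hae] with ω hω J k hk
  have hk' : k ∈ I J := by
    rw [hI, Finset.mem_Icc]; exact abs_le.mp hk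
  have h1 : ENNReal.ofReal ((σ ^ J * |D J k ω|) ^ q) ≤ S ω :=
    (Finset.single_le_sum (f := fun k => ENNReal.ofReal ((σ ^ J * |D J k ω|) ^ q))
      (fun _ _ => zero_le) hk').trans (ENNReal.le_tsum J)
  have h2 : (σ ^ J * |D J k ω|) ^ q ≤ (S ω).toReal :=
    (ENNReal.ofReal_le_iff_le_toReal hω.ne).mp h1
  have h3 : σ ^ J * |D J k ω| ≤ (S ω).toReal ^ ((q : ℝ)⁻¹) := by
    have h4 := Real.rpow_le_rpow (by positivity) h2 (show (0 : ℝ) ≤ (q : ℝ)⁻¹ by positivity)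
    rwa [Real.pow_rpow_inv_natCast (by positivity) hq0] at h4
  rw [hσinv, inv_pow, ← div_eq_mul_inv, le_div_iff₀ (by positivity)]
  linarith

/-- Dyadic approximations with small increments in `L^q` converge almost surely, uniformly on
compact sets and with a rate, to a continuous process. -/
lemma exists_continuous_limit {X : ℕ → ℤ → Ω → ℝ} (hX : ∀ J k, Measurable (X J k)) {q : ℕ}
    {η ν C : ℝ} (hC : 0 ≤ C) (hν : 0 < ν) (hq : 1 < q * (η - ν)) (hq0 : q ≠ 0)
    (hrefine : ∀ J k (e : ℤ), 0 ≤ e → e ≤ 1 →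
      ∫⁻ ω, ENNReal.ofReal (|X (J + 1) (2 * k + e) ω - X J k ω| ^ q) ∂P
        ≤ ENNReal.ofReal (C * (((2 : ℝ) ^ (-η)) ^ q) ^ J))
    (hshift : ∀ J k, ∫⁻ ω, ENNReal.ofReal (|X J (k + 1) ω - X J k ω| ^ q) ∂P
        ≤ ENNReal.ofReal (C * (((2 : ℝ) ^ (-η)) ^ q) ^ J)) :
    ∃ V : ℝ → Ω → ℝ, (∀ᵐ ω ∂P, Continuous fun t => V t ω) ∧
      ∀ a b : ℝ, ∃ A : Ω → ℝ, Measurable A ∧ ∀ᵐ ω ∂P, ∀ J : ℕ, ∀ t ∈ Set.Icc a b,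
        |X J ⌊(2 : ℝ) ^ J * t⌋ ω - V t ω| ≤ A ω * (2 : ℝ) ^ (-(J * ν)) := by
  set ρ : ℝ := (2 : ℝ) ^ (-ν) with hρ
  have hρ0 : 0 < ρ := by positivity
  have hρ1 : ρ < 1 := Real.rpow_lt_one_of_one_lt_of_neg (by norm_num) (by linarith)
  have hD0 : ∀ N : ℕ, _ := fun N => exists_uniform_bound (P := P)
    (D := fun J k ω => X (J + 1) (2 * k + 0) ω - X J k ω) (by fun_prop) hC hq hq0
    (fun J k => hrefine J k 0 le_rfl zero_le_one) N
  have hD1 : ∀ N : ℕ, _ := fun N => exists_uniform_bound (P := P)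
    (D := fun J k ω => X (J + 1) (2 * k + 1) ω - X J k ω) (by fun_prop) hC hq hq0
    (fun J k => hrefine J k 1 zero_le_one le_rfl) N
  have hD2 : ∀ N : ℕ, _ := fun N => exists_uniform_bound (P := P)
    (D := fun J k ω => X J (k + 1) ω - X J k ω) (by fun_prop) hC hq hq0 hshift N
  choose A0 hA0m hA0p hA0 using hD0
  choose A1 hA1m hA1p hA1 using hD1
  choose A2 hA2m hA2p hA2 using hD2
  have hall : ∀ᵐ ω ∂P, ∀ N : ℕ, (∀ J : ℕ, ∀ k e : ℤ, |k| ≤ N * 2 ^ J → 0 ≤ e → e ≤ 1 →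
        |X (J + 1) (2 * k + e) ω - X J k ω| ≤ (A0 N ω + A1 N ω + A2 N ω) * ρ ^ J) ∧
      ∀ J : ℕ, ∀ k : ℤ, |k| ≤ N * 2 ^ J →
        |X J (k + 1) ω - X J k ω| ≤ (A0 N ω + A1 N ω + A2 N ω) * ρ ^ J := by
    rw [ae_all_iff]
    intro N
    filter_upwards [hA0 N, hA1 N, hA2 N] with ω h0 h1 h2
    have p0 := hA0p N ω
    have p1 := hA1p N ω
    have p2 := hA2p N ω
    refine ⟨fun J k e hk he0 he1 => ?_, fun J k hk => ?_⟩
    · have hρJ : 0 < ρ ^ J := by positivity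
      obtain rfl | rfl : e = 0 ∨ e = 1 := by omega
      · refine (h0 J k hk).trans ?_
        gcongr; linarith
      · refine (h1 J k hk).trans ?_
        gcongr; linarith
    · refine (h2 J k hk).trans ?_
      gcongr; linarith
  refine ⟨fun t ω => Filter.limUnder Filter.atTop fun J => X J ⌊(2 : ℝ) ^ J * t⌋ ω, ?_, fun a b => ?_⟩
  · filter_upwards [hall] with ω hω
    exact continuous_limUnder (x := fun J k => X J k ω) hρ0 hρ1 fun N => ⟨_, hω N⟩
  · obtain ⟨N, hN⟩ := exists_nat_ge (max |a| |b|)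
    refine ⟨fun ω => (A0 N ω + A1 N ω + A2 N ω) / (1 - ρ), by fun_prop, ?_⟩
    filter_upwards [hall] with ω hω J t ht
    have htN : |t| ≤ N := (abs_le_max_abs_abs ht.1 ht.2).trans hN
    have h1 := abs_sub_limUnder_le (x := fun J k => X J k ω) hρ1 (hω N).1 htN J
    have h2 : (2 : ℝ) ^ (-((J : ℝ) * ν)) = ρ ^ J := by
      rw [hρ, ← Real.rpow_mul_natCast (by norm_num)]; congr 1; ring
    rw [h2]
    refine h1.trans (le_of_eq ?_)
    ring

end moments

/-! ### The algorithm in `L²(P)` -/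

section convolution

variable {Ω : Type*} [MeasurableSpace Ω] {P : Measure Ω} [IsProbabilityMeasure P]

lemma lintegral_enorm_Lp_le (X : Lp ℝ 2 P) : ∫⁻ ω, ‖X ω‖ₑ ∂P ≤ ‖X‖ₑ := by
  rw [← eLpNorm_one_eq_lintegral_enorm, Lp.enorm_def]
  exact eLpNorm_le_eLpNorm_of_exponent_le (by norm_num) (Lp.aestronglyMeasurable X)

/-- The convolution of a summable filter with an `L²`-bounded sequence converges almost surely and
in `L²`, with the same sum. -/
lemma convolve_ae_eq {f : ℤ → ℝ} (hf : Summable fun n => |f n|) {a : ℤ → Lp ℝ 2 P} {C : ℝ}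
    (hC : ∀ k, ‖a k‖ ≤ C) {x : ℤ → Ω → ℝ} (hx : ∀ᵐ ω ∂P, ∀ n, a n ω = x n ω) (k : ℤ) :
    (fun ω => convolve f (fun n => x n ω) k) =ᵐ[P] (∑' n, f n • a (k - n) : Lp ℝ 2 P) := by
  have hs := summable_smul_of_bounded hf hC k
  -- Almost sure absolute convergence, from the `L¹` norms bounded by the `L²` norms. It is needed
  -- because `convolve` uses a pointwise `tsum`, which would be `0` for a divergent series.
  have hfin : ∀ᵐ ω ∂P, ∑' n, ‖(f n • a (k - n) : Lp ℝ 2 P) ω‖ₑ < ⊤ := by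
    have hm : ∀ n, Measurable fun ω => ‖(f n • a (k - n) : Lp ℝ 2 P) ω‖ₑ := fun n =>
      (Lp.stronglyMeasurable _).enorm
    refine ae_lt_top (Measurable.tsum hm) ?_
    rw [lintegral_tsum fun n => (hm n).aemeasurable]
    refine ne_top_of_le_ne_top ?_ (ENNReal.tsum_le_tsum fun n => lintegral_enorm_Lp_le _)
    have h2 : Summable fun n => |f n| * C := hf.mul_right C
    refine ne_top_of_le_ne_top h2.tsum_ofReal_ne_top (ENNReal.tsum_le_tsum fun n => ?_)
    rw [← ofReal_norm, norm_smul, Real.norm_eq_abs]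
    exact ENNReal.ofReal_le_ofReal (by gcongr; exact hC _)
  have hsm : ∀ᵐ ω ∂P, ∀ n : ℤ, (f n • a (k - n) : Lp ℝ 2 P) ω = f n * x (k - n) ω := by
    have : ∀ᵐ ω ∂P, ∀ n : ℤ, (f n • a (k - n) : Lp ℝ 2 P) ω = f n • a (k - n) ω := by
      rw [ae_all_iff]
      intro n
      filter_upwards [Lp.coeFn_smul (f n) (a (k - n))] with ω hω
      rw [hω]; rfl
    filter_upwards [this, hx] with ω h1 h2 n
    rw [h1, h2, smul_eq_mul]
  refine (Lp_tsum_ae_eq hs.hasSum ?_).symm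
  filter_upwards [hfin, hsm] with ω h1 h2
  have h3 : Summable fun n => (f n • a (k - n) : Lp ℝ 2 P) ω := by
    refine Summable.of_norm ?_
    have := ENNReal.summable_toReal h1.ne
    simpa using this
  rw [convolve]
  simp_rw [← h2]
  exact h3.hasSum

variable {M : VelocityModel} {uhat : ℝ → ℂ} {η : ℝ}

lemma map_tsum_upsampleVec {H L : Type*} [NormedAddCommGroup H] [NormedSpace ℝ H]
    [CompleteSpace H] [NormedAddCommGroup L] [NormedSpace ℝ L] (T : H →L[ℝ] L) {f : ℤ → ℝ}
    (hf : Summable fun n => |f n|) {a : ℤ → H} {C : ℝ} (hC : ∀ k, ‖a k‖ ≤ C) (k : ℤ) :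
    T (∑' n, f n • upsampleVec a (k - n)) = ∑' n, f n • upsampleVec (fun m => T (a m)) (k - n) := by
  rw [T.map_tsum (summable_smul_of_bounded hf (norm_upsampleVec_le hC) k)]
  refine tsum_congr fun n => ?_
  rw [map_smul, upsampleVec, upsampleVec, apply_ite T, map_zero]

/-- The discretizations are the images of the scaling vectors. -/
lemma discretization_ae_eq (hh : IsSpectralWeight (spectralFilter M) η) (hu : IsMeyerFilter uhat)
    (T : Lp ℂ 2 (volume : Measure ℝ) →L[ℝ] Lp ℝ 2 P) {V₀ : ℤ → Ω → ℝ} {ε : ℕ → ℤ → Ω → ℝ}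
    (hV : ∀ k, T (scalingVec hh hu 0 k) =ᵐ[P] V₀ k)
    (hε : ∀ j k, T (waveletVec hu j k) =ᵐ[P] ε j k) (J : ℕ) (k : ℤ) :
    T (scalingVec hh hu J k) =ᵐ[P] discretization M uhat V₀ ε J k := by
  induction J generalizing k with
  | zero => exact hV k
  | succ J ih =>
    obtain ⟨C, hC⟩ := norm_scalingVec_le hh hu J
    have hlow := (lowFilter_series M hu J).1
    have hhigh := (highFilter_series M hu J).1
    have hD : ∀ k, ‖waveletVec hu J k‖ ≤ 1 := fun k => (norm_waveletVec hu J k).le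
    have hTC : ∀ k, ‖T (scalingVec hh hu J k)‖ ≤ ‖T‖ * C := fun k => T.le_opNorm_of_le (hC k)
    have hTD : ∀ k, ‖T (waveletVec hu J k)‖ ≤ ‖T‖ * 1 := fun k => T.le_opNorm_of_le (hD k)
    rw [scalingVec_succ M hh hu J k, map_add, map_tsum_upsampleVec T hlow hC,
      map_tsum_upsampleVec T hhigh hD]
    filter_upwards [Lp.coeFn_add
        (∑' n, timeFilter (lowFilterHat M uhat J) n • upsampleVec
          (fun m => T (scalingVec hh hu J m)) (k - n))
        (∑' n, timeFilter (highFilterHat M uhat J) n • upsampleVec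
          (fun m => T (waveletVec hu J m)) (k - n)),
      convolve_ae_eq hlow (norm_upsampleVec_le hTC) (ae_upsampleVec_eq ih) k,
      convolve_ae_eq hhigh (norm_upsampleVec_le hTD) (ae_upsampleVec_eq (hε J)) k] with ω h1 h2 h3
    rw [h1, Pi.add_apply, ← h2, ← h3]
    rfl

end convolution

/-! ### Increments of the scaled discretizations -/

section increments

variable {h : ℝ → ℝ} {uhat : ℝ → ℂ} {η : ℝ}

lemma two_rpow_neg_pow_sq (η : ℝ) (J : ℕ) :
    (((2 : ℝ) ^ (-η)) ^ J) ^ 2 = ((2 : ℝ) ^ J) ^ (-(2 * η)) := by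
  rw [← pow_mul, ← Real.rpow_natCast, ← Real.rpow_natCast, ← Real.rpow_mul (by norm_num),
    ← Real.rpow_mul (by norm_num)]
  congr 1; push_cast; ring

/-- The approximation error and the modulus of continuity of the harmonics have the same order
`2^{-Jη}`. A common constant `√(8I)` serves both, using `2π/3 ≥ 1` for the first and `4 ≤ 8` for the
second. -/
lemma exists_norm_sub_le (hh : IsSpectralWeight h η) (hu : IsMeyerFilter uhat) :
    ∃ B, 0 ≤ B ∧
      (∀ J k, ‖(√2 ^ J) • scalingVec hh hu J k - harmonicVec hh (k / 2 ^ J)‖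
        ≤ B * ((2 : ℝ) ^ (-η)) ^ J) ∧
      ∀ (J : ℕ) (s t : ℝ), |s - t| ≤ ((2 : ℝ) ^ J)⁻¹ →
        ‖harmonicVec hh s - harmonicVec hh t‖ ≤ B * ((2 : ℝ) ^ (-η)) ^ J := by
  set I : ℝ := ∫ x, |x| ^ (2 * η) * h x ^ 2 with hI
  have hI0 : 0 ≤ I := integral_nonneg fun x => by positivity
  have hη := hh.exponent_pos
  refine ⟨√(8 * I), Real.sqrt_nonneg _, fun J k => ?_, fun J s t hst => ?_⟩
  · refine (sq_le_sq₀ (norm_nonneg _) (by positivity)).mp ?_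
    rw [mul_pow, Real.sq_sqrt (by positivity), two_rpow_neg_pow_sq]
    refine (norm_scalingVec_sub_sq_le hh hu J k).trans ?_
    have h1 : ((2 : ℝ) ^ J * (2 * π / 3)) ^ (-(2 * η)) ≤ ((2 : ℝ) ^ J) ^ (-(2 * η)) := by
      refine Real.rpow_le_rpow_of_nonpos (by positivity) ?_ (by linarith)
      have : 1 ≤ 2 * π / 3 := by linarith [Real.pi_gt_three]
      exact le_mul_of_one_le_right (by positivity) this
    rw [← hI]
    calc _ ≤ 8 * (((2 : ℝ) ^ J) ^ (-(2 * η)) * I) := by gcongr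
      _ = _ := by ring
  · refine (sq_le_sq₀ (norm_nonneg _) (by positivity)).mp ?_
    rw [mul_pow, Real.sq_sqrt (by positivity), two_rpow_neg_pow_sq]
    refine (norm_harmonicVec_sub_sq_le hh s t).trans ?_
    have h1 : |s - t| ^ (2 * η) ≤ ((2 : ℝ) ^ J) ^ (-(2 * η)) := by
      rw [Real.rpow_neg (by positivity), ← Real.inv_rpow (by positivity)]
      exact Real.rpow_le_rpow (abs_nonneg _) hst (by linarith)
    rw [← hI]
    have h2 : 0 ≤ ((2 : ℝ) ^ J) ^ (-(2 * η)) := by positivity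
    calc _ ≤ 4 * I * ((2 : ℝ) ^ J) ^ (-(2 * η)) := by gcongr
      _ ≤ _ := by nlinarith

lemma two_rpow_neg_lt_one (hη : 0 < η) : (2 : ℝ) ^ (-η) < 1 :=
  Real.rpow_lt_one_of_one_lt_of_neg (by norm_num) (by linarith)

/-- Both kinds of increments are compared through the harmonics at the corresponding dyadic times,
which lie at distance at most `2^{-J}`. The three errors of the triangle inequality give the factor
`3`. -/
lemma exists_norm_increment_le (hh : IsSpectralWeight h η) (hu : IsMeyerFilter uhat) :
    ∃ B, 0 ≤ B ∧
      (∀ J k (e : ℤ), 0 ≤ e → e ≤ 1 →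
        ‖(√2 ^ (J + 1)) • scalingVec hh hu (J + 1) (2 * k + e) - (√2 ^ J) • scalingVec hh hu J k‖
          ≤ B * ((2 : ℝ) ^ (-η)) ^ J) ∧
      ∀ J k, ‖(√2 ^ J) • scalingVec hh hu J (k + 1) - (√2 ^ J) • scalingVec hh hu J k‖
          ≤ B * ((2 : ℝ) ^ (-η)) ^ J := by
  obtain ⟨B, hB, h1, h2⟩ := exists_norm_sub_le hh hu
  have hρ := two_rpow_neg_lt_one hh.exponent_pos
  have key : ∀ (a b a' b' : Lp ℂ 2 (volume : Measure ℝ)) (r : ℝ), ‖a - a'‖ ≤ r → ‖b - b'‖ ≤ r →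
      ‖a' - b'‖ ≤ r → ‖a - b‖ ≤ 3 * r := by
    intro a b a' b' r e1 e2 e3
    have : a - b = (a - a') + (a' - b') - (b - b') := by abel
    rw [this]
    exact ((norm_sub_le _ _).trans (add_le_add_left (norm_add_le _ _) _)).trans (by linarith)
  refine ⟨3 * B, by positivity, fun J k e he0 he1 => ?_, fun J k => ?_⟩
  · rw [mul_assoc]
    refine key _ _ _ _ _ ((h1 (J + 1) _).trans ?_) (h1 J k) (h2 J _ _ ?_)
    · refine mul_le_mul_of_nonneg_left ?_ hB
      rw [pow_succ]
      exact mul_le_of_le_one_right (by positivity) hρ.le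
    · have e0 : (0 : ℝ) ≤ e := by exact_mod_cast he0
      have e1 : (e : ℝ) ≤ 1 := by exact_mod_cast he1
      have : (((2 * k + e : ℤ) : ℝ) / 2 ^ (J + 1) - k / 2 ^ J) = e / 2 * ((2 : ℝ) ^ J)⁻¹ := by
        push_cast; rw [pow_succ]; field_simp; ring
      rw [this, abs_of_nonneg (by positivity)]
      exact mul_le_of_le_one_left (by positivity) (by linarith)
  · rw [mul_assoc]
    refine key _ _ _ _ _ (h1 J _) (h1 J k) (h2 J _ _ ?_)
    have : (((k + 1 : ℤ) : ℝ) / 2 ^ J - k / 2 ^ J) = ((2 : ℝ) ^ J)⁻¹ := by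
      push_cast; field_simp; ring
    rw [this, abs_of_nonneg (by positivity)]

lemma tendsto_scalingVec (hh : IsSpectralWeight h η) (hu : IsMeyerFilter uhat) (t : ℝ) :
    Filter.Tendsto (fun J : ℕ => (√2 ^ J) • scalingVec hh hu J ⌊(2 : ℝ) ^ J * t⌋) Filter.atTop
      (nhds (harmonicVec hh t)) := by
  obtain ⟨B, hB, h1, h2⟩ := exists_norm_sub_le hh hu
  rw [tendsto_iff_norm_sub_tendsto_zero]
  have hlim : Filter.Tendsto (fun J : ℕ => 2 * B * ((2 : ℝ) ^ (-η)) ^ J) Filter.atTop (nhds 0) := by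
    have := (tendsto_pow_atTop_nhds_zero_of_lt_one (by positivity)
      (two_rpow_neg_lt_one hh.exponent_pos)).const_mul (2 * B)
    simpa using this
  refine squeeze_zero (fun _ => norm_nonneg _) (fun J => ?_) hlim
  have e1 := h1 J ⌊(2 : ℝ) ^ J * t⌋
  have e2 := h2 J (⌊(2 : ℝ) ^ J * t⌋ / 2 ^ J) t (by
    have hp : (0 : ℝ) < 2 ^ J := by positivity
    have : (⌊(2 : ℝ) ^ J * t⌋ : ℝ) / 2 ^ J - t = -(Int.fract ((2 : ℝ) ^ J * t) / 2 ^ J) := by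
      rw [Int.fract]; field_simp; ring
    rw [this, abs_neg, abs_of_nonneg (div_nonneg (Int.fract_nonneg _) hp.le), div_eq_mul_inv]
    exact mul_le_of_le_one_left (by positivity) (Int.fract_lt_one _).le)
  have e3 := norm_sub_le_norm_sub_add_norm_sub ((√2 ^ J) • scalingVec hh hu J ⌊(2 : ℝ) ^ J * t⌋)
    (harmonicVec hh (⌊(2 : ℝ) ^ J * t⌋ / 2 ^ J)) (harmonicVec hh t)
  linarith

end increments

/-! ### The limit process -/

section limit

variable {h : ℝ → ℝ} {uhat : ℝ → ℂ} {η : ℝ} {Ω : Type*} [MeasurableSpace Ω] {P : Measure Ω}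

lemma two_rpow_half (J : ℕ) : (2 : ℝ) ^ ((J : ℝ) / 2) = √2 ^ J := by
  rw [Real.sqrt_eq_rpow, ← Real.rpow_mul_natCast (by norm_num)]
  congr 1; ring

/-- Any exponent below `η` could be reached with `q` large enough. For `η/2` the condition `q (η -
η/2) > 1` reads `q > 2/η`. -/
lemma exists_rate_limit_smul_scalingVec [IsProbabilityMeasure P] (hh : IsSpectralWeight h η)
    (hu : IsMeyerFilter uhat) {T : Lp ℂ 2 (volume : Measure ℝ) →L[ℝ] Lp ℝ 2 P}
    {K : Submodule ℝ (Lp ℂ 2 (volume : Measure ℝ))} (hiso : ∀ x ∈ K, ‖T x‖ = ‖x‖)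
    (hgauss : ∀ x ∈ K, IsCenteredGaussian (T x)) (hsc : ∀ J k, scalingVec hh hu J k ∈ K) :
    ∃ V : ℝ → Ω → ℝ, (∀ᵐ ω ∂P, Continuous fun t => V t ω) ∧
      ∀ a b : ℝ, ∃ A : Ω → ℝ, Measurable A ∧ ∀ᵐ ω ∂P, ∀ J : ℕ, ∀ t ∈ Set.Icc a b,
        |T ((√2 ^ J) • scalingVec hh hu J ⌊(2 : ℝ) ^ J * t⌋) ω - V t ω|
          ≤ A ω * (2 : ℝ) ^ (-(J * (η / 2))) := by
  have hη := hh.exponent_pos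
  obtain ⟨B, hB, h1, h2⟩ := exists_norm_increment_le hh hu
  obtain ⟨q, hq⟩ := exists_nat_gt (2 / η)
  have hq1 : 1 < q * (η - η / 2) := by
    rw [div_lt_iff₀ hη] at hq; linarith
  have hq0 : q ≠ 0 := by rintro rfl; simp at hq1; linarith
  set m : ℝ := ∫ x, |x| ^ q ∂(gaussianReal 0 1) with hm
  have hm0 : 0 ≤ m := integral_nonneg fun x => by positivity
  have hmem : ∀ J k, (√2 ^ J) • scalingVec hh hu J k ∈ K := fun J k => K.smul_mem _ (hsc J k)
  have key : ∀ x ∈ K, ∀ y ∈ K, ∀ J : ℕ, ‖x - y‖ ≤ B * ((2 : ℝ) ^ (-η)) ^ J →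
      ∫⁻ ω, ENNReal.ofReal (|T x ω - T y ω| ^ q) ∂P
        ≤ ENNReal.ofReal (B ^ q * m * (((2 : ℝ) ^ (-η)) ^ q) ^ J) := by
    intro x hx y hy J hxy
    have e1 := (hgauss _ (K.sub_mem hx hy)).lintegral_pow_le q
    have e2 : ∫⁻ ω, ENNReal.ofReal (|T x ω - T y ω| ^ q) ∂P
        = ∫⁻ ω, ENNReal.ofReal (|T (x - y) ω| ^ q) ∂P := by
      refine lintegral_congr_ae ?_
      rw [map_sub]
      filter_upwards [Lp.coeFn_sub (T x) (T y)] with ω hω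
      rw [hω, Pi.sub_apply]
    rw [e2]
    refine e1.trans (ENNReal.ofReal_le_ofReal ?_)
    rw [hiso _ (K.sub_mem hx hy), ← hm]
    calc ‖x - y‖ ^ q * m ≤ (B * ((2 : ℝ) ^ (-η)) ^ J) ^ q * m := by gcongr
      _ = _ := by rw [mul_pow, ← pow_mul, ← pow_mul, mul_comm J q]; ring
  exact exists_continuous_limit (X := fun J k => T ((√2 ^ J) • scalingVec hh hu J k))
    (fun J k => (Lp.stronglyMeasurable _).measurable) (η := η) (ν := η / 2) (C := B ^ q * m)
    (by positivity) (by linarith) hq1 hq0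
    (fun J k e he0 he1 => key _ (hmem _ _) _ (hmem _ _) J (h1 J k e he0 he1))
    (fun J k => key _ (hmem _ _) _ (hmem _ _) J (h2 J k))

/-- The discretizations attached to a Gaussian isometry converge, with a rate, to the image of the
harmonics. -/
lemma exists_rate_limit [IsProbabilityMeasure P] (hh : IsSpectralWeight h η)
    (hu : IsMeyerFilter uhat) {T : Lp ℂ 2 (volume : Measure ℝ) →L[ℝ] Lp ℝ 2 P}
    {K : Submodule ℝ (Lp ℂ 2 (volume : Measure ℝ))} (hiso : ∀ x ∈ K, ‖T x‖ = ‖x‖)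
    (hgauss : ∀ x ∈ K, IsCenteredGaussian (T x)) (hsc : ∀ J k, scalingVec hh hu J k ∈ K)
    {X : ℕ → ℤ → Ω → ℝ} (hX : ∀ J k, T (scalingVec hh hu J k) =ᵐ[P] X J k) :
    ∃ V : ℝ → Ω → ℝ, (∀ᵐ ω ∂P, Continuous fun t => V t ω) ∧ ConvergesWithRate (η / 2) P X V ∧
      ∀ t, T (harmonicVec hh t) =ᵐ[P] V t := by
  have hη := hh.exponent_pos
  obtain ⟨V, hcont, hrate⟩ := exists_rate_limit_smul_scalingVec hh hu hiso hgauss hsc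
  refine ⟨V, hcont, fun a b => ?_, fun t => ?_⟩
  · obtain ⟨A, hA, hAr⟩ := hrate a b
    refine ⟨A, hA, ?_⟩
    have hX' : ∀ᵐ ω ∂P, ∀ J k, T ((√2 ^ J) • scalingVec hh hu J k) ω = √2 ^ J * X J k ω := by
      rw [ae_all_iff]; intro J
      rw [ae_all_iff]; intro k
      rw [map_smul]
      filter_upwards [Lp.coeFn_smul (√2 ^ J) (T (scalingVec hh hu J k)), hX J k] with ω e1 e2
      rw [e1, Pi.smul_apply, e2, smul_eq_mul]
    filter_upwards [hAr, hX'] with ω e1 e2 J t ht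
    rw [two_rpow_half, ← e2]
    exact e1 J t ht
  -- The same sequence tends in measure to `T (harmonicVec hh t)`, by continuity of `T`, and to `V
  -- t`, by the almost sure rate on the degenerate interval `[t, t]`.
  · have h1 : TendstoInMeasure P
        (fun J : ℕ => T ((√2 ^ J) • scalingVec hh hu J ⌊(2 : ℝ) ^ J * t⌋)) Filter.atTop
        (T (harmonicVec hh t)) :=
      tendstoInMeasure_of_tendsto_Lp ((T.continuous.tendsto _).comp (tendsto_scalingVec hh hu t))
    have h2 : TendstoInMeasure P
        (fun J : ℕ => T ((√2 ^ J) • scalingVec hh hu J ⌊(2 : ℝ) ^ J * t⌋)) Filter.atTop (V t) := by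
      refine tendstoInMeasure_of_tendsto_ae (fun J => Lp.aestronglyMeasurable _) ?_
      obtain ⟨A, -, hA⟩ := hrate t t
      filter_upwards [hA] with ω hω
      rw [tendsto_iff_norm_sub_tendsto_zero]
      refine squeeze_zero (fun _ => norm_nonneg _) (fun J => hω J t ⟨le_rfl, le_rfl⟩) ?_
      have e1 := (tendsto_pow_atTop_nhds_zero_of_lt_one (by positivity)
        (two_rpow_neg_lt_one (half_pos hη))).const_mul (A ω)
      rw [mul_zero] at e1
      refine e1.congr fun J => ?_
      rw [← Real.rpow_mul_natCast (by norm_num)]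
      congr 2; ring
    exact tendstoInMeasure_ae_unique h1 h2

/-- A closed subspace containing the coarsest scaling vectors and the wavelets contains all scaling
vectors. -/
lemma scalingVec_mem {M : VelocityModel} (hh : IsSpectralWeight (spectralFilter M) η)
    (hu : IsMeyerFilter uhat) {K : Submodule ℝ (Lp ℂ 2 (volume : Measure ℝ))}
    (hK : IsClosed (K : Set (Lp ℂ 2 (volume : Measure ℝ)))) (h0 : ∀ k, scalingVec hh hu 0 k ∈ K)
    (hw : ∀ j k, waveletVec hu j k ∈ K) (J : ℕ) (k : ℤ) : scalingVec hh hu J k ∈ K := by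
  have hup : ∀ {a : ℤ → Lp ℂ 2 (volume : Measure ℝ)} {C : ℝ} {f : ℤ → ℝ},
      (∀ k, ‖a k‖ ≤ C) → (∀ k, a k ∈ K) → (Summable fun n => |f n|) → ∀ k,
      ∑' n, f n • upsampleVec a (k - n) ∈ K := by
    intro a C f hC ha hf k
    refine hK.mem_of_tendsto
      (summable_smul_of_bounded hf (norm_upsampleVec_le hC) k).hasSum (.of_forall fun s => ?_)
    refine K.sum_mem fun n _ => K.smul_mem _ ?_
    rw [upsampleVec]
    split_ifs
    · exact ha _
    · exact K.zero_mem
  induction J generalizing k with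
  | zero => exact h0 k
  | succ J ih =>
    obtain ⟨C, hC⟩ := norm_scalingVec_le hh hu J
    rw [scalingVec_succ M hh hu J k]
    exact K.add_mem (hup hC ih (lowFilter_series M hu J).1 k)
      (hup (fun k => (norm_waveletVec hu J k).le) (hw J) (highFilter_series M hu J).1 k)

lemma harmonicVec_mem (hh : IsSpectralWeight h η) (hu : IsMeyerFilter uhat)
    {K : Submodule ℝ (Lp ℂ 2 (volume : Measure ℝ))}
    (hK : IsClosed (K : Set (Lp ℂ 2 (volume : Measure ℝ))))
    (hsc : ∀ J k, scalingVec hh hu J k ∈ K) (t : ℝ) : harmonicVec hh t ∈ K :=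
  hK.mem_of_tendsto (tendsto_scalingVec hh hu t)
    (.of_forall fun J => K.smul_mem _ (hsc J _))

end limit

/-! ### Gaussian isometries -/

section isometry

variable {Ω : Type*} [MeasurableSpace Ω] {P : Measure Ω}

/-- `T` maps `K` isometrically into a space of centered Gaussian variables. -/
structure IsGaussianIsometry {H : Type*} [NormedAddCommGroup H] [InnerProductSpace ℝ H]
    (T : H →L[ℝ] Lp ℝ 2 P) (K : Submodule ℝ H) : Prop where
  isometric : ∀ x ∈ K, ∀ y ∈ K, inner ℝ (T x) (T y) = inner ℝ x y
  gaussian : ∀ x ∈ K, IsCenteredGaussian (T x)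

/-- A centered Gaussian process extends to a Gaussian isometry on the closed span of any family of
vectors with the same Gram matrix. -/
lemma exists_isGaussianIsometry [IsProbabilityMeasure P] {ι H : Type*}
    [NormedAddCommGroup H] [InnerProductSpace ℝ H] [CompleteSpace H] {X : ι → Ω → ℝ}
    (hX : IsGaussianProcess X P) (h0 : ∀ i, ∫ ω, X i ω ∂P = 0)
    {w : ι → H} (hw : ∀ i j, ∫ ω, X i ω * X j ω ∂P = inner ℝ (w i) (w j)) :
    ∃ T : H →L[ℝ] Lp ℝ 2 P, (∀ i, T (w i) =ᵐ[P] X i) ∧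
      IsGaussianIsometry T (Submodule.span ℝ (Set.range w)).topologicalClosure := by
  have hm : ∀ i, MemLp (X i) 2 P := fun i => (hX.hasGaussianLaw_eval i).memLp_two
  obtain ⟨T, hT, hin, hmem⟩ := exists_isometric_extension (w := w) (X := fun i => (hm i).toLp)
    fun i j => by
      rw [inner_Lp_eq, ← hw]
      refine integral_congr_ae ?_
      filter_upwards [(hm i).coeFn_toLp, (hm j).coeFn_toLp] with ω e1 e2
      rw [e1, e2]
  refine ⟨T, fun i => ?_, hin, fun x hx => ?_⟩
  · rw [hT]; exact (hm i).coeFn_toLp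
  · exact isCenteredGaussian_of_mem_closure_span hX h0 (fun i => (hm i).coeFn_toLp) (hmem x hx)

variable {H : Type*} [NormedAddCommGroup H] [InnerProductSpace ℝ H] {T : H →L[ℝ] Lp ℝ 2 P}
  {K : Submodule ℝ H}

lemma IsGaussianIsometry.norm_eq (hT : IsGaussianIsometry T K) {x : H} (hx : x ∈ K) :
    ‖T x‖ = ‖x‖ := by
  have h := hT.isometric x hx x hx
  rw [real_inner_self_eq_norm_sq, real_inner_self_eq_norm_sq] at h
  exact (sq_eq_sq₀ (norm_nonneg _) (norm_nonneg _)).mp h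

lemma IsGaussianIsometry.isGaussianProcess (hT : IsGaussianIsometry T K) {ι : Type*} {w : ι → H}
    (hw : ∀ i, w i ∈ K) : IsGaussianProcess (fun i ω => T (w i) ω) P := by
  refine isGaussianProcess_of_mem (S := K.map T.toLinearMap) ?_ (Z := fun i => T (w i))
    fun i => Submodule.mem_map_of_mem (f := T.toLinearMap) (hw i)
  rintro _ ⟨x, hx, rfl⟩
  exact hT.gaussian x hx

lemma IsGaussianIsometry.integral_mul (hT : IsGaussianIsometry T K) {x y : H} (hx : x ∈ K)
    (hy : y ∈ K) : ∫ ω, T x ω * T y ω ∂P = inner ℝ x y := by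
  rw [← inner_Lp_eq, hT.isometric x hx y hy]

lemma IsGaussianIsometry.covariance_eq [IsProbabilityMeasure P]
    (hT : IsGaussianIsometry T K) {x y : H} (hx : x ∈ K)
    (hy : y ∈ K) : cov[T x, T y; P] = inner ℝ x y := by
  rw [covariance_eq_sub (Lp.memLp _) (Lp.memLp _), (hT.gaussian x hx).integral_eq_zero, zero_mul,
    sub_zero, ← hT.integral_mul hx hy]
  rfl

/-- Images of orthogonal vectors are independent. -/
lemma IsGaussianIsometry.iIndepFun [IsProbabilityMeasure P]
    (hT : IsGaussianIsometry T K) {ι : Type*} {w : ι → H}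
    (hw : ∀ i, w i ∈ K) (horth : ∀ i j, i ≠ j → inner ℝ (w i) (w j) = 0) :
    iIndepFun (fun i ω => T (w i) ω) P := by
  -- The criterion concerns independence of processes; each variable is taken as a process indexed
  -- by one point.
  have h1 := IsGaussianProcess.iIndepFun_of_covariance_eq_zero (P := P) (S := fun _ : ι => Unit)
    (X := fun i _ ω => T (w i) ω) (hT.isGaussianProcess (w := fun p : (_ : ι) × Unit => w p.1)
      fun p => hw p.1) (fun i _ => aemeasurable_Lp _)
    fun i j hij _ _ => (hT.covariance_eq (hw i) (hw j)).trans (horth i j hij)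
  exact h1.comp (fun _ a => a ()) fun _ => measurable_pi_apply _

lemma IsGaussianIsometry.indepFun [IsProbabilityMeasure P]
    (hT : IsGaussianIsometry T K) {ι κ : Type*} {w : ι → H}
    {w' : κ → H} (hw : ∀ i, w i ∈ K) (hw' : ∀ i, w' i ∈ K)
    (horth : ∀ i j, inner ℝ (w i) (w' j) = 0) :
    IndepFun (fun ω i => T (w i) ω) (fun ω i => T (w' i) ω) P := by
  refine IsGaussianProcess.indepFun_of_covariance_eq_zero (X := fun i ω => T (w i) ω)
    (Y := fun i ω => T (w' i) ω) ?_ (fun i => aemeasurable_Lp _) (fun i => aemeasurable_Lp _)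
    fun i j => (hT.covariance_eq (hw i) (hw' j)).trans (horth i j)
  have := hT.isGaussianProcess (w := Sum.elim w w') (Sum.rec hw hw')
  refine this.congr fun i => ?_
  rcases i with i | i <;> rfl

end isometry

/-! ### Runs of the algorithm and velocity processes -/

section main

variable {M : VelocityModel} {uhat : ℝ → ℂ} {η : ℝ} {Ω : Type*} [MeasurableSpace Ω] {P : Measure Ω}

/-- The factor `√(2π)` of the discrete filters, squared, cancels the normalization of the
covariance. -/
lemma integral_discreteFilter_zero (M : VelocityModel) (n : ℤ) :
    (2 * π)⁻¹ * ∫ x in (-π)..π, Real.cos ((n : ℝ) * x) * discreteFilter M 0 x ^ 2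
      = ∫ x in (-π)..π, Real.cos ((n : ℝ) * x) * spectralFilter M (wrap x) ^ 2 := by
  rw [← intervalIntegral.integral_const_mul]
  congr 1; funext x
  rw [discreteFilter_eq, mul_pow, Real.sq_sqrt Real.two_pi_pos.le, pow_zero, one_mul]
  field_simp

/-- The images of the coarsest scaling vectors and of the wavelets form an input. -/
lemma IsGaussianIsometry.isSimulationInput [IsProbabilityMeasure P]
    {T : Lp ℂ 2 (volume : Measure ℝ) →L[ℝ] Lp ℝ 2 P}
    {K : Submodule ℝ (Lp ℂ 2 (volume : Measure ℝ))} (hT : IsGaussianIsometry T K)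
    (hh : IsSpectralWeight (spectralFilter M) η) (hu : IsMeyerFilter uhat)
    (h0 : ∀ k, scalingVec hh hu 0 k ∈ K) (hw : ∀ j k, waveletVec hu j k ∈ K) :
    IsSimulationInput M P (fun k ω => T (scalingVec hh hu 0 k) ω)
      (fun j k ω => T (waveletVec hu j k) ω) where
  gaussian := hT.isGaussianProcess h0
  centered k := (hT.gaussian _ (h0 k)).integral_eq_zero
  covariance k l := by
    rw [hT.integral_mul (h0 k) (h0 l), inner_scalingVec_zero, integral_discreteFilter_zero]
  noise_law j k := by
    have h := (hT.gaussian _ (hw j k)).hasLaw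
    have h1 : ‖T (waveletVec hu j k)‖₊ = 1 := by
      ext
      rw [coe_nnnorm, hT.norm_eq (hw j k), norm_waveletVec, NNReal.coe_one]
    rwa [h1, one_pow] at h
  noise_indep := hT.iIndepFun (w := fun i : ℕ × ℤ => waveletVec hu i.1 i.2) (fun i => hw _ _)
    fun i j hij => by rw [inner_waveletVec, if_neg hij]
  indep := hT.indepFun (w' := fun i : ℕ × ℤ => waveletVec hu i.1 i.2) h0 (fun i => hw _ _)
    fun k i => inner_scalingVec_waveletVec hh hu k i.2 i.1

lemma IsSimulationInput.integral_noise {V₀ : ℤ → Ω → ℝ} {ε : ℕ → ℤ → Ω → ℝ}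
    (hin : IsSimulationInput M P V₀ ε) (j : ℕ) (k : ℤ) : ∫ ω, ε j k ω ∂P = 0 := by
  rw [(hin.noise_law j k).integral_eq, integral_id_gaussianReal]

lemma IsSimulationInput.integral_noise_mul [IsProbabilityMeasure P]
    {V₀ : ℤ → Ω → ℝ} {ε : ℕ → ℤ → Ω → ℝ}
    (hin : IsSimulationInput M P V₀ ε) (i i' : ℕ × ℤ) :
    ∫ ω, ε i.1 i.2 ω * ε i'.1 i'.2 ω ∂P = if i = i' then 1 else 0 := by
  have hm : ∀ i : ℕ × ℤ, AEMeasurable (ε i.1 i.2) P := fun i => (hin.noise_law _ _).aemeasurable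
  split_ifs with hi
  · subst hi
    have h1 := variance_of_integral_eq_zero (hm i) (hin.integral_noise i.1 i.2)
    rw [(hin.noise_law _ _).variance_eq, variance_id_gaussianReal, NNReal.coe_one] at h1
    simp_rw [← pow_two]
    exact h1.symm
  · rw [(hin.noise_indep.indepFun hi).integral_fun_mul_eq_mul_integral
      (hm i).aestronglyMeasurable (hm i').aestronglyMeasurable, hin.integral_noise, zero_mul]

lemma IsSimulationInput.integral_mul_noise {V₀ : ℤ → Ω → ℝ} {ε : ℕ → ℤ → Ω → ℝ}
    (hin : IsSimulationInput M P V₀ ε) (k : ℤ) (i : ℕ × ℤ) :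
    ∫ ω, V₀ k ω * ε i.1 i.2 ω ∂P = 0 := by
  have h1 : IndepFun (V₀ k) (ε i.1 i.2) P :=
    hin.indep.comp (φ := fun a : ℤ → ℝ => a k) (ψ := fun a : ℕ × ℤ → ℝ => a i)
      (measurable_pi_apply _) (measurable_pi_apply _)
  rw [h1.integral_fun_mul_eq_mul_integral
    (hin.gaussian.hasGaussianLaw_eval k).aemeasurable.aestronglyMeasurable
    (hin.noise_law _ _).aemeasurable.aestronglyMeasurable, hin.centered, zero_mul]

/-- Every run of the algorithm converges to a velocity process. -/
lemma exists_velocityProcess [IsProbabilityMeasure P] (hh : IsSpectralWeight (spectralFilter M) η)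
    (hu : IsMeyerFilter uhat)
    {V₀ : ℤ → Ω → ℝ} {ε : ℕ → ℤ → Ω → ℝ} (hin : IsSimulationInput M P V₀ ε) :
    ∃ V : ℝ → Ω → ℝ, IsVelocityProcess M P V ∧
      ConvergesWithRate (η / 2) P (discretization M uhat V₀ ε) V := by
  set w : ℤ ⊕ (ℕ × ℤ) → Lp ℂ 2 (volume : Measure ℝ) :=
    Sum.elim (scalingVec hh hu 0) fun i => waveletVec hu i.1 i.2 with hwdef
  obtain ⟨T, hTw, hT⟩ := exists_isGaussianIsometry (w := w) hin.isGaussianProcess_elim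
    (by rintro (k | i); exacts [hin.centered k, hin.integral_noise _ _])
    (by
      rintro (k | i) (l | i')
      · refine (hin.covariance k l).trans ?_
        rw [integral_discreteFilter_zero]
        exact (inner_scalingVec_zero hh hu k l).symm
      · exact (hin.integral_mul_noise k i').trans
          (inner_scalingVec_waveletVec hh hu k i'.2 i'.1).symm
      · have h1 := hin.integral_mul_noise l i
        simp_rw [mul_comm (V₀ l _)] at h1
        refine h1.trans ?_
        rw [real_inner_comm]
        exact (inner_scalingVec_waveletVec hh hu l i.2 i.1).symm
      · exact (hin.integral_noise_mul i i').trans (inner_waveletVec hu i i').symm)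
  set K := (Submodule.span ℝ (Set.range w)).topologicalClosure with hK
  have hwK : ∀ i, w i ∈ K := fun i =>
    Submodule.le_topologicalClosure _ (Submodule.subset_span ⟨i, rfl⟩)
  have hclosed := Submodule.isClosed_topologicalClosure (Submodule.span ℝ (Set.range w))
  -- In this direction the recursion and the limit `J → ∞` place all vectors in `K`; density of the
  -- harmonics is not needed.
  have hsc := scalingVec_mem hh hu hclosed (fun k => hwK (Sum.inl k))
    (fun j k => hwK (Sum.inr (j, k)))
  have hharm := harmonicVec_mem hh hu hclosed hsc
  obtain ⟨V, hcont, hrate, hV⟩ := exists_rate_limit hh hu (fun x hx => hT.norm_eq hx) hT.gaussian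
    hsc (discretization_ae_eq hh hu T (fun k => hTw (Sum.inl k)) fun j k => hTw (Sum.inr (j, k)))
  refine ⟨V, ⟨(hT.isGaussianProcess hharm).congr hV, fun t => ?_, fun s t => ?_, hcont⟩, hrate⟩
  · rw [← integral_congr_ae (hV t)]
    exact (hT.gaussian _ (hharm t)).integral_eq_zero
  · rw [← inner_harmonicVec hh, ← hT.integral_mul (hharm s) (hharm t)]
    refine integral_congr_ae ?_
    filter_upwards [hV s, hV t] with ω e1 e2
    rw [e1, e2]

/-- Every velocity process is the limit of a run of the algorithm. -/
lemma exists_simulationInput [IsProbabilityMeasure P] (hh : IsSpectralWeight (spectralFilter M) η)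
    (hu : IsMeyerFilter uhat)
    {V : ℝ → Ω → ℝ} (hV : IsVelocityProcess M P V) :
    ∃ (V₀ : ℤ → Ω → ℝ) (ε : ℕ → ℤ → Ω → ℝ), IsSimulationInput M P V₀ ε ∧
      ConvergesWithRate (η / 2) P (discretization M uhat V₀ ε) V := by
  obtain ⟨T, hTw, hT⟩ := exists_isGaussianIsometry (w := harmonicVec hh) hV.gaussian hV.centered
    fun s t => (hV.covariance s t).trans (inner_harmonicVec hh s t).symm
  -- Here density is essential: it lets `T` be evaluated on the wavelets, so that the noises are
  -- functionals of `V` and no enlargement of the probability space is required.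
  have hsc := scalingVec_mem_closure_span hh hu
  have hwv := waveletVec_mem_closure_span hh hu
  refine ⟨_, _, hT.isSimulationInput hh hu (hsc 0) hwv, ?_⟩
  obtain ⟨V', hcont, hrate, hV'⟩ := exists_rate_limit hh hu (fun x hx => hT.norm_eq hx) hT.gaussian
    hsc (discretization_ae_eq hh hu T (fun k => ae_eq_rfl) fun j k => ae_eq_rfl)
  -- The limit `V'` agrees with `V` only almost surely at each fixed time. A countable dense set of
  -- times and the continuity of both paths remove the dependence of the null set on `t`.
  have heq : ∀ᵐ ω ∂P, ∀ r : ℚ, V' r ω = V r ω := by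
    rw [ae_all_iff]
    exact fun r => (hV' r).symm.trans (hTw r)
  intro a b
  obtain ⟨A, hA, hAr⟩ := hrate a b
  refine ⟨A, hA, ?_⟩
  filter_upwards [hAr, heq, hcont, hV.continuous] with ω e1 e2 e3 e4 J t ht
  have e5 : (fun t => V' t ω) = fun t => V t ω := by
    refine Continuous.ext_on Rat.denseRange_cast e3 e4 ?_
    rintro _ ⟨r, rfl⟩
    exact e2 r
  rw [← congrFun e5 t]
  exact e1 J t ht

end main

end AnomalousDiffusion

end

theorem theorem1 (M : AnomalousDiffusion.VelocityModel) :
    ∃ ν : ℝ, 0 < ν ∧ ν < 1 ∧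
      ∀ uhat : ℝ → ℂ, AnomalousDiffusion.IsMeyerFilter uhat →
      ∀ (Ω : Type*) [MeasurableSpace Ω] (P : Measure Ω) [IsProbabilityMeasure P],
        -- every run of the algorithm converges to a velocity process
        (∀ (V₀ : ℤ → Ω → ℝ) (ε : ℕ → ℤ → Ω → ℝ),
          AnomalousDiffusion.IsSimulationInput M P V₀ ε →
          ∃ V : ℝ → Ω → ℝ, AnomalousDiffusion.IsVelocityProcess M P V ∧
            AnomalousDiffusion.ConvergesWithRate ν P
              (AnomalousDiffusion.discretization M uhat V₀ ε) V) ∧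
        -- every velocity process is the limit of a run of the algorithm
        (∀ V : ℝ → Ω → ℝ, AnomalousDiffusion.IsVelocityProcess M P V →
          ∃ (V₀ : ℤ → Ω → ℝ) (ε : ℕ → ℤ → Ω → ℝ),
            AnomalousDiffusion.IsSimulationInput M P V₀ ε ∧
            AnomalousDiffusion.ConvergesWithRate ν P
              (AnomalousDiffusion.discretization M uhat V₀ ε) V) := by
  obtain ⟨η, hh⟩ := AnomalousDiffusion.exists_isSpectralWeight M
  have h0 := hh.exponent_pos
  have h1 := hh.exponent_lt_one
  -- Since `η` comes from the spectral filter alone, the rate is fixed before `û` and the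
  -- probability space.
  refine ⟨η / 2, by linarith, by linarith, fun uhat hu Ω _ P _ => ⟨fun V₀ ε hin => ?_,
    fun V hV => ?_⟩⟩
  · exact AnomalousDiffusion.exists_velocityProcess hh hu hin
  · exact AnomalousDiffusion.exists_simulationInput hh hu hV
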